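/- For a prime $p$, a cubic local specification $\Sigma_p$ is a set of isomorphism classes of étale cubic algebras over $\mathbb{Q}_p$. Let $A_p$ be the set of all of these, and $A_p'$ the set of those that are not totally ramified; call $\Sigma_p$ ordinary if $\Sigma_p=A_p$ or $\Sigma_p=A_p'$. Let $\Sigma=(\Sigma_p)_p$ be a collection of cubic local specifications that is ordinary at all but finitely many primes. A quadratic field $F$ satisfies $\Sigma$ if $(F\times\mathbb{Q})\otimes_{\mathbb{Q}}\mathbb{Q}_p\in\Sigma_p$ for all $p$. Let $U$, $s$ and $r$ be the products of those primes $p$ at which $\Sigma_p$ is not ordinary and for which, respectively: $\Sigma_p$ contains at least one unramified algebra; $\Sigma_p$ consists of a single algebra $F\times\mathbb{Q}_p$ where $F$ is a ramified quadratic extension of $\mathbb{Q}_p$; $\Sigma_p$ consists of all algebras $F\times\mathbb{Q}_p$ where $F$ is a ramified quadratic extension of $\mathbb{Q}_p$. **Proposition 4.2.** For a choice of sign $\pm$ and $X>0$, let $N_2^{\pm}(X,\Sigma)$ be the (finite) number of quadratic fields $F$, up to isomorphism, with $0<\pm\mathrm{Disc}(F)<X$ that satisfy $\Sigma$. Then for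 every $\epsilon>0$ $$N_2^{\pm}(X,\Sigma)=\prod_p c_p(\Sigma_p)\cdot\frac{3}{\pi^2}X+O_\epsilon\!\left(X^{1/2}\,\frac{U^{1/4}}{s^{1/4}r^{1/2}}\,(Usr)^{\epsilon}\right),$$ where the implied constant depends only on $\epsilon$ (not on $X$, the sign, or $\Sigma$), and $$c_p(\Sigma_p)=\frac{\displaystyle\sum_{F\,:\,F\times\mathbb{Q}_p\in\Sigma_p}\frac{1}{\mathrm{Disc}_p(F)}\frac{1}{|\mathrm{Aut}(F)|}}{\displaystyle\sum_{F\,:\,F\times\mathbb{Q}_p\in A_p}\frac{1}{\mathrm{Disc}_p(F)}\frac{1}{|\mathrm{Aut}(F)|}}.$$ Here the sums run over isomorphism classes of quadratic étale algebras $F$ over $\mathbb{Q}_p$ (including $\mathbb{Q}_p\times\mathbb{Q}_p$), $\mathrm{Aut}(F)$ is the group of $\mathbb{Q}_p$-algebra automorphisms of $F$, and $\mathrm{Disc}_p(F)$ is the power of $p$ that generates the discriminant ideal of the maximal order of $F$ over $\mathbb{Z}_p$. -/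

import Mathlib

open scoped TensorProduct

noncomputable section

namespace QuadCount

/-- An étale algebra of degree `n` over a field `K`. -/
structure EtaleAlgebra (K : Type) [Field K] (n : ℕ) where
  carrier : Type
  [commRing : CommRing carrier]
  [algebra : Algebra K carrier]
  [etale : Algebra.Etale K carrier]
  finrank_eq : Module.finrank K carrier = n

namespace EtaleAlgebra

attribute [instance] commRing algebra etale

variable {K : Type} [Field K] {n : ℕ}

instance finite (A : EtaleAlgebra K n) : Module.Finite K A.carrier :=
  Algebra.FormallyUnramified.finite_of_free K A.carrier

/-- Isomorphism of étale algebras over `K`. -/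
instance setoid (K : Type) [Field K] (n : ℕ) : Setoid (EtaleAlgebra K n) where
  r A B := Nonempty (A.carrier ≃ₐ[K] B.carrier)
  iseqv :=
    { refl := fun _ => ⟨AlgEquiv.refl⟩
      symm := fun ⟨e⟩ => ⟨e.symm⟩
      trans := fun ⟨e⟩ ⟨f⟩ => ⟨e.trans f⟩ }

end EtaleAlgebra

/-- Isomorphism classes of étale algebras of degree `n` over `K`. -/
def EtaleClass (K : Type) [Field K] (n : ℕ) : Type 1 :=
  Quotient (EtaleAlgebra.setoid K n)

/-- The isomorphism class of an étale algebra. -/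
def EtaleAlgebra.toClass {K : Type} [Field K] {n : ℕ} (A : EtaleAlgebra K n) : EtaleClass K n :=
  Quotient.mk (EtaleAlgebra.setoid K n) A

theorem etale_prod_aux {K : Type} [Field K] {m n : ℕ} (A : EtaleAlgebra K m)
    (B : EtaleAlgebra K n) : Algebra.Etale K (A.carrier × B.carrier) := by
  let N : Bool → Σ n, EtaleAlgebra K n := fun b => Bool.rec ⟨m, A⟩ ⟨n, B⟩ b
  let e : (∀ b, (N b).2.carrier) ≃ₐ[K] A.carrier × B.carrier :=
    { toFun := fun f => (f false, f true)
      invFun := fun x b => Bool.rec x.1 x.2 b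
      left_inv := fun f => by funext b; cases b <;> rfl
      right_inv := fun _ => rfl
      map_mul' := fun _ _ => rfl
      map_add' := fun _ _ => rfl
      commutes' := fun _ => rfl }
  exact Algebra.Etale.of_equiv e

/-- The product of two étale algebras over a field is étale. -/
theorem etale_prod (K A B : Type) [Field K] [CommRing A] [CommRing B] [Algebra K A] [Algebra K B]
    [Algebra.Etale K A] [Algebra.Etale K B] : Algebra.Etale K (A × B) :=
  etale_prod_aux (K := K) ⟨A, rfl⟩ ⟨B, rfl⟩

/-- The étale algebra `F × K` over `K`. -/
def EtaleAlgebra.prodBase {K : Type} [Field K] {n : ℕ} (F : EtaleAlgebra K n) :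
    EtaleAlgebra K (n + 1) where
  carrier := F.carrier × K
  etale := etale_prod K F.carrier K
  finrank_eq := by rw [Module.finrank_prod, F.finrank_eq, Module.finrank_self]

/-- The étale algebra `L ⊗ F` over `L`, for a field extension `L` of `K`. -/
def EtaleAlgebra.baseChange {K : Type} [Field K] {n : ℕ} (F : EtaleAlgebra K n)
    (L : Type) [Field L] [Algebra K L] : EtaleAlgebra L n where
  carrier := L ⊗[K] F.carrier
  finrank_eq := by rw [Module.finrank_baseChange, F.finrank_eq]

/-- The map on isomorphism classes induced by `F ↦ F × K`. -/
def EtaleClass.prodBase {K : Type} [Field K] {n : ℕ} (F : EtaleClass K n) :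
    EtaleClass K (n + 1) :=
  Quotient.liftOn F (fun A => A.prodBase.toClass)
    (fun _ _ h => h.elim fun e => Quotient.sound ⟨AlgEquiv.prodCongr e AlgEquiv.refl⟩)

section Local

variable {p : ℕ} [Fact p.Prime] {n : ℕ}

instance (F : EtaleAlgebra ℚ_[p] n) : Algebra ℤ_[p] F.carrier :=
  Algebra.compHom F.carrier (algebraMap ℤ_[p] ℚ_[p])

instance (F : EtaleAlgebra ℚ_[p] n) : IsScalarTower ℤ_[p] ℚ_[p] F.carrier :=
  IsScalarTower.of_algebraMap_eq' rfl

/-- The maximal order of an étale algebra over `ℚ_p`. -/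
abbrev maxOrder (F : EtaleAlgebra ℚ_[p] n) : Subalgebra ℤ_[p] F.carrier :=
  integralClosure ℤ_[p] F.carrier

/-- `F` is unramified: its maximal order is unramified over `ℤ_p`. -/
def IsUnramified (F : EtaleAlgebra ℚ_[p] n) : Prop :=
  Algebra.FormallyUnramified ℤ_[p] (maxOrder F)

/-- `F` is totally ramified: it is a field, and `p` generates the `n`-th power of the maximal
ideal of its ring of integers. -/
def IsTotallyRamified (F : EtaleAlgebra ℚ_[p] n) : Prop :=
  IsField F.carrier ∧
    ∃ P : Ideal (maxOrder F), P.IsMaximal ∧ Ideal.span {(p : maxOrder F)} = P ^ n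

/-- The discriminant ideal of the maximal order of `F` over `ℤ_p`: the ideal generated by the
discriminants `det (Tr (b i * b j))` of all `n`-tuples `b` in the maximal order. -/
def discIdeal (F : EtaleAlgebra ℚ_[p] n) : Ideal ℤ_[p] :=
  Ideal.span {z : ℤ_[p] | ∃ b : Fin n → maxOrder F,
    (z : ℚ_[p]) = Algebra.discr ℚ_[p] (fun i => (b i : F.carrier))}

/-- `Disc_p(F)`, the power of `p` generating the discriminant ideal of `F`; it equals the
index of that ideal in `ℤ_p`. -/
def discP (F : EtaleAlgebra ℚ_[p] n) : ℕ :=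
  Nat.card (ℤ_[p] ⧸ discIdeal F)

/-- The local mass `1 / Disc_p(F) * 1 / |Aut(F)|`. -/
def mass (F : EtaleAlgebra ℚ_[p] n) : ℝ :=
  1 / (discP F : ℝ) * (1 / (Nat.card (F.carrier ≃ₐ[ℚ_[p]] F.carrier) : ℝ))

theorem discIdeal_le (F G : EtaleAlgebra ℚ_[p] n) (e : F.carrier ≃ₐ[ℚ_[p]] G.carrier) :
    discIdeal F ≤ discIdeal G := by
  refine Ideal.span_mono ?_
  rintro z ⟨b, hb⟩
  refine ⟨fun i => ⟨e (b i), ?_⟩, ?_⟩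
  · exact IsIntegral.map (e.restrictScalars ℤ_[p]) (b i).2
  · rw [hb, Algebra.discr_eq_discr_of_algEquiv (fun i => (b i : F.carrier)) e]
    rfl

theorem mass_congr (F G : EtaleAlgebra ℚ_[p] n) (h : Nonempty (F.carrier ≃ₐ[ℚ_[p]] G.carrier)) :
    mass F = mass G := by
  obtain ⟨e⟩ := h
  have h1 : discIdeal F = discIdeal G := le_antisymm (discIdeal_le F G e) (discIdeal_le G F e.symm)
  have h2 : Nat.card (F.carrier ≃ₐ[ℚ_[p]] F.carrier) = Nat.card (G.carrier ≃ₐ[ℚ_[p]] G.carrier) :=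
    Nat.card_congr e.autCongr.toEquiv
  simp only [mass, discP, h1, h2]

/-- The local mass of an isomorphism class. -/
def EtaleClass.mass (F : EtaleClass ℚ_[p] n) : ℝ :=
  Quotient.lift QuadCount.mass mass_congr F

/-- `Σ_p` is ordinary: it is the set of all étale cubic algebras over `ℚ_p`, or the set of all
those that are not totally ramified. -/
def IsOrdinary (S : Set (EtaleClass ℚ_[p] 3)) : Prop :=
  S = Set.univ ∨
    S = {c | ∃ A : EtaleAlgebra ℚ_[p] 3, ¬ IsTotallyRamified A ∧ A.toClass = c}

/-- `Σ_p` contains at least one unramified algebra. -/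
def HasUnramified (S : Set (EtaleClass ℚ_[p] 3)) : Prop :=
  ∃ A : EtaleAlgebra ℚ_[p] 3, IsUnramified A ∧ A.toClass ∈ S

/-- `Σ_p` consists of a single algebra `F × ℚ_p` with `F` ramified quadratic. -/
def IsSingleRamified (S : Set (EtaleClass ℚ_[p] 3)) : Prop :=
  ∃ F : EtaleAlgebra ℚ_[p] 2, ¬ IsUnramified F ∧ S = {F.prodBase.toClass}

/-- `Σ_p` consists of all algebras `F × ℚ_p` with `F` ramified quadratic. -/
def IsAllRamified (S : Set (EtaleClass ℚ_[p] 3)) : Prop :=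
  S = {c | ∃ F : EtaleAlgebra ℚ_[p] 2, ¬ IsUnramified F ∧ F.prodBase.toClass = c}

/-- The local density `c_p(Σ_p)`. The sums run over isomorphism classes of quadratic étale
algebras `F` over `ℚ_p`; in the denominator there is no condition on `F × ℚ_p`. -/
def localDensity (S : Set (EtaleClass ℚ_[p] 3)) : ℝ :=
  (∑ᶠ (F : EtaleClass ℚ_[p] 2) (_ : F.prodBase ∈ S), F.mass) /
    (∑ᶠ F : EtaleClass ℚ_[p] 2, F.mass)

end Local

instance primesFact (p : Nat.Primes) : Fact (p : ℕ).Prime := ⟨p.2⟩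

/-- A collection `Σ = (Σ_p)_p` of cubic local specifications, ordinary at all but finitely
many primes. -/
structure CubicSpec where
  loc : ∀ p : Nat.Primes, Set (EtaleClass ℚ_[p] 3)
  finite_not_ordinary : {p : Nat.Primes | ¬ IsOrdinary (loc p)}.Finite

namespace CubicSpec

variable (S : CubicSpec)

/-- The set of prime factors of the conductor `M` of `Σ`, that is, of the primes at which `Σ` is
not ordinary. -/
def badPrimes : Set Nat.Primes := {p | ¬ IsOrdinary (S.loc p)}

/-- The product of the primes `p ∣ M` such that `Σ_p` contains an unramified algebra. -/
def U : ℕ := ∏ᶠ (p : Nat.Primes) (_ : p ∈ S.badPrimes ∧ HasUnramified (S.loc p)), (p : ℕ)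

/-- The product of the primes `p ∣ M` such that `Σ_p` consists of a single algebra `F × ℚ_p`
with `F` ramified. -/
def s : ℕ := ∏ᶠ (p : Nat.Primes) (_ : p ∈ S.badPrimes ∧ IsSingleRamified (S.loc p)), (p : ℕ)

/-- The product of the primes `p ∣ M` such that `Σ_p` consists of all algebras `F × ℚ_p` with `F`
ramified. -/
def r : ℕ := ∏ᶠ (p : Nat.Primes) (_ : p ∈ S.badPrimes ∧ IsAllRamified (S.loc p)), (p : ℕ)

end CubicSpec

/-- A quadratic number field. -/
structure QuadraticField where
  carrier : Type
  [field : Field carrier]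
  [numberField : NumberField carrier]
  finrank_eq : Module.finrank ℚ carrier = 2

namespace QuadraticField

attribute [instance] field numberField

/-- Isomorphism of quadratic fields. -/
instance setoid : Setoid QuadraticField where
  r F G := Nonempty (F.carrier ≃+* G.carrier)
  iseqv :=
    { refl := fun _ => ⟨RingEquiv.refl _⟩
      symm := fun ⟨e⟩ => ⟨e.symm⟩
      trans := fun ⟨e⟩ ⟨f⟩ => ⟨e.trans f⟩ }

/-- A quadratic field as an étale algebra over `ℚ`. -/
def toEtale (F : QuadraticField) : EtaleAlgebra ℚ 2 where
  carrier := F.carrier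
  etale :=
    { formallyEtale := Algebra.FormallyEtale.of_isSeparable ℚ F.carrier
      finitePresentation := Algebra.FinitePresentation.of_finiteType.mp inferInstance }
  finrank_eq := F.finrank_eq

/-- `F` satisfies `Σ`: the cubic étale algebra `(F × ℚ) ⊗ ℚ_p` lies in `Σ_p` for all `p`. -/
def Satisfies (F : QuadraticField) (S : CubicSpec) : Prop :=
  ∀ p : Nat.Primes, (F.toEtale.prodBase.baseChange ℚ_[p]).toClass ∈ S.loc p

end QuadraticField

/-- The set of isomorphism classes of quadratic fields `F` with `0 < ± Disc(F) < X` that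
satisfy `Σ`; the sign is `σ`. -/
def quadraticFields (σ : ℤˣ) (X : ℝ) (S : CubicSpec) : Set (Quotient QuadraticField.setoid) :=
  {c | ∃ F : QuadraticField, Quotient.mk QuadraticField.setoid F = c ∧
    0 < (σ : ℤ) * NumberField.discr F.carrier ∧
    (((σ : ℤ) * NumberField.discr F.carrier : ℤ) : ℝ) < X ∧ F.Satisfies S}

/-- `N_2^±(X, Σ)`, the number of such quadratic fields. -/
def N₂ (σ : ℤˣ) (X : ℝ) (S : CubicSpec) : ℕ := (quadraticFields σ X S).ncard

end QuadCount

end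

/-! A quadratic field is `ℚ(√n)` for a unique squarefree `n ≠ 1`, and its behaviour at `p` depends
only on the class of `n` in `ℚ_p^×` modulo squares. Since `F × ℚ_p` is never a field, ordinary
primes impose no condition. For odd `p` there are four square classes, given by the parity of the
valuation and the residue symbol of the unit part; for `p = 2` there are eight, given by the parity
of the valuation and the unit part modulo `8`.

Write `n = ± 2^i g m` with `g` a product of odd bad primes and `m` odd and coprime to all odd bad
primes. With the class at `2` and `g` fixed, `|Disc|` is a fixed multiple of `m`, and the indicator
of `Σ` is a product over odd bad `p` of factors `α_p + β_p (m | p)` (`indicator_eq_prod`). Expanding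
it gives sums of `(m | q)` over squarefree `m` in a class modulo `8`, where `q` runs over products
of odd bad primes (`abs_sum_prod_sub_le`).

The term `q = 1` carries the main term, and the local factors recombine into the densities `c_p`.
For `q > 1` the Pólya–Vinogradov inequality bounds a sum over an interval by about `q^(1/2)`. Möbius
inversion over square divisors `d²` then leaves `∑ min(Y/d², q^(1/2+η))`, which is of order `(Y
q^(1/2+η))^(1/2)` (`sum_min_le`, `abs_sqfSum_sub_le`); hence the exponents `1/2` of `X` and `1/4` of
`q`.

As `Y` is at most `X/g`, the error is `√X` times a product of local factors: `p^(1/4)` when `Σ_p`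
distinguishes residue classes, and `p^(-1/2)` when `p` divides `g`. An unramified algebra thus costs
`p^(1/4)`, a single ramified one `p^(1/4 - 1/2) = p^(-1/4)`, all ramified ones together `p^(-1/2)`,
because there `β_p = 0` (`errorFactor_add_le`). Constants per prime are absorbed by `p^ε` outside a
finite set of primes that depends only on `ε`. -/

noncomputable section

namespace QuadCount

/-! ### Quadratic étale algebras over a field as `K[√a]`. -/

section Generic

variable {K : Type} [Field K]

/-- The differentials `D s` span the Kähler module. Every proof of unramifiedness below thereby
becomes a computation with derivations. -/
theorem formallyUnramified_of_D_eq_zero (R S : Type*) [CommRing R] [CommRing S] [Algebra R S]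
    (h : ∀ s : S, KaehlerDifferential.D R S s = 0) : Algebra.FormallyUnramified R S := by
  refine ⟨⟨fun x y => ?_⟩⟩
  have key : ∀ z : Ω[S⁄R], z = 0 := by
    intro z
    have hz : z ∈ (⊤ : Submodule S (Ω[S⁄R])) := trivial
    rw [← KaehlerDifferential.span_range_derivation] at hz
    induction hz using Submodule.span_induction with
    | mem x hx => obtain ⟨s, rfl⟩ := hx; exact h s
    | zero => rfl
    | add x y _ _ hx hy => rw [hx, hy, add_zero]
    | smul a x _ hx => rw [hx, smul_zero]
  rw [key x, key y]

theorem etale_quadraticAlgebra {a : K} (h2 : (2 : K) ≠ 0) (ha : a ≠ 0) :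
    Algebra.Etale K (QuadraticAlgebra K a 0) := by
  have h : Algebra.FormallyUnramified K (QuadraticAlgebra K a 0) := by
    apply formallyUnramified_of_D_eq_zero
    set D := KaehlerDifferential.D K (QuadraticAlgebra K a 0)
    have hω : D QuadraticAlgebra.omega = 0 := by
      have h1 : D (QuadraticAlgebra.omega * QuadraticAlgebra.omega) = 0 := by
        rw [show (QuadraticAlgebra.omega : QuadraticAlgebra K a 0) * QuadraticAlgebra.omega
          = algebraMap K _ a by ext <;> simp]
        exact D.map_algebraMap a
      -- Here `2 ω · Dω = D a = 0`; multiplying by `ω` turns the coefficient into the invertible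
      -- scalar `a`.
      rw [D.leibniz, ← two_smul K, smul_eq_zero_iff_right h2] at h1
      have h3 := congrArg (fun t => (QuadraticAlgebra.omega : QuadraticAlgebra K a 0) • t) h1
      simp only [smul_zero, smul_smul] at h3
      rw [show (QuadraticAlgebra.omega : QuadraticAlgebra K a 0) * QuadraticAlgebra.omega
          = algebraMap K _ a by ext <;> simp, algebraMap_smul, smul_eq_zero_iff_right ha] at h3
      exact h3
    rintro ⟨x, y⟩
    rw [QuadraticAlgebra.mk_eq_add_smul_omega, map_add, D.map_smul, hω, smul_zero, add_zero]
    exact D.map_algebraMap x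
  have h' := Algebra.FormallyEtale.of_formallyUnramified_of_field K (QuadraticAlgebra K a 0)
  exact
    { formallyEtale := h'
      finitePresentation := Algebra.FinitePresentation.of_finiteType.mp inferInstance }

/-- The algebra homomorphism `K[√a] → A` determined by a square root of `a` in `A`. -/
def homOfRoot {A : Type*} [CommRing A] [Algebra K A] {a : K} (w : A)
    (hw : w * w = algebraMap K A a) : QuadraticAlgebra K a 0 →ₐ[K] A :=
  QuadraticAlgebra.lift ⟨w, by rw [hw, zero_smul, add_zero, Algebra.algebraMap_eq_smul_one]⟩

theorem homOfRoot_apply {A : Type*} [CommRing A] [Algebra K A] {a : K} (w : A)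
    (hw : w * w = algebraMap K A a) (z : QuadraticAlgebra K a 0) :
    homOfRoot w hw z = algebraMap K A z.re + z.im • w := by
  simp [homOfRoot, QuadraticAlgebra.lift, Algebra.algebraMap_eq_smul_one]

theorem homOfRoot_injective {A : Type*} [CommRing A] [Algebra K A] {a : K} (w : A)
    (hw : w * w = algebraMap K A a) (hn : ∀ x : K, algebraMap K A x ≠ w) :
    Function.Injective (homOfRoot w hw) := by
  have : Nontrivial A := by
    by_contra hA
    rw [not_nontrivial_iff_subsingleton] at hA
    exact hn 0 (Subsingleton.elim _ _)
  rw [injective_iff_map_eq_zero]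
  intro z hz
  rw [homOfRoot_apply] at hz
  have him : z.im = 0 := by
    by_contra h
    apply hn (-(z.im)⁻¹ * z.re)
    have h1 : z.im • w = -algebraMap K A z.re := by rw [eq_neg_iff_add_eq_zero, add_comm]; exact hz
    have h2 := congrArg (fun t => (z.im)⁻¹ • t) h1
    simp only [smul_smul, inv_mul_cancel₀ h, one_smul] at h2
    rw [h2, Algebra.smul_def, map_mul, map_neg]
    ring
  rw [him, zero_smul, add_zero, map_eq_zero_iff _ (algebraMap K A).injective] at hz
  ext <;> simp [hz, him]

/-- A two-dimensional algebra with a non-scalar square root of `a` is `K[√a]`. -/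
def equivOfRoot {A : Type*} [CommRing A] [Algebra K A] {a : K} (w : A)
    (hw : w * w = algebraMap K A a) (hn : ∀ x : K, algebraMap K A x ≠ w)
    (hA : Module.finrank K A = 2) : QuadraticAlgebra K a 0 ≃ₐ[K] A :=
  AlgEquiv.ofBijective (homOfRoot w hw) <| by
    have : Module.Finite K A := Module.finite_of_finrank_pos (by omega)
    refine ⟨homOfRoot_injective w hw hn, ?_⟩
    exact (LinearMap.injective_iff_surjective_of_finrank_eq_finrank
      (f := (homOfRoot w hw).toLinearMap) (by rw [hA, QuadraticAlgebra.finrank_eq_two])).1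
      (homOfRoot_injective w hw hn)

/-- Complete the square: for `v` outside `K` with `v² = s + t v`, the element `w = v - t/2` has
square `s + t²/4`. Were this zero, `w` would be nilpotent, hence zero by reducedness, and `v` would
be a scalar. -/
theorem exists_equiv_quadraticAlgebra (h2 : (2 : K) ≠ 0) {A : Type*} [CommRing A] [Algebra K A]
    [IsReduced A] (hA : Module.finrank K A = 2) :
    ∃ a : K, a ≠ 0 ∧ Nonempty (QuadraticAlgebra K a 0 ≃ₐ[K] A) := by
  have : Nontrivial A := Module.nontrivial_of_finrank_pos (R := K) (by omega)
  have : Module.Finite K A := Module.finite_of_finrank_pos (by omega)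
  obtain ⟨v, hv⟩ : ∃ v : A, ∀ x : K, algebraMap K A x ≠ v := by
    by_contra! h
    have : Module.finrank K A ≤ 1 := finrank_le_one (1 : A) fun w => by
      obtain ⟨x, hx⟩ := h w
      exact ⟨x, by rw [← hx, Algebra.algebraMap_eq_smul_one]⟩
    omega
  have hli : LinearIndependent K ![1, v] := by
    rw [LinearIndependent.pair_iff' one_ne_zero]
    intro x hx
    exact hv x (by rw [← hx, Algebra.algebraMap_eq_smul_one])
  let b := basisOfLinearIndependentOfCardEqFinrank hli (by simp [hA])
  have hb : (v * v) = b.repr (v * v) 0 • (1 : A) + b.repr (v * v) 1 • v := by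
    conv_lhs => rw [← b.sum_repr (v * v)]
    simp [b, Fin.sum_univ_two]
  set s := b.repr (v * v) 0
  set t := b.repr (v * v) 1
  have hw : (v - algebraMap K A (t / 2)) * (v - algebraMap K A (t / 2)) =
      algebraMap K A (s + t ^ 2 / 4) := by
    have h4 : (4 : K) ≠ 0 := by
      rw [show (4 : K) = 2 * 2 by norm_num]; exact mul_ne_zero h2 h2
    have e1 : s + t ^ 2 / 4 = s + (t / 2) * (t / 2) := by field_simp; ring
    have e2 : algebraMap K A t = algebraMap K A (t / 2) + algebraMap K A (t / 2) := by
      rw [← map_add]; congr 1; field_simp; ring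
    rw [e1, map_add, map_mul]
    rw [Algebra.smul_def, Algebra.smul_def, e2] at hb
    linear_combination hb
  have hn : ∀ x : K, algebraMap K A x ≠ v - algebraMap K A (t / 2) := by
    intro x hx
    exact hv (x + t / 2) (by rw [map_add, hx]; ring)
  refine ⟨_, ?_, ⟨equivOfRoot _ hw hn hA⟩⟩
  intro h0
  rw [h0, map_zero] at hw
  have := (isReduced_iff_pow_one_lt 2 one_lt_two).1 ‹IsReduced A› _ (by rw [pow_two]; exact hw)
  exact hn 0 (by rw [map_zero, this])

theorem nonempty_equiv_of_sq_mul {a b c : K} (hc : c ≠ 0) (h : a = b * c ^ 2) :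
    Nonempty (QuadraticAlgebra K a 0 ≃ₐ[K] QuadraticAlgebra K b 0) := by
  refine ⟨equivOfRoot (c • QuadraticAlgebra.omega) ?_ ?_ (QuadraticAlgebra.finrank_eq_two _ _)⟩
  · rw [smul_mul_smul_comm, h, QuadraticAlgebra.algebraMap_eq]
    ext
    · simp
      ring
    · simp
  · intro x hx
    have := congrArg QuadraticAlgebra.im hx
    simp at this
    exact hc this.symm

/-- The nonzero solutions of `z³ = a z` remember `a`. The image of `(ω, 0)` is some `(x + y ω, t)`;
since `a` is not a square, `t = 0`. Comparing coordinates leaves only `x = 0`, `a = b y²`, because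
the other cases make `a` equal to `x²` or `(2x)²`. -/
theorem eq_mul_sq_of_equiv_aux (h2 : (2 : K) ≠ 0) {a b : K} (ha : ∀ t : K, a ≠ t ^ 2)
    (e : (QuadraticAlgebra K a 0 × K) ≃ₐ[K] (QuadraticAlgebra K b 0 × K)) :
    ∃ c : K, c ≠ 0 ∧ a = b * c ^ 2 := by
  have ha0 : a ≠ 0 := fun h => ha 0 (by simp [h])
  let z : QuadraticAlgebra K a 0 × K := (QuadraticAlgebra.omega, 0)
  have hz : z * z * z = a • z := by
    refine Prod.ext ?_ ?_
    · ext <;> simp [z]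
    · simp [z]
  have hez : e z * e z * e z = a • e z := by rw [← map_mul, ← map_mul, hz, map_smul]
  have hz0 : e z ≠ 0 := by
    rw [Ne, map_eq_zero_iff _ e.injective]
    intro h
    have := congrArg (fun t => t.1.im) h
    simp [z] at this
  generalize e z = q at hez hz0
  obtain ⟨⟨x, y⟩, t⟩ := q
  have ht := congrArg Prod.snd hez
  have hx := congrArg (fun t => t.1.re) hez
  have hy := congrArg (fun t => t.1.im) hez
  simp at ht hx hy
  have ht0 : t = 0 := by
    by_contra h
    exact ha t (by rw [pow_two]; exact (ht.resolve_right h).symm)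
  subst ht0
  have hx' : x * (x ^ 2 + 3 * b * y ^ 2 - a) = 0 := by linear_combination hx
  have hy' : y * (3 * x ^ 2 + b * y ^ 2 - a) = 0 := by linear_combination hy
  by_cases y0 : y = 0
  · subst y0
    exfalso
    by_cases x0 : x = 0
    · subst x0; exact hz0 rfl
    · rcases mul_eq_zero.1 hx' with h | h
      · exact x0 h
      · exact ha x (by linear_combination -h)
  · have h1 := (mul_eq_zero.1 hy').resolve_left y0
    refine ⟨y, y0, ?_⟩
    by_cases x0 : x = 0
    · subst x0; linear_combination -h1
    · exfalso
      have h3 := (mul_eq_zero.1 hx').resolve_left x0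
      have h4 : 2 * (x ^ 2 - b * y ^ 2) = 0 := by linear_combination h1 - h3
      have h5 := (mul_eq_zero.1 h4).resolve_left h2
      exact ha (2 * x) (by linear_combination -h1 - h5)

/-- Cancellation: `K[√a] × K ≅ K[√b] × K` forces `a` and `b` to agree up to squares. -/
theorem eq_mul_sq_of_prod_equiv (h2 : (2 : K) ≠ 0) {a b : K} (ha0 : a ≠ 0) (hb0 : b ≠ 0)
    (e : (QuadraticAlgebra K a 0 × K) ≃ₐ[K] (QuadraticAlgebra K b 0 × K)) :
    ∃ c : K, c ≠ 0 ∧ a = b * c ^ 2 := by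
  by_cases ha : ∀ t : K, a ≠ t ^ 2
  · exact eq_mul_sq_of_equiv_aux h2 ha e
  by_cases hb : ∀ t : K, b ≠ t ^ 2
  · obtain ⟨c, hc, h⟩ := eq_mul_sq_of_equiv_aux h2 hb e.symm
    exact ⟨c⁻¹, inv_ne_zero hc, by rw [h]; field_simp⟩
  push Not at ha hb
  obtain ⟨s, rfl⟩ := ha
  obtain ⟨t, rfl⟩ := hb
  have hs : s ≠ 0 := by rintro rfl; simp at ha0
  have ht : t ≠ 0 := by rintro rfl; simp at hb0
  exact ⟨s / t, div_ne_zero hs ht, by field_simp⟩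

theorem eq_mul_sq_of_equiv (h2 : (2 : K) ≠ 0) {a b : K} (ha0 : a ≠ 0) (hb0 : b ≠ 0)
    (e : QuadraticAlgebra K a 0 ≃ₐ[K] QuadraticAlgebra K b 0) :
    ∃ c : K, c ≠ 0 ∧ a = b * c ^ 2 :=
  eq_mul_sq_of_prod_equiv h2 ha0 hb0 (AlgEquiv.prodCongr e AlgEquiv.refl)

/-- `1 ⊗ ω` remains a square root of `a`; it is not a scalar because `1 ⊗ 1` and `1 ⊗ ω` form the
base-changed basis. -/
theorem nonempty_baseChange_equiv (L : Type) [Field L] [Algebra K L] {A : Type} [CommRing A]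
    [Algebra K A] {a : K} (e : QuadraticAlgebra K a 0 ≃ₐ[K] A) :
    Nonempty (QuadraticAlgebra L (algebraMap K L a) 0 ≃ₐ[L] L ⊗[K] A) := by
  have hfr : Module.finrank L (L ⊗[K] A) = 2 := by
    rw [Module.finrank_baseChange, ← e.toLinearEquiv.finrank_eq, QuadraticAlgebra.finrank_eq_two]
  refine ⟨equivOfRoot (1 ⊗ₜ e QuadraticAlgebra.omega) ?_ ?_ hfr⟩
  · rw [Algebra.TensorProduct.tmul_mul_tmul, ← map_mul,
      show (QuadraticAlgebra.omega : QuadraticAlgebra K a 0) * QuadraticAlgebra.omega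
          = algebraMap K _ a by ext <;> simp, AlgEquiv.commutes, mul_one,
      Algebra.TensorProduct.algebraMap_apply, Algebra.algebraMap_eq_smul_one,
      Algebra.algebraMap_self, RingHom.id_apply, Algebra.algebraMap_eq_smul_one,
      ← TensorProduct.smul_tmul]
  · intro x hx
    let b := (QuadraticAlgebra.basis a (0 : K)).map e.toLinearEquiv
    let B := b.baseChange L
    have h0 : b 0 = 1 := by
      simp only [b, Module.Basis.map_apply]
      rw [show QuadraticAlgebra.basis a (0 : K) 0 = 1 by
        ext <;> simp [QuadraticAlgebra.basis, QuadraticAlgebra.re_one, QuadraticAlgebra.im_one]]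
      simp
    have h1 : b 1 = e QuadraticAlgebra.omega := by
      simp only [b, Module.Basis.map_apply]
      rw [show QuadraticAlgebra.basis a (0 : K) 1 = QuadraticAlgebra.omega by
        ext <;> simp [QuadraticAlgebra.basis]]
      simp
    have e1 : (1 : L) ⊗ₜ[K] e QuadraticAlgebra.omega = B 1 := by
      simp only [B, Module.Basis.baseChange_apply, h1]
    have e0 : algebraMap L (L ⊗[K] A) x = x • B 0 := by
      simp only [B, Module.Basis.baseChange_apply, h0]
      rw [Algebra.algebraMap_eq_smul_one]
      rfl
    rw [e1, e0] at hx
    have := congrArg (fun t => B.repr t 1) hx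
    simp at this

end Generic

end QuadCount

end

/-! ### Integral elements, discriminants and automorphisms of quadratic algebras. -/

noncomputable section

namespace QuadCount

/-- Modulo `4` the form becomes `(X - Y)(X + Y)`, and the two factors agree modulo the prime `2`.
This confines the maximal order to `R[(1 + √n)/2]` when `n ≡ 1` modulo `4`. -/
theorem dvd_sub_of_four_dvd {R : Type} [CommRing R] {n : R} (h2 : Prime (2 : R)) (h4 : (4 : R) ∣ n - 1) (X Y : R)
    (h : 4 ∣ X ^ 2 - n * Y ^ 2) : 2 ∣ X - Y := by
  have h1 : (2 : R) ∣ (X - Y) * (X + Y) := by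
    obtain ⟨s, hs⟩ := h4
    obtain ⟨t, ht⟩ := h
    exact ⟨2 * (t + s * Y ^ 2), by linear_combination ht + hs * Y ^ 2⟩
  rcases h2.dvd_or_dvd h1 with h | ⟨t, ht⟩
  · exact h
  · exact ⟨t - Y, by linear_combination ht⟩

theorem discr_quadratic {K : Type} [Field K] {a : K} {A : Type} [CommRing A] [Algebra K A]
    (e : QuadraticAlgebra K a 0 ≃ₐ[K] A) (z : Fin 2 → QuadraticAlgebra K a 0) :
    Algebra.discr K (fun i => e (z i)) =
      4 * a * ((z 0).re * (z 1).im - (z 1).re * (z 0).im) ^ 2 := by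
  have htr : ∀ w : QuadraticAlgebra K a 0, Algebra.trace K _ w = 2 * w.re := by
    intro w
    rw [Algebra.trace_eq_matrix_trace (QuadraticAlgebra.basis a (0 : K)), Matrix.trace_fin_two,
      Algebra.leftMulMatrix_eq_repr_mul, Algebra.leftMulMatrix_eq_repr_mul]
    simp [QuadraticAlgebra.basis]
    ring
  rw [show (fun i => e (z i)) = e ∘ z from rfl, ← Algebra.discr_eq_discr_of_algEquiv z e,
    Algebra.discr_def, Matrix.det_fin_two]
  simp only [Algebra.traceMatrix_apply, Algebra.traceForm_apply, htr]
  simp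
  ring

section Integral

variable {R K : Type} [CommRing R] [Field K] [Algebra R K]

open QuadraticAlgebra in
/-- The nontrivial automorphism of `K[√a]`. -/
def conjHom (a : K) : QuadraticAlgebra K a 0 →ₐ[K] QuadraticAlgebra K a 0 :=
  homOfRoot (-omega) (by rw [QuadraticAlgebra.algebraMap_eq]; ext <;> simp)

theorem conjHom_apply (a : K) (z : QuadraticAlgebra K a 0) :
    conjHom a z = ⟨z.re, -z.im⟩ := by
  rw [conjHom, homOfRoot_apply, QuadraticAlgebra.algebraMap_eq]
  ext <;> simp

variable [IsFractionRing R K]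

/-- An integral element has an integral conjugate, so trace and norm lie in the integrally closed
`R`; conversely the element is a root of `T² - X T + N`. Only conjugation is used, so split algebras
are covered. -/
theorem isIntegral_iff_trace_norm [IsIntegrallyClosed R] (n : R) {A : Type} [CommRing A]
    [Algebra K A] [Algebra R A] [IsScalarTower R K A]
    (e : QuadraticAlgebra K (algebraMap R K n) 0 ≃ₐ[K] A)
    (z : QuadraticAlgebra K (algebraMap R K n) 0) :
    IsIntegral R (e z) ↔ ∃ X N : R, algebraMap R K X = 2 * z.re ∧
      algebraMap R K N = z.re ^ 2 - algebraMap R K n * z.im ^ 2 := by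
  have hinj : Function.Injective (algebraMap K A) := by
    have : Nontrivial A := e.symm.toRingHom.domain_nontrivial
    exact (algebraMap K A).injective
  have htr : e z + e (conjHom _ z) = algebraMap K A (2 * z.re) := by
    rw [← map_add, ← e.commutes]
    congr 1
    rw [conjHom_apply, QuadraticAlgebra.algebraMap_eq]
    ext <;> simp
    ring
  have hno : e z * e (conjHom _ z) =
      algebraMap K A (z.re ^ 2 - algebraMap R K n * z.im ^ 2) := by
    rw [← map_mul, ← e.commutes]
    congr 1
    rw [conjHom_apply, QuadraticAlgebra.algebraMap_eq]
    ext <;> simp <;> ring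
  constructor
  · intro h
    have h' : IsIntegral R (e (conjHom _ z)) := by
      have := h.map (((e.toAlgHom.comp (conjHom _)).comp e.symm.toAlgHom).restrictScalars R)
      simpa using this
    have h1 := h.add h'
    have h2 := h.mul h'
    rw [htr, isIntegral_algebraMap_iff hinj] at h1
    rw [hno, isIntegral_algebraMap_iff hinj] at h2
    obtain ⟨X, hX⟩ := IsIntegrallyClosed.isIntegral_iff.1 h1
    obtain ⟨N, hN⟩ := IsIntegrallyClosed.isIntegral_iff.1 h2
    exact ⟨X, N, hX, hN⟩
  · rintro ⟨X, N, hX, hN⟩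
    refine ⟨Polynomial.X ^ 2 - (Polynomial.C X * Polynomial.X - Polynomial.C N), ?_, ?_⟩
    · apply Polynomial.monic_X_pow_sub
      rw [sub_eq_add_neg, ← Polynomial.C_neg]
      exact Polynomial.degree_linear_le.trans_lt (by norm_num)
    · simp only [Polynomial.eval₂_sub, Polynomial.eval₂_pow, Polynomial.eval₂_X,
        Polynomial.eval₂_mul, Polynomial.eval₂_C]
      rw [IsScalarTower.algebraMap_apply R K A, IsScalarTower.algebraMap_apply R K A, hX, hN,
        ← htr, ← hno]
      ring

variable [IsDomain R]

/-- Write `y = a/b` in lowest terms. Then `b²` divides `n a²` and is prime to `a²`, so it divides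
the squarefree `n`, and `b` is a unit. -/
theorem exists_algebraMap_eq_of_squarefree [UniqueFactorizationMonoid R] {n N : R}
    (hn : Squarefree n) {y : K} (h : algebraMap R K N = algebraMap R K n * y ^ 2) :
    ∃ Y : R, algebraMap R K Y = y := by
  obtain ⟨a, b, hab, rfl⟩ := IsFractionRing.exists_reduced_fraction (A := R) y
  have hb0 : algebraMap R K b ≠ 0 := IsFractionRing.to_map_ne_zero_of_mem_nonZeroDivisors b.2
  have hb : IsUnit (b : R) := by
    have h1 : N * b ^ 2 = n * a ^ 2 := by
      apply IsFractionRing.injective R K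
      rw [map_mul, map_mul, h, map_pow, map_pow, IsFractionRing.mk'_eq_div]
      field_simp
    have h2 : (b : R) * b ∣ n * a ^ 2 := by
      rw [← h1, pow_two]; exact Dvd.intro_left _ rfl
    apply hn
    refine IsRelPrime.dvd_of_dvd_mul_right ?_ h2
    rw [← pow_two]
    exact (hab.symm.pow_left).pow_right
  obtain ⟨u, hu⟩ := hb
  refine ⟨a * ↑u⁻¹, ?_⟩
  rw [IsFractionRing.mk'_eq_div, eq_div_iff hb0, ← map_mul, ← hu]
  simp

variable [CharZero K]

/-- The trace `X` and the norm `N` satisfy `X² - 4N = n (2 im)²`, and squarefreeness of `n` then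
makes `2 im` integral too. -/
theorem isIntegral_iff_coords [UniqueFactorizationMonoid R] {n : R} (hn : Squarefree n)
    {A : Type} [CommRing A]
    [Algebra K A] [Algebra R A] [IsScalarTower R K A]
    (e : QuadraticAlgebra K (algebraMap R K n) 0 ≃ₐ[K] A)
    (z : QuadraticAlgebra K (algebraMap R K n) 0) :
    IsIntegral R (e z) ↔ ∃ X Y : R, algebraMap R K X = 2 * z.re ∧
      algebraMap R K Y = 2 * z.im ∧ 4 ∣ X ^ 2 - n * Y ^ 2 := by
  rw [isIntegral_iff_trace_norm]
  constructor
  · rintro ⟨X, N, hX, hN⟩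
    have h1 : algebraMap R K (X ^ 2 - 4 * N) = algebraMap R K n * (2 * z.im) ^ 2 := by
      rw [map_sub, map_pow, map_mul, hX, hN, map_ofNat]
      ring
    obtain ⟨Y, hY⟩ := exists_algebraMap_eq_of_squarefree hn h1
    refine ⟨X, Y, hX, hY, N, ?_⟩
    apply IsFractionRing.injective R K
    simp only [map_sub, map_pow, map_mul, hX, hN, hY, map_ofNat]
    ring
  · rintro ⟨X, Y, hX, hY, N, hN⟩
    refine ⟨X, N, hX, ?_⟩
    have := congrArg (algebraMap R K) hN
    simp only [map_sub, map_pow, map_mul, hX, hY, map_ofNat] at this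
    linear_combination -(1 / 4 : K) * this

/-- `δ` is the discriminant of the maximal order of `K[√n]` over `R`. -/
def IsQuadDisc (K : Type) [Field K] [Algebra R K] (n δ : R) : Prop :=
  ∀ (A : Type) [CommRing A] [Algebra K A] [Algebra R A] [IsScalarTower R K A],
    (QuadraticAlgebra K (algebraMap R K n) 0 ≃ₐ[K] A) →
    (∀ b : Fin 2 → A, (∀ i, IsIntegral R (b i)) →
      ∃ D : R, Algebra.discr K b = algebraMap R K (δ * D ^ 2)) ∧
    ∃ b : Fin 2 → A, (∀ i, IsIntegral R (b i)) ∧ Algebra.discr K b = algebraMap R K δ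

/-- The congruence hypothesis says that the maximal order is `R[√n]`. The witness `D` is the
determinant of the coordinates in the basis `1, √n`. -/
theorem isQuadDisc_four_mul [UniqueFactorizationMonoid R] {n : R} (hn : Squarefree n)
    (h : ∀ X Y : R, 4 ∣ X ^ 2 - n * Y ^ 2 → 2 ∣ X ∧ 2 ∣ Y) : IsQuadDisc K n (4 * n) := by
  intro A _ _ _ _ e
  constructor
  · intro b hb
    have hb' : ∀ i, ∃ x y : R, algebraMap R K x = (e.symm (b i)).re ∧
        algebraMap R K y = (e.symm (b i)).im := by
      intro i
      have := hb i
      rw [← e.apply_symm_apply (b i), isIntegral_iff_coords hn] at this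
      obtain ⟨X, Y, hX, hY, h4⟩ := this
      obtain ⟨⟨x, rfl⟩, ⟨y, rfl⟩⟩ := h X Y h4
      simp only [map_mul, map_ofNat] at hX hY
      exact ⟨x, y, mul_left_cancel₀ two_ne_zero hX, mul_left_cancel₀ two_ne_zero hY⟩
    choose x y hx hy using hb'
    refine ⟨x 0 * y 1 - x 1 * y 0, ?_⟩
    have := discr_quadratic e (fun i => e.symm (b i))
    simp only [AlgEquiv.apply_symm_apply] at this
    rw [show (fun i => b i) = b from rfl] at this
    rw [this]
    simp only [← hx, ← hy, map_mul, map_sub, map_pow, map_ofNat]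
  · refine ⟨fun i => e (![1, QuadraticAlgebra.omega] i), ?_, ?_⟩
    · intro i
      rw [isIntegral_iff_coords hn]
      fin_cases i
      · exact ⟨2, 0, by simp [QuadraticAlgebra.re_one, map_ofNat (algebraMap R K) 2],
          by simp [QuadraticAlgebra.im_one], 1, by ring⟩
      · exact ⟨0, 2, by simp, by simp [map_ofNat (algebraMap R K) 2], -n, by ring⟩
    · rw [discr_quadratic]
      simp [QuadraticAlgebra.re_one, QuadraticAlgebra.im_one, map_ofNat (algebraMap R K) 4]

/-- Here the maximal order is `R[(1 + √n)/2]`; the coordinates in the basis `1, (1 + √n)/2` are `re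
- im` and `2 im`. -/
theorem isQuadDisc_self [UniqueFactorizationMonoid R] {n : R} (hn : Squarefree n)
    (h4 : (4 : R) ∣ n - 1)
    (h : ∀ X Y : R, 4 ∣ X ^ 2 - n * Y ^ 2 → 2 ∣ X - Y) : IsQuadDisc K n n := by
  intro A _ _ _ _ e
  constructor
  · intro b hb
    have hb' : ∀ i, ∃ x y : R, algebraMap R K x = (e.symm (b i)).re - (e.symm (b i)).im ∧
        algebraMap R K y = 2 * (e.symm (b i)).im := by
      intro i
      have := hb i
      rw [← e.apply_symm_apply (b i), isIntegral_iff_coords hn] at this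
      obtain ⟨X, Y, hX, hY, h4⟩ := this
      obtain ⟨x, hx⟩ := h X Y h4
      have hx' := congrArg (algebraMap R K) hx
      simp only [map_mul, map_ofNat, map_sub, hX, hY] at hx'
      exact ⟨x, Y, mul_left_cancel₀ (two_ne_zero (α := K)) (by linear_combination -hx'), hY⟩
    choose x y hx hy using hb'
    refine ⟨x 0 * y 1 - x 1 * y 0, ?_⟩
    have := discr_quadratic e (fun i => e.symm (b i))
    simp only [AlgEquiv.apply_symm_apply] at this
    rw [show (fun i => b i) = b from rfl] at this
    rw [this]
    simp only [hx, hy, map_mul, map_sub, map_pow]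
    ring
  · refine ⟨fun i => e (![1, ⟨1 / 2, 1 / 2⟩] i), ?_, ?_⟩
    · intro i
      rw [isIntegral_iff_coords hn]
      fin_cases i
      · exact ⟨2, 0, by simp [QuadraticAlgebra.re_one, map_ofNat (algebraMap R K) 2],
          by simp [QuadraticAlgebra.im_one], 1, by ring⟩
      · refine ⟨1, 1, by simp, by simp, ?_⟩
        rw [one_pow, mul_one, ← neg_sub]
        exact h4.neg_right
    · rw [discr_quadratic]
      simp [QuadraticAlgebra.re_one, QuadraticAlgebra.im_one]
      ring

end Integral

/-- The nontrivial automorphism of `K[√a]`, as an equivalence. -/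
def conjEquiv {K : Type} [Field K] (a : K) :
    QuadraticAlgebra K a 0 ≃ₐ[K] QuadraticAlgebra K a 0 :=
  AlgEquiv.ofAlgHom (conjHom a) (conjHom a)
    (by ext <;> simp [conjHom_apply]) (by ext <;> simp [conjHom_apply])

/-- An automorphism sends `ω` to a non-scalar square root of `a`; written as `x + y ω`, it must have
`x = 0` and `y² = 1`. Irreducibility plays no role, so the split algebra also has two automorphisms.
-/
theorem card_aut_quadraticAlgebra {K : Type} [Field K] (h2 : (2 : K) ≠ 0) {a : K} (ha : a ≠ 0) :
    Nat.card (QuadraticAlgebra K a 0 ≃ₐ[K] QuadraticAlgebra K a 0) = 2 := by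
  rw [Nat.card_eq_two_iff]
  have hc : conjEquiv a QuadraticAlgebra.omega = -QuadraticAlgebra.omega := by
    change conjHom a _ = _
    rw [conjHom_apply]
    ext <;> simp
  refine ⟨AlgEquiv.refl, conjEquiv a, ?_, ?_⟩
  · intro h
    have h1 := congrArg (fun f => (f QuadraticAlgebra.omega).im) h
    simp only [hc] at h1
    simp at h1
    apply h2
    linear_combination h1
  · rw [Set.eq_univ_iff_forall]
    intro φ
    have hext : ∀ ψ : QuadraticAlgebra K a 0 ≃ₐ[K] QuadraticAlgebra K a 0,
        φ QuadraticAlgebra.omega = ψ QuadraticAlgebra.omega → φ = ψ := by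
      intro ψ h
      have : φ.toAlgHom = ψ.toAlgHom := QuadraticAlgebra.algHom_ext h
      exact AlgEquiv.coe_toAlgHom_injective this
    have hsq : φ QuadraticAlgebra.omega * φ QuadraticAlgebra.omega = algebraMap K _ a := by
      rw [← map_mul, show (QuadraticAlgebra.omega : QuadraticAlgebra K a 0) *
        QuadraticAlgebra.omega = algebraMap K _ a by ext <;> simp, φ.commutes]
    have hne : ∀ x : K, φ QuadraticAlgebra.omega ≠ algebraMap K _ x := by
      intro x hx
      rw [← φ.commutes x] at hx
      have := congrArg QuadraticAlgebra.im (φ.injective hx)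
      simp at this
    generalize hw : φ QuadraticAlgebra.omega = w at *
    obtain ⟨x, y⟩ := w
    have hre := congrArg QuadraticAlgebra.re hsq
    have him := congrArg QuadraticAlgebra.im hsq
    rw [QuadraticAlgebra.algebraMap_eq] at hre him
    simp at hre him
    have hy : y ≠ 0 := by
      rintro rfl
      exact hne x rfl
    have hx : x = 0 := by
      have : (2 * y) * x = 0 := by linear_combination him
      exact (mul_eq_zero.1 this).resolve_left (mul_ne_zero h2 hy)
    subst hx
    have hyy : (y - 1) * (y + 1) = 0 := by
      apply mul_left_cancel₀ ha
      linear_combination hre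
    rcases mul_eq_zero.1 hyy with h | h
    · left
      apply hext
      change _ = QuadraticAlgebra.omega
      ext
      · simp
      · simpa using sub_eq_zero.1 h
    · right
      apply hext
      rw [hc]
      ext
      · simp
      · simpa using eq_neg_of_add_eq_zero_left h

end QuadCount

end

/-! ### Isomorphism classes, local masses and ramification over `ℚ_p`. -/

noncomputable section

namespace QuadCount

theorem smul_one_add_smul_omega {K : Type} [Field K] {a : K} (x y : K) :
    x • (1 : QuadraticAlgebra K a 0) + y • QuadraticAlgebra.omega = ⟨x, y⟩ := by
  ext <;> simp [QuadraticAlgebra.re_one, QuadraticAlgebra.im_one]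

theorem im_omega_add_omega {K : Type} [Field K] {a : K} :
    ((QuadraticAlgebra.omega : QuadraticAlgebra K a 0) + QuadraticAlgebra.omega).im = 2 := by
  simp
  norm_num

theorem smul_mk {K : Type} [Field K] {a : K} (c x y : K) :
    c • (⟨x, y⟩ : QuadraticAlgebra K a 0) = ⟨c * x, c * y⟩ := by
  ext <;> simp

section Classes

theorem toClass_eq_iff {K : Type} [Field K] {n : ℕ} {A B : EtaleAlgebra K n} :
    A.toClass = B.toClass ↔ Nonempty (A.carrier ≃ₐ[K] B.carrier) :=
  Quotient.eq (r := EtaleAlgebra.setoid K n)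

variable {K : Type} [Field K] [CharZero K]

/-- The étale algebra `K[√a]`. -/
def quadEtale (a : Kˣ) : EtaleAlgebra K 2 where
  carrier := QuadraticAlgebra K (a : K) 0
  etale := etale_quadraticAlgebra two_ne_zero a.ne_zero
  finrank_eq := QuadraticAlgebra.finrank_eq_two _ _

/-- The isomorphism class of `K[√a]`. -/
def quadClass (a : Kˣ) : EtaleClass K 2 := (quadEtale a).toClass

theorem exists_quadClass_eq (A : EtaleAlgebra K 2) : ∃ a : Kˣ, quadClass a = A.toClass := by
  have := Algebra.FormallyUnramified.isReduced_of_field K A.carrier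
  obtain ⟨a, ha, ⟨e⟩⟩ := exists_equiv_quadraticAlgebra (K := K) two_ne_zero A.finrank_eq
  exact ⟨Units.mk0 a ha, toClass_eq_iff.2 ⟨e⟩⟩

theorem quadClass_surjective : Function.Surjective (quadClass (K := K)) := by
  intro c
  induction c using Quotient.inductionOn with
  | h A => exact exists_quadClass_eq A

theorem quadClass_eq_of_eq_mul_sq {a b : Kˣ} {c : K} (h : (a : K) = b * c ^ 2) :
    quadClass a = quadClass b := by
  have hc : c ≠ 0 := by
    rintro rfl
    exact a.ne_zero (by rw [h]; ring)
  exact toClass_eq_iff.2 (nonempty_equiv_of_sq_mul hc h)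

theorem quadClass_prodBase_eq {a b : Kˣ} (h : (quadClass a).prodBase = (quadClass b).prodBase) :
    ∃ c : K, c ≠ 0 ∧ (a : K) = b * c ^ 2 := by
  obtain ⟨e⟩ := toClass_eq_iff.1 h
  exact eq_mul_sq_of_prod_equiv two_ne_zero a.ne_zero b.ne_zero e

theorem quadClass_eq {a b : Kˣ} (h : quadClass a = quadClass b) :
    ∃ c : K, c ≠ 0 ∧ (a : K) = b * c ^ 2 :=
  quadClass_prodBase_eq (congrArg EtaleClass.prodBase h)

/-- Cancelling the factor `K` by comparing square classes. A set of cubic algebras can thus be read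
as a condition on `F` alone. -/
theorem prodBase_injective :
    Function.Injective (EtaleClass.prodBase : EtaleClass K 2 → EtaleClass K 3) := by
  intro F G h
  obtain ⟨a, rfl⟩ := quadClass_surjective F
  obtain ⟨b, rfl⟩ := quadClass_surjective G
  obtain ⟨c, -, hc⟩ := quadClass_prodBase_eq h
  exact quadClass_eq_of_eq_mul_sq hc

end Classes

section Derivations

variable {R S M : Type*} [CommRing R] [CommRing S] [Algebra R S] [AddCommGroup M] [Module S M]
  [Module R M]

/-- Multiplying `D E = 2 E · D E` by `E` gives `E · D E = 0`. -/
theorem derivation_idempotent (D : Derivation R S M) {E : S} (hE : E * E = E) : D E = 0 := by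
  have h1 : D E = E • D E + E • D E := by
    conv_lhs => rw [← hE, D.leibniz]
  have h2 : E • D E = E • D E + E • D E := by
    conv_lhs => rw [h1]
    rw [smul_add, smul_smul, hE]
  have h3 : E • D E = 0 := by simpa using h2
  rw [h1, h3, add_zero]

variable [IsScalarTower R S M]

/-- `2 W · D W = u · D E = 0`; multiplying by `W` gives `u E · D W = 0`, and `W = E W` finishes. The
idempotent `E` allows an application inside one factor of a product algebra. -/
theorem derivation_sqrt (D : Derivation R S M) {E W : S} {u : R} (hu : IsUnit u)
    (h2 : IsUnit (2 : R)) (hE : E * E = E) (hEW : E * W = W) (hW : W * W = u • E) : D W = 0 := by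
  have hDE := derivation_idempotent D hE
  have h1 : (2 : R) • (W • D W) = 0 := by
    have h := D.leibniz W W
    rw [hW, D.map_smul, hDE, smul_zero] at h
    rw [two_smul]
    exact h.symm
  have h3 : W • D W = 0 := (h2.smul_eq_zero).1 h1
  have h4 : u • (E • D W) = 0 := by
    rw [← smul_assoc, ← hW, mul_smul, h3, smul_zero]
  have h5 : E • D W = 0 := (hu.smul_eq_zero).1 h4
  have h6 := D.leibniz E W
  rw [hEW, hDE, smul_zero, add_zero, h5] at h6
  exact h6

end Derivations

section Local

variable {p : ℕ} [Fact p.Prime]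

theorem card_quotient_span_pow (k : ℕ) :
    Nat.card (ℤ_[p] ⧸ Ideal.span {(p : ℤ_[p]) ^ k}) = p ^ k := by
  rw [← PadicInt.ker_toZModPow k]
  have e := RingHom.quotientKerEquivOfSurjective (ZMod.ringHom_surjective (PadicInt.toZModPow (p := p) k))
  rw [Nat.card_congr e.toEquiv, Nat.card_zmod]

/-- The two halves of `IsQuadDisc` are the two inclusions of ideals. -/
theorem discIdeal_eq_span (F : EtaleAlgebra ℚ_[p] 2) {n δ : ℤ_[p]} (h : IsQuadDisc ℚ_[p] n δ)
    (e : QuadraticAlgebra ℚ_[p] (algebraMap ℤ_[p] ℚ_[p] n) 0 ≃ₐ[ℚ_[p]] F.carrier) :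
    discIdeal F = Ideal.span {δ} := by
  obtain ⟨h1, b, hb, hδ⟩ := h F.carrier e
  apply le_antisymm
  · rw [discIdeal, Ideal.span_le]
    rintro z ⟨c, hc⟩
    obtain ⟨D, hD⟩ := h1 (fun i => (c i : F.carrier)) (fun i => (c i).2)
    rw [SetLike.mem_coe, Ideal.mem_span_singleton]
    refine ⟨D ^ 2, ?_⟩
    apply IsFractionRing.injective ℤ_[p] ℚ_[p]
    rw [← hD, ← hc]
    rfl
  · rw [Ideal.span_singleton_le_iff_mem]
    apply Ideal.subset_span
    exact ⟨fun i => ⟨b i, hb i⟩, hδ.symm⟩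

theorem mass_of_isQuadDisc (a : ℚ_[p]ˣ) {n δ : ℤ_[p]} (h : IsQuadDisc ℚ_[p] n δ)
    (ha : (a : ℚ_[p]) = algebraMap ℤ_[p] ℚ_[p] n) {k : ℕ} (hk : Associated δ ((p : ℤ_[p]) ^ k)) :
    (quadClass a).mass = 1 / (2 * (p : ℝ) ^ k) := by
  have e := (nonempty_equiv_of_sq_mul (a := algebraMap ℤ_[p] ℚ_[p] n) (b := (a : ℚ_[p]))
    one_ne_zero (by rw [ha]; ring)).some
  change mass (quadEtale a) = _
  have h1 : discP (quadEtale a) = p ^ k := by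
    rw [discP, discIdeal_eq_span (quadEtale a) h e, Ideal.span_singleton_eq_span_singleton.2 hk,
      card_quotient_span_pow]
  have h2 : Nat.card ((quadEtale a).carrier ≃ₐ[ℚ_[p]] (quadEtale a).carrier) = 2 :=
    card_aut_quadraticAlgebra two_ne_zero a.ne_zero
  rw [mass, h1, h2]
  push_cast
  rw [one_div_mul_one_div, mul_comm]

theorem isUnit_two (hp : p ≠ 2) : IsUnit (2 : ℤ_[p]) := by
  rw [PadicInt.isUnit_iff]
  have h := PadicInt.norm_intCast_eq_one_iff (p := p) (z := 2)
  have : IsCoprime (2 : ℤ) p := by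
    rw [← Nat.cast_ofNat, Nat.isCoprime_iff_coprime]
    exact (Nat.coprime_primes Nat.prime_two (Fact.out : p.Prime)).2 (Ne.symm hp)
  simpa using h.2 this

theorem isUnit_four (hp : p ≠ 2) : IsUnit (4 : ℤ_[p]) := by
  rw [show (4 : ℤ_[p]) = 2 * 2 by norm_num]
  exact (isUnit_two hp).mul (isUnit_two hp)

theorem isQuadDisc_of_ne_two (hp : p ≠ 2) {n : ℤ_[p]} (hn : Squarefree n) :
    IsQuadDisc ℚ_[p] n (4 * n) :=
  isQuadDisc_four_mul hn fun _ _ _ => ⟨(isUnit_two hp).dvd, (isUnit_two hp).dvd⟩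

theorem mass_unit (hp : p ≠ 2) (a : ℚ_[p]ˣ) {u : ℤ_[p]} (hu : IsUnit u)
    (ha : (a : ℚ_[p]) = algebraMap ℤ_[p] ℚ_[p] u) : (quadClass a).mass = 1 / 2 := by
  rw [mass_of_isQuadDisc a (isQuadDisc_of_ne_two hp hu.squarefree) ha (k := 0)]
  · simp
  · rw [pow_zero, associated_one_iff_isUnit]
    exact (isUnit_four hp).mul hu

theorem squarefree_p_mul {u : ℤ_[p]} (hu : IsUnit u) : Squarefree ((p : ℤ_[p]) * u) :=
  ((associated_mul_unit_left _ _ hu).irreducible_iff.2 PadicInt.prime_p.irreducible).squarefree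

theorem mass_p_mul_unit (hp : p ≠ 2) (a : ℚ_[p]ˣ) {u : ℤ_[p]} (hu : IsUnit u)
    (ha : (a : ℚ_[p]) = algebraMap ℤ_[p] ℚ_[p] (p * u)) : (quadClass a).mass = 1 / (2 * p) := by
  rw [mass_of_isQuadDisc a (isQuadDisc_of_ne_two hp (squarefree_p_mul hu)) ha (k := 1)]
  · simp
  · rw [pow_one]
    have h := associated_mul_unit_left (p : ℤ_[p]) (4 * u) ((isUnit_four hp).mul hu)
    rwa [show (p : ℤ_[p]) * (4 * u) = 4 * (p * u) by ring] at h

/-- For `n ≡ 2, 3` modulo `4` the form `X² - n Y²` vanishes modulo `4` only at even pairs, a finite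
check in `ZMod 4`. The abstract `φ` makes it serve both `ℤ` and `ℤ_2`. -/
theorem two_dvd_of_four_dvd {R : Type*} [CommRing R] [IsDomain R] [CharZero R] (φ : R →+* ZMod 4)
    (hφ : ∀ x, φ x = 0 ↔ 4 ∣ x) {n : R} (hn : φ n = 2 ∨ φ n = 3) (X Y : R)
    (h : 4 ∣ X ^ 2 - n * Y ^ 2) : 2 ∣ X ∧ 2 ∣ Y := by
  have key : ∀ x : R, 2 * φ x = 0 → 2 ∣ x := by
    intro x hx
    rw [← map_ofNat φ 2, ← map_mul, hφ] at hx
    obtain ⟨t, ht⟩ := hx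
    exact ⟨t, mul_left_cancel₀ (two_ne_zero (α := R)) (by linear_combination ht)⟩
  rw [← hφ, map_sub, map_mul, map_pow, map_pow] at h
  have h3 : 2 * φ X = 0 ∧ 2 * φ Y = 0 := by
    generalize φ X = x at *
    generalize φ Y = y at *
    rcases hn with hn | hn <;> rw [hn] at h <;> revert x y <;> decide
  exact ⟨key _ h3.1, key _ h3.2⟩

theorem toZModPow_eq_zero_iff (k : ℕ) (x : ℤ_[p]) :
    PadicInt.toZModPow k x = 0 ↔ (p : ℤ_[p]) ^ k ∣ x := by
  rw [← RingHom.mem_ker, PadicInt.ker_toZModPow, Ideal.mem_span_singleton]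

section IntegralCoords

theorem exists_coords (hp : p ≠ 2) {n : ℤ_[p]} (hn : Squarefree n) {A : Type} [CommRing A]
    [Algebra ℚ_[p] A] [Algebra ℤ_[p] A] [IsScalarTower ℤ_[p] ℚ_[p] A]
    (e : QuadraticAlgebra ℚ_[p] (algebraMap ℤ_[p] ℚ_[p] n) 0 ≃ₐ[ℚ_[p]] A)
    {w : A} (hw : IsIntegral ℤ_[p] w) : ∃ x y : ℤ_[p], w = x • (1 : A) + y • e QuadraticAlgebra.omega := by
  rw [← e.apply_symm_apply w, isIntegral_iff_coords hn] at hw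
  obtain ⟨X, Y, hX, hY, -⟩ := hw
  obtain ⟨x, rfl⟩ := (isUnit_two hp).dvd (a := X)
  obtain ⟨y, rfl⟩ := (isUnit_two hp).dvd (a := Y)
  simp only [map_mul, map_ofNat] at hX hY
  have hX' := mul_left_cancel₀ two_ne_zero hX
  have hY' := mul_left_cancel₀ two_ne_zero hY
  refine ⟨x, y, ?_⟩
  rw [← map_one e, ← IsScalarTower.algebraMap_smul ℚ_[p] x, ← IsScalarTower.algebraMap_smul ℚ_[p] y,
    ← map_smul, ← map_smul, ← map_add, ← e.symm_apply_eq,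
    smul_one_add_smul_omega, hX', hY']

theorem omega_mul_omega {K : Type} [Field K] (a : K) :
    (QuadraticAlgebra.omega : QuadraticAlgebra K a 0) * QuadraticAlgebra.omega
      = algebraMap K _ a := by
  rw [QuadraticAlgebra.algebraMap_eq]
  ext <;> simp

theorem sqrt_mul_sqrt {n : ℤ_[p]} {A : Type} [CommRing A]
    [Algebra ℚ_[p] A] [Algebra ℤ_[p] A] [IsScalarTower ℤ_[p] ℚ_[p] A]
    (e : QuadraticAlgebra ℚ_[p] (algebraMap ℤ_[p] ℚ_[p] n) 0 ≃ₐ[ℚ_[p]] A) :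
    e QuadraticAlgebra.omega * e QuadraticAlgebra.omega = n • (1 : A) := by
  rw [← map_mul, omega_mul_omega, e.commutes, ← IsScalarTower.algebraMap_apply,
    Algebra.algebraMap_eq_smul_one]

theorem isIntegral_sqrt {n : ℤ_[p]} {A : Type} [CommRing A]
    [Algebra ℚ_[p] A] [Algebra ℤ_[p] A] [IsScalarTower ℤ_[p] ℚ_[p] A]
    (e : QuadraticAlgebra ℚ_[p] (algebraMap ℤ_[p] ℚ_[p] n) 0 ≃ₐ[ℚ_[p]] A) :
    IsIntegral ℤ_[p] (e QuadraticAlgebra.omega) := by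
  rw [isIntegral_iff_trace_norm]
  exact ⟨0, -n, by simp, by simp⟩

end IntegralCoords

/-- For odd `p` the maximal order is spanned by `1` and `√u`, and `√u` has zero differential because
`2` and `u` are units. -/
theorem isUnramified_of_unit (hp : p ≠ 2) {u : ℤ_[p]} (hu : IsUnit u) (F : EtaleAlgebra ℚ_[p] 2)
    (e : QuadraticAlgebra ℚ_[p] (algebraMap ℤ_[p] ℚ_[p] u) 0 ≃ₐ[ℚ_[p]] F.carrier) :
    IsUnramified F := by
  apply formallyUnramified_of_D_eq_zero
  intro s
  set D := KaehlerDifferential.D ℤ_[p] (maxOrder F)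
  let W : maxOrder F := ⟨e QuadraticAlgebra.omega, isIntegral_sqrt e⟩
  obtain ⟨x, y, hxy⟩ := exists_coords hp hu.squarefree e s.2
  have hs : s = x • 1 + y • W := Subtype.ext hxy
  have hW : D W = 0 := derivation_sqrt D hu (isUnit_two hp) (one_mul 1) (one_mul W)
    (Subtype.ext (sqrt_mul_sqrt e))
  rw [hs, map_add, D.map_smul, D.map_smul, hW, D.map_one_eq_zero, smul_zero, smul_zero, add_zero]

/-- The maximal order is spanned by the idempotents `E`, `T` of the two factors and the square root
`W` in the first one; all three have zero differential. -/
theorem isUnramified_prodBase_of_unit (hp : p ≠ 2) {u : ℤ_[p]} (hu : IsUnit u)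
    (F : EtaleAlgebra ℚ_[p] 2)
    (e : QuadraticAlgebra ℚ_[p] (algebraMap ℤ_[p] ℚ_[p] u) 0 ≃ₐ[ℚ_[p]] F.carrier) :
    IsUnramified F.prodBase := by
  apply formallyUnramified_of_D_eq_zero
  intro s
  set D := KaehlerDifferential.D ℤ_[p] (maxOrder F.prodBase)
  have hint : ∀ z : F.carrier × ℚ_[p], IsIntegral ℤ_[p] z.1 → IsIntegral ℤ_[p] z.2 →
      IsIntegral ℤ_[p] (show F.prodBase.carrier from z) := by
    intro z h1 h2
    exact IsIntegral.pair h1 h2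
  let E : maxOrder F.prodBase := ⟨((1 : F.carrier), (0 : ℚ_[p])), hint _ isIntegral_one isIntegral_zero⟩
  let T : maxOrder F.prodBase := ⟨((0 : F.carrier), (1 : ℚ_[p])), hint _ isIntegral_zero isIntegral_one⟩
  let W : maxOrder F.prodBase := ⟨(e QuadraticAlgebra.omega, (0 : ℚ_[p])),
    hint _ (isIntegral_sqrt e) isIntegral_zero⟩
  have h1 : IsIntegral ℤ_[p] (show F.carrier × ℚ_[p] from s.1).1 := by
    exact IsIntegral.map_of_comp_eq (RingHom.id ℤ_[p]) (RingHom.fst F.carrier ℚ_[p]) rfl s.2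
  have h2 : IsIntegral ℤ_[p] (show F.carrier × ℚ_[p] from s.1).2 := by
    exact IsIntegral.map_of_comp_eq (RingHom.id ℤ_[p]) (RingHom.snd F.carrier ℚ_[p]) rfl s.2
  obtain ⟨x, y, hxy⟩ := exists_coords hp hu.squarefree e h1
  obtain ⟨t, ht⟩ := IsIntegrallyClosed.isIntegral_iff.1 h2
  have hs : s = x • E + y • W + t • T := by
    apply Subtype.ext
    refine Prod.ext ?_ ?_
    · refine hxy.trans ?_
      change _ = x • (1 : F.carrier) + y • e QuadraticAlgebra.omega + t • (0 : F.carrier)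
      rw [smul_zero, add_zero]
    · refine ht.symm.trans ?_
      change _ = x • (0 : ℚ_[p]) + y • (0 : ℚ_[p]) + t • (1 : ℚ_[p])
      rw [smul_zero, smul_zero, zero_add, zero_add, Algebra.algebraMap_eq_smul_one]
  have hEE : E * E = E := Subtype.ext (Prod.ext (one_mul _) (zero_mul _))
  have hTT : T * T = T := Subtype.ext (Prod.ext (zero_mul _) (one_mul _))
  have hEW : E * W = W := Subtype.ext (Prod.ext (one_mul _) (zero_mul _))
  have hWW : W * W = u • E := by
    apply Subtype.ext
    refine Prod.ext (sqrt_mul_sqrt e) ?_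
    change (0 : ℚ_[p]) * 0 = u • (0 : ℚ_[p])
    rw [smul_zero, zero_mul]
  rw [hs, map_add, map_add, D.map_smul, D.map_smul, D.map_smul, derivation_idempotent D hEE,
    derivation_idempotent D hTT, derivation_sqrt D hu (isUnit_two hp) hEE hEW hWW]
  simp

/-- Since `W² = p u`, the class of `W` generates a square-zero ideal modulo `p`, and conjugation
agrees with the identity modulo that ideal. Unramifiedness would make them agree modulo `p`, so `p`
would divide `2 W`, which is impossible for odd `p`. -/
theorem not_isUnramified_of_p_mul (hp : p ≠ 2) {u : ℤ_[p]} (hu : IsUnit u)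
    (F : EtaleAlgebra ℚ_[p] 2)
    (e : QuadraticAlgebra ℚ_[p] (algebraMap ℤ_[p] ℚ_[p] (p * u)) 0 ≃ₐ[ℚ_[p]] F.carrier) :
    ¬ IsUnramified F := by
  intro hF
  have hF' : Algebra.FormallyUnramified ℤ_[p] (maxOrder F) := hF
  let W : maxOrder F := ⟨e QuadraticAlgebra.omega, isIntegral_sqrt e⟩
  have hWW : W * W = ((p : ℤ_[p]) * u) • (1 : maxOrder F) := Subtype.ext (sqrt_mul_sqrt e)
  let c : F.carrier →ₐ[ℤ_[p]] F.carrier :=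
    ((e.toAlgHom.comp (conjHom _)).comp e.symm.toAlgHom).restrictScalars ℤ_[p]
  let σ : maxOrder F →ₐ[ℤ_[p]] maxOrder F := c.mapIntegralClosure
  have hσW : σ W = -W := by
    apply Subtype.ext
    change e (conjHom _ (e.symm (e QuadraticAlgebra.omega))) = -e QuadraticAlgebra.omega
    rw [e.symm_apply_apply, conjHom_apply, ← map_neg]
    congr 1
  let P : Ideal (maxOrder F) := Ideal.span {algebraMap ℤ_[p] (maxOrder F) p}
  let I : Ideal (maxOrder F ⧸ P) := Ideal.span {Ideal.Quotient.mk P W}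
  have hI : I ^ 2 = ⊥ := by
    rw [Ideal.span_singleton_pow, Ideal.span_singleton_eq_bot, pow_two, ← map_mul,
      Ideal.Quotient.eq_zero_iff_mem, hWW, mul_smul, Algebra.smul_def]
    exact Ideal.mul_mem_right _ _ (Ideal.mem_span_singleton_self _)
  have h := Algebra.FormallyUnramified.comp_injective (R := ℤ_[p]) (A := maxOrder F) I hI
    (a₁ := Ideal.Quotient.mkₐ ℤ_[p] P) (a₂ := (Ideal.Quotient.mkₐ ℤ_[p] P).comp σ) (by
      ext s
      change Ideal.Quotient.mk I (Ideal.Quotient.mk P s) =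
        Ideal.Quotient.mk I (Ideal.Quotient.mk P (σ s))
      rw [Ideal.Quotient.eq, ← map_sub]
      obtain ⟨x, y, hxy⟩ := exists_coords hp (squarefree_p_mul hu) e s.2
      have hs : s = x • 1 + y • W := Subtype.ext hxy
      have hd : s - σ s = algebraMap _ _ (2 * y) * W := by
        rw [hs, map_add, map_smul, map_smul, map_one, hσW, ← Algebra.smul_def, mul_smul, two_smul]
        rw [smul_neg]
        abel
      rw [hd, map_mul]
      exact Ideal.mul_mem_left _ _ (Ideal.mem_span_singleton_self _))
  have hW := DFunLike.congr_fun h W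
  change Ideal.Quotient.mk P W = Ideal.Quotient.mk P (σ W) at hW
  rw [Ideal.Quotient.eq, hσW, sub_neg_eq_add, Ideal.mem_span_singleton] at hW
  obtain ⟨s, hs⟩ := hW
  obtain ⟨x, y, hxy⟩ := exists_coords hp (squarefree_p_mul hu) e s.2
  have h1 := congrArg (fun t : maxOrder F => (e.symm (t : F.carrier)).im) hs
  have h2 : (e.symm ((W + W : maxOrder F) : F.carrier)).im = 2 := by
    change (e.symm (e QuadraticAlgebra.omega + e QuadraticAlgebra.omega)).im = 2
    rw [map_add, e.symm_apply_apply, im_omega_add_omega]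
  have h3 : (e.symm ((algebraMap ℤ_[p] (maxOrder F) p * s : maxOrder F) : F.carrier)).im
      = algebraMap ℤ_[p] ℚ_[p] (p * y) := by
    have h5 : ((algebraMap ℤ_[p] (maxOrder F) p * s : maxOrder F) : F.carrier) =
        e ⟨algebraMap ℤ_[p] ℚ_[p] (p * x), algebraMap ℤ_[p] ℚ_[p] (p * y)⟩ := by
      rw [← Algebra.smul_def]
      change (p : ℤ_[p]) • (s : F.carrier) = _
      rw [hxy, ← map_one e, ← IsScalarTower.algebraMap_smul ℚ_[p] x,
        ← IsScalarTower.algebraMap_smul ℚ_[p] y, ← IsScalarTower.algebraMap_smul ℚ_[p] (p : ℤ_[p]),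
        ← map_smul, ← map_smul, ← map_add, ← map_smul, smul_one_add_smul_omega, smul_mk,
        map_mul _ _ x, map_mul _ _ y]
    rw [h5, e.symm_apply_apply]
  rw [h2, h3, ← map_ofNat (algebraMap ℤ_[p] ℚ_[p]) 2] at h1
  have h4 := IsFractionRing.injective ℤ_[p] ℚ_[p] h1
  have : IsUnit (p : ℤ_[p]) := isUnit_of_dvd_unit ⟨y, h4⟩ (isUnit_two hp)
  exact PadicInt.prime_p.not_isUnit this

end Local

end QuadCount

end

/-! ### Square classes of `ℚ_p` and the local densities. -/

noncomputable section

namespace QuadCount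

/-- A nonzero integer as a unit of a field of characteristic zero. -/
def intUnit (K : Type) [Field K] [CharZero K] (n : ℤ) (hn : n ≠ 0) : Kˣ :=
  Units.mk0 (n : K) (Int.cast_ne_zero.2 hn)

section Local

variable {p : ℕ} [Fact p.Prime]

/-- Hensel's lemma for `T² - x` at the approximate root `1`. -/
theorem padic_exists_sq {x : ℤ_[p]} (hx : ‖x - 1‖ < ‖(2 : ℤ_[p])‖ ^ 2) : ∃ y : ℤ_[p], x = y ^ 2 := by
  have h := hensels_lemma (p := p) (R := ℤ_[p]) (F := Polynomial.X ^ 2 - Polynomial.C x) (a := 1) (by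
    simpa [Polynomial.aeval_def, one_add_one_eq_two, norm_sub_rev] using hx)
  obtain ⟨z, hz, -⟩ := h
  refine ⟨z, ?_⟩
  simp [Polynomial.aeval_def] at hz
  linear_combination -hz

/-- The quotient of two units that agree modulo `p^k` is close to `1`, hence a square. It is applied
with `k = 1` for odd `p` and `k = 3` for `p = 2`. -/
theorem exists_eq_mul_sq_of_toZModPow_eq {k : ℕ} (hk : ‖(p : ℤ_[p]) ^ k‖ < ‖(2 : ℤ_[p])‖ ^ 2)
    {u v : ℤ_[p]} (hv : IsUnit v) (h : PadicInt.toZModPow k u = PadicInt.toZModPow k v) :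
    ∃ c : ℤ_[p], u = v * c ^ 2 := by
  obtain ⟨v, rfl⟩ := hv
  rw [← sub_eq_zero, ← map_sub, toZModPow_eq_zero_iff] at h
  obtain ⟨t, ht⟩ := h
  have h1 : u * ↑v⁻¹ - 1 = (p : ℤ_[p]) ^ k * (t * ↑v⁻¹) := by
    have : (v : ℤ_[p]) * ↑v⁻¹ = 1 := v.mul_inv
    linear_combination (↑v⁻¹ : ℤ_[p]) * ht + this
  obtain ⟨y, hy⟩ := padic_exists_sq (x := u * ((v⁻¹ : ℤ_[p]ˣ) : ℤ_[p])) (by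
    rw [h1, norm_mul]
    refine lt_of_le_of_lt ?_ hk
    exact mul_le_of_le_one_right (norm_nonneg _) (PadicInt.norm_le_one _))
  refine ⟨y, ?_⟩
  rw [← hy, mul_comm u, ← mul_assoc, v.mul_inv, one_mul]

theorem norm_p_pow_one_lt (hp : p ≠ 2) : ‖(p : ℤ_[p]) ^ 1‖ < ‖(2 : ℤ_[p])‖ ^ 2 := by
  rw [PadicInt.isUnit_iff.1 (isUnit_two hp), pow_one, one_pow, PadicInt.norm_p]
  exact inv_lt_one_of_one_lt₀ (by exact_mod_cast (Fact.out : p.Prime).one_lt)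

theorem norm_two_pow_three_lt : ‖((2 : ℕ) : ℤ_[2]) ^ 3‖ < ‖(2 : ℤ_[2])‖ ^ 2 := by
  have := PadicInt.norm_p (p := 2)
  rw [norm_pow, this]
  push_cast at this
  rw [this]
  norm_num

theorem isUnit_intCast {n : ℤ} (hn : ¬ (p : ℤ) ∣ n) : IsUnit (n : ℤ_[p]) := by
  rw [PadicInt.isUnit_iff]
  rw [← PadicInt.norm_intCast_lt_one_iff] at hn
  exact le_antisymm (PadicInt.norm_le_one _) (not_lt.1 hn)

/-- Comparing norms, `j` and `j'` differ by twice the valuation of `c`; both are `0` or `1`, so they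
agree and `c` is a unit. -/
theorem unit_part {m m' : ℤ_[p]} (hm : IsUnit m) (hm' : IsUnit m') {j j' : Bool} {c : ℚ_[p]}
    (h : (p : ℚ_[p]) ^ j.toNat * m = (p : ℚ_[p]) ^ j'.toNat * m' * c ^ 2) :
    j = j' ∧ ∃ c' : ℤ_[p], m = m' * c' ^ 2 := by
  have hp0 : (p : ℚ_[p]) ≠ 0 := Nat.cast_ne_zero.2 (Fact.out : p.Prime).ne_zero
  have hm1 : ‖(m : ℚ_[p])‖ = 1 := PadicInt.isUnit_iff.1 hm
  have hm2 : ‖(m' : ℚ_[p])‖ = 1 := PadicInt.isUnit_iff.1 hm'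
  have hc0 : c ≠ 0 := by
    rintro rfl
    have : (m : ℚ_[p]) = 0 := by
      have h0 : (p : ℚ_[p]) ^ j.toNat * m = 0 := by rw [h]; ring
      exact (mul_eq_zero.1 h0).resolve_left (pow_ne_zero _ hp0)
    rw [this, norm_zero] at hm1
    exact zero_ne_one hm1
  have hp1 : (1 : ℝ) < p := by exact_mod_cast (Fact.out : p.Prime).one_lt
  have hn := congrArg norm h
  rw [norm_mul, norm_mul, norm_mul, hm1, hm2, norm_pow, norm_pow, norm_pow, Padic.norm_p,
    Padic.norm_eq_zpow_neg_valuation hc0, mul_one, mul_one, ← zpow_natCast, ← zpow_natCast,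
    ← zpow_natCast, ← zpow_mul, inv_zpow', inv_zpow', ← zpow_add₀ (by positivity)] at hn
  have hexp := zpow_right_injective₀ (by positivity) hp1.ne' hn
  have hv : c.valuation = 0 := by
    cases j <;> cases j' <;> simp at hexp <;> omega
  have hjj : j = j' := by
    rw [hv] at hexp
    cases j <;> cases j' <;> simp at hexp <;> rfl
  refine ⟨hjj, ⟨c, ?_⟩, ?_⟩
  · rw [Padic.norm_eq_zpow_neg_valuation hc0, hv]; simp
  · subst hjj
    apply PadicInt.ext
    refine mul_left_cancel₀ (pow_ne_zero _ hp0) (h.trans ?_)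
    change _ = (p : ℚ_[p]) ^ j.toNat * ((m' : ℚ_[p]) * c ^ 2)
    ring

theorem exists_unit_decomposition (a : ℚ_[p]ˣ) : ∃ (j : Bool) (u : ℤ_[p]) (c : ℚ_[p]),
    IsUnit u ∧ (a : ℚ_[p]) = (p : ℚ_[p]) ^ j.toNat * u * c ^ 2 := by
  have hp0 : (p : ℚ_[p]) ≠ 0 := Nat.cast_ne_zero.2 (Fact.out : p.Prime).ne_zero
  have hpR : (p : ℝ) ≠ 0 := Nat.cast_ne_zero.2 (Fact.out : p.Prime).ne_zero
  set k := (a : ℚ_[p]).valuation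
  have hu : ‖(a : ℚ_[p]) * (p : ℚ_[p]) ^ (-k)‖ = 1 := by
    rw [norm_mul, norm_zpow, Padic.norm_p, Padic.norm_eq_zpow_neg_valuation a.ne_zero, inv_zpow',
      ← zpow_add₀ hpR]
    simp [k]
  obtain ⟨q, hq | hq⟩ := k.even_or_odd'
  · refine ⟨false, ⟨_, hu.le⟩, (p : ℚ_[p]) ^ q, PadicInt.isUnit_iff.2 hu, ?_⟩
    simp only [Bool.toNat_false, pow_zero, one_mul]
    rw [mul_assoc, ← zpow_natCast, ← zpow_mul, ← zpow_add₀ hp0, hq]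
    rw [show -(2 * q) + q * ((2 : ℕ) : ℤ) = 0 by push_cast; ring]
    simp
  · refine ⟨true, ⟨_, hu.le⟩, (p : ℚ_[p]) ^ q, PadicInt.isUnit_iff.2 hu, ?_⟩
    simp only [Bool.toNat_true]
    rw [mul_comm ((p : ℚ_[p]) ^ 1), mul_assoc, mul_assoc, ← zpow_natCast, ← zpow_natCast,
      ← zpow_mul, ← zpow_add₀ hp0, ← zpow_add₀ hp0, hq]
    rw [show -(2 * q + 1) + (((1 : ℕ) : ℤ) + q * ((2 : ℕ) : ℤ)) = 0 by push_cast; ring]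
    simp

theorem finsum_mem_eq_sum {ι : Type} [Fintype ι] {f : ι → EtaleClass ℚ_[p] 2}
    (hf : Function.Bijective f) (S : Set (EtaleClass ℚ_[p] 3)) [DecidablePred (· ∈ S)] :
    ∑ᶠ (F : EtaleClass ℚ_[p] 2) (_ : F.prodBase ∈ S), F.mass =
      ∑ i, if (f i).prodBase ∈ S then (f i).mass else 0 := by
  rw [← finsum_eq_sum_of_fintype]
  symm
  apply finsum_eq_of_bijective f hf
  intro i
  by_cases h : (f i).prodBase ∈ S
  · simp [h]
  · simp [h]

theorem finsum_mass_eq_sum {ι : Type} [Fintype ι] {f : ι → EtaleClass ℚ_[p] 2}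
    (hf : Function.Bijective f) :
    ∑ᶠ (F : EtaleClass ℚ_[p] 2), F.mass = ∑ i, (f i).mass := by
  rw [← finsum_eq_sum_of_fintype]
  exact (finsum_eq_of_bijective f hf fun _ => rfl).symm

end Local

section Odd

variable (p : ℕ) [Fact p.Prime]

theorem exists_nonresidue (hp : p ≠ 2) : ∃ n : ℤ, jacobiSym n p = -1 := by
  obtain ⟨a, ha⟩ := FiniteField.exists_nonsquare (F := ZMod p) (by rwa [ZMod.ringChar_zmod_n])
  obtain ⟨n, rfl⟩ := ZMod.intCast_surjective a
  refine ⟨n, ?_⟩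
  rw [← jacobiSym.legendreSym.to_jacobiSym]
  exact legendreSym.eq_neg_one_iff p |>.2 ha

variable {p} in
theorem not_dvd_of_jacobiSym_ne_zero {n : ℤ} (h : jacobiSym n p ≠ 0) : ¬ (p : ℤ) ∣ n := by
  intro hd
  apply h
  rw [← jacobiSym.legendreSym.to_jacobiSym, legendreSym.eq_zero_iff]
  rwa [ZMod.intCast_zmod_eq_zero_iff_dvd]

variable {p} in
theorem jacobiSym_eq_one_or_neg_one {n : ℤ} (h : ¬ (p : ℤ) ∣ n) :
    jacobiSym n p = 1 ∨ jacobiSym n p = -1 := by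
  rw [← jacobiSym.legendreSym.to_jacobiSym]
  apply legendreSym.eq_one_or_neg_one
  rwa [Ne, ZMod.intCast_zmod_eq_zero_iff_dvd]

/-- The integer `1` or a quadratic nonresidue modulo the odd prime `p`. -/
def residueRep (s : Bool) : ℤ :=
  if s then (if h : p ≠ 2 then (exists_nonresidue p h).choose else 1) else 1

theorem jacobiSym_residueRep (hp : p ≠ 2) (s : Bool) :
    jacobiSym (residueRep p s) p = if s then -1 else 1 := by
  cases s
  · simp [residueRep]
  · simp only [residueRep, if_true, dif_pos hp]
    exact (exists_nonresidue p hp).choose_spec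

theorem residueRep_not_dvd (s : Bool) : ¬ (p : ℤ) ∣ residueRep p s := by
  by_cases hp : p = 2
  · subst hp
    cases s <;> simp [residueRep]
  · apply not_dvd_of_jacobiSym_ne_zero
    rw [jacobiSym_residueRep p hp]
    cases s <;> simp

theorem pow_mul_ne_zero {n : ℤ} (hn : ¬ (p : ℤ) ∣ n) (j : Bool) : (p : ℤ) ^ j.toNat * n ≠ 0 := by
  refine mul_ne_zero (pow_ne_zero _ (Int.natCast_ne_zero.2 (Fact.out : p.Prime).ne_zero)) ?_
  rintro rfl
  exact hn (dvd_zero _)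

/-- The four classes of quadratic étale algebras over `ℚ_p`, `p` odd. -/
def oddClass (x : Bool × Bool) : EtaleClass ℚ_[p] 2 :=
  quadClass (intUnit ℚ_[p] ((p : ℤ) ^ x.1.toNat * residueRep p x.2)
    (pow_mul_ne_zero p (residueRep_not_dvd p x.2) x.1))

variable {p}

/-- Equal symbols make `n m` a square modulo `p`, so `n ≡ m T²` for some integer `T`, and this lifts
to `ℤ_p`. -/
theorem exists_eq_mul_sq_of_jacobiSym_eq (hp : p ≠ 2) {n m : ℤ} (hm : ¬ (p : ℤ) ∣ m)
    (h : jacobiSym n p = jacobiSym m p) : ∃ c : ℤ_[p], (n : ℤ_[p]) = m * c ^ 2 := by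
  have hm0 : ((m : ℤ) : ZMod p) ≠ 0 := by rwa [Ne, ZMod.intCast_zmod_eq_zero_iff_dvd]
  have hsq : IsSquare (((n * m : ℤ)) : ZMod p) := by
    have h1 : jacobiSym (n * m) p = 1 := by
      rw [jacobiSym.mul_left, h]
      rcases jacobiSym_eq_one_or_neg_one hm with h | h <;> rw [h] <;> norm_num
    apply (legendreSym.eq_one_iff p (a := n * m) ?_).1
    · rw [jacobiSym.legendreSym.to_jacobiSym, h1]
    · intro h0
      rw [← legendreSym.eq_zero_iff, jacobiSym.legendreSym.to_jacobiSym, h1] at h0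
      exact one_ne_zero h0
  obtain ⟨t, ht⟩ := hsq
  obtain ⟨T, hT⟩ := ZMod.intCast_surjective (t / (m : ZMod p))
  have hnm : ((n : ℤ) : ZMod p) = ((m * T ^ 2 : ℤ) : ZMod p) := by
    push_cast at ht ⊢
    rw [hT]
    field_simp
    rw [ht]
    ring
  have hT0 : ¬ (p : ℤ) ∣ m * T ^ 2 := by
    rw [← ZMod.intCast_zmod_eq_zero_iff_dvd, ← hnm, ZMod.intCast_zmod_eq_zero_iff_dvd]
    apply not_dvd_of_jacobiSym_ne_zero
    rw [h]
    rcases jacobiSym_eq_one_or_neg_one hm with h | h <;> rw [h] <;> norm_num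
  obtain ⟨c, hc⟩ := exists_eq_mul_sq_of_toZModPow_eq (p := p) (k := 1) (norm_p_pow_one_lt hp)
    (u := (n : ℤ_[p])) (v := ((m * T ^ 2 : ℤ) : ℤ_[p])) (isUnit_intCast hT0) (by
      rw [map_intCast, map_intCast]
      rw [← sub_eq_zero, ← Int.cast_sub, ZMod.intCast_zmod_eq_zero_iff_dvd, pow_one,
        ← ZMod.intCast_zmod_eq_zero_iff_dvd, Int.cast_sub, hnm, sub_self])
  refine ⟨T * c, ?_⟩
  rw [hc]
  push_cast
  ring

theorem quadClass_eq_oddClass (hp : p ≠ 2) {n : ℤ} (hn : ¬ (p : ℤ) ∣ n) (j : Bool) :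
    quadClass (intUnit ℚ_[p] ((p : ℤ) ^ j.toNat * n) (pow_mul_ne_zero p hn j)) =
      oddClass p (j, decide (jacobiSym n p = -1)) := by
  obtain ⟨c, hc⟩ := exists_eq_mul_sq_of_jacobiSym_eq hp (n := n)
    (residueRep_not_dvd p (decide (jacobiSym n p = -1))) (by
      rw [jacobiSym_residueRep p hp]
      rcases jacobiSym_eq_one_or_neg_one hn with h | h <;> rw [h] <;> simp)
  apply quadClass_eq_of_eq_mul_sq (c := (c : ℚ_[p]))
  have := congrArg (fun t : ℤ_[p] => (t : ℚ_[p])) hc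
  simp only [PadicInt.coe_intCast, PadicInt.coe_mul, PadicInt.coe_pow] at this
  simp only [intUnit, Units.val_mk0]
  push_cast
  rw [this]
  ring

theorem oddClass_bijective (hp : p ≠ 2) : Function.Bijective (oddClass p) := by
  constructor
  · rintro ⟨j, s⟩ ⟨j', s'⟩ h
    obtain ⟨c, -, hc⟩ := quadClass_eq h
    simp only [intUnit, Units.val_mk0] at hc
    push_cast at hc
    obtain ⟨hj, c', hc'⟩ := unit_part (isUnit_intCast (residueRep_not_dvd p s))
      (isUnit_intCast (residueRep_not_dvd p s')) (by simpa using hc)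
    refine Prod.ext hj ?_
    have h1 := congrArg (PadicInt.toZMod (p := p)) hc'
    rw [map_mul, map_pow, map_intCast, map_intCast] at h1
    obtain ⟨T, hT⟩ := ZMod.intCast_surjective (PadicInt.toZMod c')
    rw [← hT] at h1
    have h2 : jacobiSym (residueRep p s) p = jacobiSym (residueRep p s' * T ^ 2) p := by
      rw [← jacobiSym.legendreSym.to_jacobiSym, ← jacobiSym.legendreSym.to_jacobiSym]
      simp only [legendreSym]
      push_cast
      rw [h1]
    have h3 : jacobiSym (T ^ 2) p = 1 := by
      rw [jacobiSym.mul_left] at h2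
      have h4 : jacobiSym (T ^ 2) p ≠ 0 := by
        intro h0
        rw [h0, mul_zero, jacobiSym_residueRep p hp] at h2
        cases s <;> simp at h2
      rw [jacobiSym.pow_left] at h4 ⊢
      rcases jacobiSym_eq_one_or_neg_one (p := p) (n := T)
        (not_dvd_of_jacobiSym_ne_zero (fun h => h4 (by rw [h]; norm_num))) with h | h <;>
        rw [h] <;> norm_num
    rw [jacobiSym.mul_left, h3, jacobiSym_residueRep p hp, jacobiSym_residueRep p hp] at h2
    cases s <;> cases s' <;> simp at h2 <;> rfl
  · intro F
    obtain ⟨a, rfl⟩ := quadClass_surjective F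
    obtain ⟨j, u, c, hu, ha⟩ := exists_unit_decomposition a
    obtain ⟨n, hn⟩ := ZMod.intCast_surjective (PadicInt.toZModPow 1 u)
    have hnu : ¬ (p : ℤ) ∣ n := by
      rw [← ZMod.intCast_zmod_eq_zero_iff_dvd]
      intro h0
      have h1 : PadicInt.toZModPow 1 u = 0 := by
        rw [← hn, ZMod.intCast_zmod_eq_zero_iff_dvd, pow_one, ← ZMod.intCast_zmod_eq_zero_iff_dvd]
        exact h0
      rw [toZModPow_eq_zero_iff, pow_one] at h1
      exact PadicInt.prime_p.not_isUnit (isUnit_of_dvd_unit h1 hu)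
    obtain ⟨d, hd⟩ := exists_eq_mul_sq_of_toZModPow_eq (p := p) (k := 1) (norm_p_pow_one_lt hp)
      (u := u) (v := (n : ℤ_[p])) (isUnit_intCast hnu) (by rw [map_intCast, hn])
    refine ⟨_, (quadClass_eq_oddClass hp hnu j).symm.trans ?_⟩
    symm
    apply quadClass_eq_of_eq_mul_sq (c := (d : ℚ_[p]) * c)
    rw [ha, hd]
    simp only [intUnit, Units.val_mk0]
    push_cast
    ring

theorem mass_oddClass (hp : p ≠ 2) (x : Bool × Bool) :
    (oddClass p x).mass = 1 / (2 * (p : ℝ) ^ x.1.toNat) := by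
  obtain ⟨j, s⟩ := x
  have hu := isUnit_intCast (residueRep_not_dvd p s)
  cases j
  · rw [oddClass, mass_unit hp _ hu (by simp [intUnit])]
    simp
  · rw [oddClass, mass_p_mul_unit hp _ hu (by simp [intUnit])]
    simp

theorem isUnramified_of_oddClass (hp : p ≠ 2) {F : EtaleAlgebra ℚ_[p] 2} {s : Bool}
    (h : F.toClass = oddClass p (false, s)) : IsUnramified F ∧ IsUnramified F.prodBase := by
  obtain ⟨e⟩ := toClass_eq_iff.1 h
  have hu := isUnit_intCast (residueRep_not_dvd p s)
  have e' := (nonempty_equiv_of_sq_mul (K := ℚ_[p])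
    (a := algebraMap ℤ_[p] ℚ_[p] (residueRep p s))
    (b := (intUnit ℚ_[p] ((p : ℤ) ^ false.toNat * residueRep p s)
      (pow_mul_ne_zero p (residueRep_not_dvd p s) false) : ℚ_[p]))
    one_ne_zero (by simp [intUnit])).some
  exact ⟨isUnramified_of_unit hp hu F (e'.trans e.symm),
    isUnramified_prodBase_of_unit hp hu F (e'.trans e.symm)⟩

theorem not_isUnramified_of_oddClass (hp : p ≠ 2) {F : EtaleAlgebra ℚ_[p] 2} {s : Bool}
    (h : F.toClass = oddClass p (true, s)) : ¬ IsUnramified F := by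
  obtain ⟨e⟩ := toClass_eq_iff.1 h
  have hu := isUnit_intCast (residueRep_not_dvd p s)
  have e' := (nonempty_equiv_of_sq_mul (K := ℚ_[p])
    (a := algebraMap ℤ_[p] ℚ_[p] (p * residueRep p s))
    (b := (intUnit ℚ_[p] ((p : ℤ) ^ true.toNat * residueRep p s)
      (pow_mul_ne_zero p (residueRep_not_dvd p s) true) : ℚ_[p]))
    one_ne_zero (by simp [intUnit])).some
  exact not_isUnramified_of_p_mul hp hu F (e'.trans e.symm)

-- The four classes have masses `1/2, 1/2, 1/(2p), 1/(2p)`; their sum is the denominator.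
open Classical in
theorem localDensity_odd (hp : p ≠ 2) (S : Set (EtaleClass ℚ_[p] 3)) :
    localDensity S = (∑ x : Bool × Bool, if (oddClass p x).prodBase ∈ S then
      1 / (2 * (p : ℝ) ^ x.1.toNat) else 0) / (1 + 1 / p) := by
  rw [localDensity, finsum_mem_eq_sum (oddClass_bijective hp), finsum_mass_eq_sum
    (oddClass_bijective hp)]
  simp only [mass_oddClass hp]
  congr 1
  have : (p : ℝ) ≠ 0 := Nat.cast_ne_zero.2 (Fact.out : p.Prime).ne_zero
  simp only [Fintype.sum_prod_type, Fintype.sum_bool, Bool.toNat_true, Bool.toNat_false]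
  field_simp
  ring

end Odd

section Two

theorem padicInt_coe_two : ((2 : ℤ_[2]) : ℚ_[2]) = 2 := map_ofNat PadicInt.Coe.ringHom 2

theorem two_pow_mul_ne_zero (x : Bool × Fin 4) : (2 : ℤ) ^ x.1.toNat * (2 * (x.2 : ℕ) + 1) ≠ 0 :=
  mul_ne_zero (pow_ne_zero _ two_ne_zero) (by omega)

/-- The eight classes of quadratic étale algebras over `ℚ_2`. -/
def twoClass (x : Bool × Fin 4) : EtaleClass ℚ_[2] 2 :=
  quadClass (intUnit ℚ_[2] ((2 : ℤ) ^ x.1.toNat * (2 * (x.2 : ℕ) + 1)) (two_pow_mul_ne_zero x))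

/-- The discriminants of the eight quadratic étale algebras over `ℚ_2`. -/
def twoDisc (x : Bool × Fin 4) : ℕ :=
  if x.1 then 8 else if (x.2 : ℕ) % 2 = 0 then 1 else 4

theorem two_not_dvd_odd (k : ℕ) : ¬ ((2 : ℕ) : ℤ) ∣ 2 * (k : ℤ) + 1 := by
  push_cast
  omega

theorem quadClass_eq_twoClass {n : ℤ} (j : Bool) (k : Fin 4) (hn : n % 8 = 2 * (k : ℕ) + 1)
    (h0 : (2 : ℤ) ^ j.toNat * n ≠ 0) :
    quadClass (intUnit ℚ_[2] ((2 : ℤ) ^ j.toNat * n) h0) = twoClass (j, k) := by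
  obtain ⟨c, hc⟩ := exists_eq_mul_sq_of_toZModPow_eq (p := 2) (k := 3) norm_two_pow_three_lt
    (u := (n : ℤ_[2])) (v := ((2 * (k : ℕ) + 1 : ℤ) : ℤ_[2])) (isUnit_intCast (two_not_dvd_odd _)) (by
      rw [map_intCast, map_intCast, ← sub_eq_zero, ← Int.cast_sub,
        ZMod.intCast_zmod_eq_zero_iff_dvd]
      push_cast
      omega)
  apply quadClass_eq_of_eq_mul_sq (c := (c : ℚ_[2]))
  have := congrArg (fun t : ℤ_[2] => (t : ℚ_[2])) hc
  simp only [PadicInt.coe_intCast, PadicInt.coe_mul, PadicInt.coe_pow] at this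
  simp only [intUnit, Units.val_mk0]
  rw [Int.cast_mul, this]
  push_cast
  ring

theorem twoClass_bijective : Function.Bijective twoClass := by
  constructor
  · rintro ⟨j, s⟩ ⟨j', s'⟩ h
    obtain ⟨c, -, hc⟩ := quadClass_eq h
    simp only [intUnit, Units.val_mk0] at hc
    obtain ⟨hj, c', hc'⟩ := unit_part (isUnit_intCast (two_not_dvd_odd s))
      (isUnit_intCast (two_not_dvd_odd s')) (by
        rw [Int.cast_mul, Int.cast_mul] at hc
        simpa [padicInt_coe_two] using hc)
    refine Prod.ext hj ?_
    change s = s'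
    have h1 := congrArg (PadicInt.toZModPow (p := 2) 3) hc'
    rw [map_mul, map_pow, map_intCast, map_intCast] at h1
    generalize PadicInt.toZModPow 3 c' = t at h1
    change ZMod 8 at t
    change (((2 * (s : ℕ) + 1 : ℤ)) : ZMod 8) = ((2 * (s' : ℕ) + 1 : ℤ) : ZMod 8) * t ^ 2 at h1
    clear hc' h hc
    -- A finite check: odd squares are `1` modulo `8`, so the odd part is determined modulo `8`.
    revert t s s'
    decide
  · intro F
    obtain ⟨a, rfl⟩ := quadClass_surjective F
    obtain ⟨j, u, c, hu, ha⟩ := exists_unit_decomposition a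
    obtain ⟨n, hn⟩ := ZMod.intCast_surjective (PadicInt.toZModPow 3 u)
    have hnu : ¬ ((2 : ℕ) : ℤ) ∣ n := by
      rintro ⟨t, rfl⟩
      rw [← map_intCast (PadicInt.toZModPow (p := 2) 3), ← sub_eq_zero, ← map_sub,
        toZModPow_eq_zero_iff] at hn
      have h2 : ((2 : ℕ) : ℤ_[2]) ∣ ((((2 : ℕ) : ℤ) * t : ℤ) : ℤ_[2]) - u :=
        (dvd_pow_self _ three_ne_zero).trans hn
      have h3 : ((2 : ℕ) : ℤ_[2]) ∣ u := by
        rw [dvd_sub_right ⟨(t : ℤ_[2]), by push_cast; ring⟩] at h2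
        exact h2
      exact PadicInt.prime_p.not_isUnit (isUnit_of_dvd_unit h3 hu)
    obtain ⟨d, hd⟩ := exists_eq_mul_sq_of_toZModPow_eq (p := 2) (k := 3) norm_two_pow_three_lt
      (u := u) (v := (n : ℤ_[2])) (isUnit_intCast hnu) (by rw [map_intCast, hn])
    have hn0 : (2 : ℤ) ^ j.toNat * n ≠ 0 := pow_mul_ne_zero 2 hnu j
    have h8 : n % 8 = 2 * ((⟨(n % 8 / 2).toNat, by omega⟩ : Fin 4) : ℕ) + 1 := by
      push_cast at hnu
      simp only
      omega
    refine ⟨_, (quadClass_eq_twoClass j _ h8 hn0).symm.trans ?_⟩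
    symm
    apply quadClass_eq_of_eq_mul_sq (c := (d : ℚ_[2]) * c)
    rw [ha, hd]
    simp only [intUnit, Units.val_mk0]
    push_cast
    ring

theorem isUnit_odd (k : ℕ) : IsUnit ((2 : ℤ_[2]) * k + 1) := by
  simpa using isUnit_intCast (two_not_dvd_odd k)

theorem four_dvd_iff (x : ℤ_[2]) : PadicInt.toZModPow 2 x = 0 ↔ 4 ∣ x := by
  rw [toZModPow_eq_zero_iff]
  norm_num

/-- For even `k` the radicand `2k + 1` is `1` modulo `4` and the discriminant is a unit. For odd
`k`, and for the even radicands, the maximal order is `ℤ_2[√n]` with discriminant `4n`, that is `4`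
or `8` up to units. -/
theorem mass_twoClass (x : Bool × Fin 4) : (twoClass x).mass = 1 / (2 * (twoDisc x : ℝ)) := by
  obtain ⟨j, k⟩ := x
  have hu := isUnit_odd k
  have hprime : Prime (2 : ℤ_[2]) := by simpa using PadicInt.prime_p (p := 2)
  cases j
  · by_cases hk : (k : ℕ) % 2 = 0
    · have h := mass_of_isQuadDisc (p := 2) (k := 0) (n := 2 * k + 1) (δ := 2 * k + 1)
        (intUnit ℚ_[2] ((2 : ℤ) ^ false.toNat * (2 * (k : ℕ) + 1)) (two_pow_mul_ne_zero (false, k)))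
        (by
          have h4 : (4 : ℤ_[2]) ∣ (2 * ((k : ℕ) : ℤ_[2]) + 1) - 1 := by
            obtain ⟨t, ht⟩ := Nat.dvd_of_mod_eq_zero hk
            refine ⟨t, ?_⟩
            rw [ht]
            push_cast
            ring
          exact isQuadDisc_self hu.squarefree h4 (dvd_sub_of_four_dvd hprime h4))
        (by simp [intUnit, padicInt_coe_two]) (by rw [pow_zero, associated_one_iff_isUnit]; exact hu)
      rw [twoClass, h]
      simp [twoDisc, hk]
    · have h := mass_of_isQuadDisc (p := 2) (k := 2) (n := 2 * k + 1) (δ := 4 * (2 * k + 1))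
        (intUnit ℚ_[2] ((2 : ℤ) ^ false.toNat * (2 * (k : ℕ) + 1)) (two_pow_mul_ne_zero (false, k)))
        (by
          apply isQuadDisc_four_mul hu.squarefree
          apply two_dvd_of_four_dvd (PadicInt.toZModPow 2) four_dvd_iff
          right
          change PadicInt.toZModPow 2 (2 * ((k : ℕ) : ℤ_[2]) + 1) = 3
          rw [show (2 * ((k : ℕ) : ℤ_[2]) + 1) = ((2 * (k : ℕ) + 1 : ℕ) : ℤ_[2]) by push_cast; ring,
            map_natCast]
          clear hu
          revert k
          decide)
        (by simp [intUnit, padicInt_coe_two]) (by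
          have := associated_mul_unit_left (4 : ℤ_[2]) _ hu
          norm_num
          exact this)
      rw [twoClass, h]
      simp [twoDisc, hk]
      norm_num
  · have h := mass_of_isQuadDisc (p := 2) (k := 3) (n := (2 : ℕ) * (2 * k + 1))
        (δ := 4 * ((2 : ℕ) * (2 * k + 1)))
        (intUnit ℚ_[2] ((2 : ℤ) ^ true.toNat * (2 * (k : ℕ) + 1)) (two_pow_mul_ne_zero (true, k)))
        (by
          apply isQuadDisc_four_mul (squarefree_p_mul hu)
          apply two_dvd_of_four_dvd (PadicInt.toZModPow 2) four_dvd_iff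
          left
          change PadicInt.toZModPow 2 (((2 : ℕ) : ℤ_[2]) * (2 * ((k : ℕ) : ℤ_[2]) + 1)) = 2
          rw [show (((2 : ℕ) : ℤ_[2]) * (2 * ((k : ℕ) : ℤ_[2]) + 1)) =
              ((2 * (2 * (k : ℕ) + 1) : ℕ) : ℤ_[2]) by push_cast; ring, map_natCast]
          clear hu
          revert k
          decide)
        (by simp [intUnit, padicInt_coe_two]) (by
          have := associated_mul_unit_left (8 : ℤ_[2]) _ hu
          rw [show (4 : ℤ_[2]) * (((2 : ℕ) : ℤ_[2]) * (2 * ((k : ℕ) : ℤ_[2]) + 1)) =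
            8 * (2 * ((k : ℕ) : ℤ_[2]) + 1) by push_cast; ring]
          norm_num
          exact this)
    rw [twoClass, h]
    simp [twoDisc]
    norm_num

-- The factors `1/2` from the automorphism groups cancel, and the eight reciprocals of discriminants
-- add up to `2 + 2/4 + 4/8 = 3`.
open Classical in
theorem localDensity_two (S : Set (EtaleClass ℚ_[2] 3)) :
    localDensity S = (∑ x : Bool × Fin 4, if (twoClass x).prodBase ∈ S then
      1 / (twoDisc x : ℝ) else 0) / 3 := by
  rw [localDensity, finsum_mem_eq_sum twoClass_bijective, finsum_mass_eq_sum twoClass_bijective]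
  have h : ∑ x, (twoClass x).mass = 3 / 2 := by
    simp only [mass_twoClass, Fintype.sum_prod_type, Fintype.sum_bool, Fin.sum_univ_four, twoDisc]
    norm_num
  rw [h]
  simp only [mass_twoClass]
  rw [show (3 : ℝ) / 2 = (1 / 2) * 3 by norm_num, ← div_div, Finset.sum_div]
  congr 1
  apply Finset.sum_congr rfl
  intro x _
  split_ifs
  · rw [div_div]
    congr 1
    ring
  · simp

end Two

end QuadCount

end

/-! ### Quadratic fields as squarefree integers. -/

noncomputable section

namespace QuadCount

/-- The discriminant of `ℚ(√n)`, for `n` squarefree. -/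
def fundDisc (n : ℤ) : ℤ := if n % 4 = 1 then n else 4 * n

theorem isQuadDisc_fundDisc {n : ℤ} (hn : Squarefree n) : IsQuadDisc ℚ n (fundDisc n) := by
  have h4 : ¬ (4 : ℤ) ∣ n := by
    rintro ⟨t, rfl⟩
    have := hn 2 ⟨t, by ring⟩
    rw [Int.isUnit_iff] at this
    omega
  by_cases h : n % 4 = 1
  · rw [fundDisc, if_pos h]
    have h4 : (4 : ℤ) ∣ n - 1 := by omega
    exact isQuadDisc_self hn h4 (dvd_sub_of_four_dvd Int.prime_two h4)
  · rw [fundDisc, if_neg h]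
    apply isQuadDisc_four_mul hn
    apply two_dvd_of_four_dvd (Int.castRingHom (ZMod 4))
    · intro x
      rw [eq_intCast, ZMod.intCast_zmod_eq_zero_iff_dvd]
      rfl
    · have h' : n % 4 = 2 ∨ n % 4 = 3 := by omega
      rw [eq_intCast]
      rcases h' with h' | h'
      · left
        change (n : ZMod 4) = ((2 : ℤ) : ZMod 4)
        rw [← sub_eq_zero, ← Int.cast_sub, ZMod.intCast_zmod_eq_zero_iff_dvd]
        push_cast
        omega
      · right
        change (n : ZMod 4) = ((3 : ℤ) : ZMod 4)
        rw [← sub_eq_zero, ← Int.cast_sub, ZMod.intCast_zmod_eq_zero_iff_dvd]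
        push_cast
        omega

/-- An integral basis has discriminant `δ D²`. A tuple of discriminant `δ` is an integral
combination of that basis, so `δ` is `m²` times the field discriminant. Hence `(m D)² = 1`, without
writing down an integral basis. -/
theorem discr_eq_of_isQuadDisc {L : Type} [Field L] [NumberField L] (hL : Module.finrank ℚ L = 2)
    {n δ : ℤ} (h : IsQuadDisc ℚ n δ) (hδ : δ ≠ 0)
    (e : QuadraticAlgebra ℚ (algebraMap ℤ ℚ n) 0 ≃ₐ[ℚ] L) : NumberField.discr L = δ := by
  obtain ⟨h1, c, hc, hcδ⟩ := h L e
  have hcard : Fintype.card (Module.Free.ChooseBasisIndex ℤ (NumberField.RingOfIntegers L)) = 2 := by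
    rw [← Module.finrank_eq_card_chooseBasisIndex, NumberField.RingOfIntegers.rank, hL]
  let ι := Fintype.equivFinOfCardEq hcard
  let b := (NumberField.integralBasis L).reindex ι
  have hb : Algebra.discr ℚ b = (NumberField.discr L : ℚ) := by
    rw [NumberField.coe_discr, ← Algebra.discr_reindex ℚ (NumberField.integralBasis L) ι]
    simp [b]
  have hbint : ∀ i, IsIntegral ℤ (b i) := by
    intro i
    simp only [b, Module.Basis.reindex_apply, NumberField.integralBasis_apply]
    exact NumberField.RingOfIntegers.isIntegral_coe _
  obtain ⟨D, hD⟩ := h1 b hbint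
  have hP : ∀ i j, ∃ m : ℤ, b.toMatrix c i j = m := by
    intro i j
    refine ⟨(NumberField.RingOfIntegers.basis L).repr ⟨c j, hc j⟩ (ι.symm i), ?_⟩
    rw [Module.Basis.toMatrix_apply, Module.Basis.repr_reindex_apply]
    exact NumberField.integralBasis_repr_apply (K := L) ⟨c j, hc j⟩ (ι.symm i)
  choose P hP using hP
  have hdet : (b.toMatrix c).det = (P 0 0 * P 1 1 - P 0 1 * P 1 0 : ℤ) := by
    rw [Matrix.det_fin_two, hP, hP, hP, hP]
    push_cast
    ring
  have h2 := Algebra.discr_of_matrix_vecMul (A := ℚ) b (b.toMatrix c)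
  rw [Module.Basis.toMatrix_map_vecMul, hcδ, hdet, hb] at h2
  rw [hb] at hD
  simp only [eq_intCast] at hD h2
  norm_cast at hD h2
  set m := P 0 0 * P 1 1 - P 0 1 * P 1 0
  have h3 : (m * D) ^ 2 = 1 := by
    apply mul_left_cancel₀ hδ
    rw [hD] at h2
    linear_combination -h2
  have h4 : IsUnit D := by
    apply isUnit_of_dvd_one
    rw [← h3]
    exact ⟨m ^ 2 * D, by ring⟩
  rw [hD, Int.isUnit_sq h4, mul_one]

theorem fundDisc_ne_zero {n : ℤ} (hn : n ≠ 0) : fundDisc n ≠ 0 := by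
  unfold fundDisc
  split_ifs <;> omega

/-- Squarefreeness of `m` and of `n` makes `c` and `c⁻¹` integers, so `c² = 1`. -/
theorem int_eq_of_squarefree {n m : ℤ} (hn : Squarefree n) (hm : Squarefree m) {c : ℚ}
    (h : (n : ℚ) = m * c ^ 2) : n = m := by
  have hc : c ≠ 0 := by
    rintro rfl
    apply hn.ne_zero
    have : (n : ℚ) = 0 := by rw [h]; ring
    exact_mod_cast this
  obtain ⟨x, hx⟩ := exists_algebraMap_eq_of_squarefree (K := ℚ) hm (N := n) (y := c) (by simpa using h)
  obtain ⟨y, hy⟩ := exists_algebraMap_eq_of_squarefree (K := ℚ) hn (N := m) (y := c⁻¹) (by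
    simp only [eq_intCast]
    rw [h]
    field_simp)
  have h1 : x * y = 1 := by
    have : (x : ℚ) * y = 1 := by
      simp only [eq_intCast] at hx hy
      rw [hx, hy, mul_inv_cancel₀ hc]
    exact_mod_cast this
  have hx1 : IsUnit x := isUnit_of_dvd_one ⟨y, h1.symm⟩
  have h2 : (x : ℚ) ^ 2 = 1 := by exact_mod_cast Int.isUnit_sq hx1
  simp only [eq_intCast] at hx
  rw [← hx, h2, mul_one] at h
  exact_mod_cast h

theorem exists_squarefree_mul_sq {a : ℚ} (ha : a ≠ 0) :
    ∃ (n : ℤ) (c : ℚ), Squarefree n ∧ c ≠ 0 ∧ (n : ℚ) = a * c ^ 2 := by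
  have hk : 0 < (a.num * a.den).natAbs := Int.natAbs_pos.2
    (mul_ne_zero (Rat.num_ne_zero.2 ha) (by exact_mod_cast a.den_nz))
  obtain ⟨m, b, hm, hb, h, hsf⟩ := Nat.sq_mul_squarefree_of_pos hk
  have hnd : (a.num : ℚ) = a * a.den := (Rat.mul_den_eq_num a).symm
  refine ⟨(a.num * a.den).sign * m, a.den / b, ?_, ?_, ?_⟩
  · rw [← Int.squarefree_natAbs, Int.natAbs_mul, Int.natAbs_sign_of_ne_zero (Int.natAbs_pos.1 hk),
      one_mul, Int.natAbs_natCast]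
    exact hsf
  · have := a.den_nz
    positivity
  · have h1 : ((a.num * a.den : ℤ) : ℚ) = (a.num * a.den).sign * (b ^ 2 * m) := by
      have := Int.sign_mul_natAbs (a.num * a.den)
      rw [← h] at this
      exact_mod_cast this.symm
    push_cast at h1 ⊢
    rw [hnd] at h1
    have hb' : (b : ℚ) ≠ 0 := by positivity
    field_simp
    linear_combination -h1

theorem sq_ne_of_squarefree {n : ℤ} (hn : Squarefree n) (h1 : n ≠ 1) (r : ℚ) : r ^ 2 ≠ n := by
  intro h
  exact h1 (int_eq_of_squarefree (c := r) hn squarefree_one (by rw [← h]; simp))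

/-- The quadratic field `ℚ(√n)`. -/
def quadField (n : ℤ) (hn : Squarefree n) (h1 : n ≠ 1) : QuadraticField :=
  haveI : Fact (∀ r : ℚ, r ^ 2 ≠ n + 0 * r) :=
    ⟨fun r => by rw [zero_mul, add_zero]; exact sq_ne_of_squarefree hn h1 r⟩
  haveI : CharZero (QuadraticAlgebra ℚ (n : ℚ) 0) :=
    charZero_of_injective_algebraMap (algebraMap ℚ _).injective
  { carrier := QuadraticAlgebra ℚ (n : ℚ) 0
    numberField := {
      to_charZero := inferInstance
      to_finiteDimensional := by
        -- The `ℚ`-algebra structure that every field of characteristic zero carries has to be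
        -- matched with the one of `QuadraticAlgebra`.
        convert (inferInstance : Module.Finite ℚ (QuadraticAlgebra ℚ (n : ℚ) 0)) }
    finrank_eq := by
      convert QuadraticAlgebra.finrank_eq_two (n : ℚ) 0 }

theorem quadField_equiv (n : ℤ) (hn : Squarefree n) (h1 : n ≠ 1) :
    Nonempty (QuadraticAlgebra ℚ (n : ℚ) 0 ≃ₐ[ℚ] (quadField n hn h1).carrier) := by
  let e : QuadraticAlgebra ℚ (n : ℚ) 0 ≃+* (quadField n hn h1).carrier := RingEquiv.refl _
  exact ⟨AlgEquiv.ofRingEquiv (f := e) fun r => by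
    exact RingHom.congr_fun (RingHom.ext_rat (e.toRingHom.comp (algebraMap ℚ _)) (algebraMap ℚ _)) r⟩

theorem exists_squarefree_equiv (F : QuadraticField) : ∃ n : ℤ, Squarefree n ∧ n ≠ 1 ∧
    Nonempty (QuadraticAlgebra ℚ (n : ℚ) 0 ≃ₐ[ℚ] F.carrier) := by
  obtain ⟨a, ha, ⟨e⟩⟩ := exists_equiv_quadraticAlgebra (K := ℚ) two_ne_zero F.finrank_eq
  obtain ⟨n, c, hn, hc, h⟩ := exists_squarefree_mul_sq ha
  obtain ⟨f⟩ := nonempty_equiv_of_sq_mul hc h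
  refine ⟨n, hn, ?_, ⟨f.trans e⟩⟩
  -- For `n = 1` the image of `ω` would be a square root of `1` in a field, forcing `ω = ±1`.
  rintro rfl
  let g := f.trans e
  have h1 : g QuadraticAlgebra.omega * g QuadraticAlgebra.omega = 1 := by
    rw [← map_mul, omega_mul_omega, g.commutes]
    simp
  rcases mul_self_eq_one_iff.1 h1 with h | h
  · have := congrArg QuadraticAlgebra.im (g.injective (h.trans (map_one g).symm))
    simp [QuadraticAlgebra.im_one] at this
  · have := congrArg QuadraticAlgebra.im (g.injective (h.trans (by rw [map_neg, map_one] : g (-1) = -1).symm))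
    simp [QuadraticAlgebra.im_one] at this

/-- The étale algebra `ℚ(√n)` satisfies the specification locally at all primes. -/
def IntSatisfies (S : CubicSpec) (n : ℤ) : Prop :=
  ∃ h : n ≠ 0, ∀ p : Nat.Primes, (quadClass (intUnit ℚ_[p] n h)).prodBase ∈ S.loc p

theorem toClass_baseChange (F : QuadraticField) {n : ℤ} (hn : n ≠ 0)
    (e : QuadraticAlgebra ℚ (n : ℚ) 0 ≃ₐ[ℚ] F.carrier) (p : Nat.Primes) :
    (F.toEtale.prodBase.baseChange ℚ_[p]).toClass = (quadClass (intUnit ℚ_[p] n hn)).prodBase := by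
  obtain ⟨f⟩ := nonempty_baseChange_equiv ℚ_[p] e
  have hf : algebraMap ℚ ℚ_[p] (n : ℚ) = (intUnit ℚ_[p] n hn : ℚ_[p]) := by simp [intUnit]
  rw [hf] at f
  apply toClass_eq_iff.2
  have e1 : (ℚ_[p] ⊗[ℚ] (F.carrier × ℚ)) ≃ₐ[ℚ_[p]] (ℚ_[p] ⊗[ℚ] F.carrier) × (ℚ_[p] ⊗[ℚ] ℚ) :=
    Algebra.TensorProduct.prodRight ℚ ℚ_[p] ℚ_[p] F.carrier ℚ
  have e2 := AlgEquiv.prodCongr f.symm (Algebra.TensorProduct.rid ℚ ℚ_[p] ℚ_[p])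
  exact ⟨e1.trans e2⟩

theorem satisfies_iff (S : CubicSpec) (F : QuadraticField) {n : ℤ} (hn : n ≠ 0)
    (e : QuadraticAlgebra ℚ (n : ℚ) 0 ≃ₐ[ℚ] F.carrier) : F.Satisfies S ↔ IntSatisfies S n := by
  simp only [QuadraticField.Satisfies, toClass_baseChange F hn e, IntSatisfies]
  exact ⟨fun h => ⟨hn, h⟩, fun ⟨_, h⟩ => h⟩

theorem discr_eq_fundDisc (F : QuadraticField) {n : ℤ} (hn : Squarefree n)
    (e : QuadraticAlgebra ℚ (n : ℚ) 0 ≃ₐ[ℚ] F.carrier) :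
    NumberField.discr F.carrier = fundDisc n :=
  discr_eq_of_isQuadDisc F.finrank_eq (isQuadDisc_fundDisc hn) (fundDisc_ne_zero hn.ne_zero)
    (by simpa using e)

/-- The squarefree integers that parametrize `quadraticFields σ X S`. -/
def radicands (σ : ℤˣ) (X : ℝ) (S : CubicSpec) : Set ℤ :=
  {n | Squarefree n ∧ n ≠ 1 ∧ 0 < (σ : ℤ) * fundDisc n ∧
    (((σ : ℤ) * fundDisc n : ℤ) : ℝ) < X ∧ IntSatisfies S n}

theorem radicands_finite (σ : ℤˣ) (X : ℝ) (S : CubicSpec) : (radicands σ X S).Finite := by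
  apply (Set.finite_Icc (-⌈X⌉) ⌈X⌉).subset
  rintro n ⟨-, -, h0, hX, -⟩
  have h1 : (σ : ℤ) * fundDisc n < ⌈X⌉ := Int.lt_ceil.2 hX
  rw [Set.mem_Icc]
  unfold fundDisc at h0 h1
  rcases Int.units_eq_one_or σ with rfl | rfl
  · simp only [Units.val_one, one_mul] at h0 h1
    split_ifs at h0 h1 <;> omega
  · simp only [Units.val_neg, Units.val_one, neg_mul, one_mul] at h0 h1
    split_ifs at h0 h1 <;> omega

/-- The count of fields becomes a count of integers: `n ↦ ℚ(√n)` is injective on squarefree `n ≠ 1`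
and reaches every quadratic field. -/
theorem quadraticFields_ncard (σ : ℤˣ) (X : ℝ) (S : CubicSpec) :
    (quadraticFields σ X S).Finite ∧ N₂ σ X S = (radicands σ X S).ncard := by
  let f : {n : ℤ // Squarefree n ∧ n ≠ 1} → Quotient QuadraticField.setoid :=
    fun n => Quotient.mk _ (quadField n n.2.1 n.2.2)
  have hf : Function.Injective f := by
    rintro ⟨n, hn, hn1⟩ ⟨m, hm, hm1⟩ h
    obtain ⟨g⟩ := Quotient.exact h
    obtain ⟨e1⟩ := quadField_equiv n hn hn1
    obtain ⟨e2⟩ := quadField_equiv m hm hm1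
    have g' : (quadField n hn hn1).carrier ≃ₐ[ℚ] (quadField m hm hm1).carrier :=
      AlgEquiv.ofRingEquiv (f := g) fun r => by simp
    obtain ⟨c, -, hc⟩ := eq_mul_sq_of_equiv (K := ℚ) two_ne_zero
      (Int.cast_ne_zero.2 hn.ne_zero) (Int.cast_ne_zero.2 hm.ne_zero) ((e1.trans g').trans e2.symm)
    exact Subtype.ext (int_eq_of_squarefree hn hm hc)
  let D : Set {n : ℤ // Squarefree n ∧ n ≠ 1} := {n | n.1 ∈ radicands σ X S}
  have hD : D.Finite := (radicands_finite σ X S).preimage Subtype.val_injective.injOn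
  have himg : quadraticFields σ X S = f '' D := by
    ext c
    constructor
    · rintro ⟨F, rfl, h0, hX, hS⟩
      obtain ⟨n, hn, hn1, ⟨e⟩⟩ := exists_squarefree_equiv F
      rw [discr_eq_fundDisc F hn e] at h0 hX
      rw [satisfies_iff S F hn.ne_zero e] at hS
      refine ⟨⟨n, hn, hn1⟩, ⟨hn, hn1, h0, hX, hS⟩, ?_⟩
      obtain ⟨e1⟩ := quadField_equiv n hn hn1
      exact Quotient.sound ⟨(e1.symm.trans e).toRingEquiv⟩
    · rintro ⟨⟨n, hn, hn1⟩, ⟨-, -, h0, hX, hS⟩, rfl⟩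
      obtain ⟨e⟩ := quadField_equiv n hn hn1
      refine ⟨_, rfl, ?_⟩
      rw [discr_eq_fundDisc _ hn e, satisfies_iff S _ hn.ne_zero e]
      exact ⟨h0, hX, hS⟩
  refine ⟨himg ▸ hD.image f, ?_⟩
  rw [N₂, himg, Set.ncard_image_of_injective _ hf,
    ← Set.ncard_image_of_injective D Subtype.val_injective]
  congr 1
  ext n
  constructor
  · rintro ⟨m, hm, rfl⟩
    exact hm
  · intro h
    exact ⟨⟨n, h.1, h.2.1⟩, h, rfl⟩

/-- A product with the factor `ℚ_p` has zero divisors, so it is not a field and never totally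
ramified. Ordinary primes therefore impose nothing. -/
theorem prodBase_mem_of_isOrdinary {p : ℕ} [Fact p.Prime] {S : Set (EtaleClass ℚ_[p] 3)}
    (hS : IsOrdinary S) (c : EtaleClass ℚ_[p] 2) : c.prodBase ∈ S := by
  rcases hS with rfl | rfl
  · trivial
  · induction c using Quotient.inductionOn with
    | h F =>
      refine ⟨F.prodBase, ?_, rfl⟩
      rintro ⟨hfield, -⟩
      have : Nontrivial F.carrier := Module.nontrivial_of_finrank_pos (R := ℚ_[p])
        (by rw [F.finrank_eq]; norm_num)
      have hne : (show F.prodBase.carrier from ((1 : F.carrier), (0 : ℚ_[p]))) ≠ 0 := by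
        intro h
        exact one_ne_zero (congrArg Prod.fst h)
      obtain ⟨b, hb⟩ := hfield.mul_inv_cancel hne
      have h2 : (0 : ℚ_[p]) * (show F.carrier × ℚ_[p] from b).2 = 1 := congrArg Prod.snd hb
      rw [zero_mul] at h2
      exact zero_ne_one h2

end QuadCount

end

/-! ### The Pólya–Vinogradov inequality for Jacobi symbols. -/

noncomputable section

namespace QuadCount

section PolyaVinogradov

open scoped ZMod
open ZMod

/-- The Jacobi symbol as a complex function on `ZMod q`. -/
def jac (q : ℕ) (x : ZMod q) : ℂ := (jacobiSym (x.val : ℤ) q : ℂ)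

variable {q : ℕ} [NeZero q]

theorem jac_intCast (n : ℤ) : jac q (n : ZMod q) = (jacobiSym n q : ℂ) := by
  rw [jac, ZMod.val_intCast, ← jacobiSym.mod_left]

theorem jac_mul (x y : ZMod q) : jac q (x * y) = jac q x * jac q y := by
  obtain ⟨a, rfl⟩ := ZMod.intCast_surjective x
  obtain ⟨b, rfl⟩ := ZMod.intCast_surjective y
  rw [← Int.cast_mul, jac_intCast, jac_intCast, jac_intCast, jacobiSym.mul_left]
  push_cast
  rfl

theorem jac_eq_zero_of_not_isUnit {x : ZMod q} (hx : ¬ IsUnit x) : jac q x = 0 := by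
  rw [jac, Int.cast_eq_zero, jacobiSym.eq_zero_iff_not_coprime]
  intro h
  apply hx
  rw [← ZMod.natCast_zmod_val x, ZMod.isUnit_iff_coprime]
  exact h

theorem jac_sq_of_isUnit {x : ZMod q} (hx : IsUnit x) : jac q x * jac q x = 1 := by
  rw [← ZMod.natCast_zmod_val x, ZMod.isUnit_iff_coprime] at hx
  have := jacobiSym.sq_one (a := (x.val : ℤ)) (b := q) hx
  rw [jac, ← pow_two]
  exact_mod_cast this

theorem norm_jac_le {q : ℕ} (x : ZMod q) : ‖jac q x‖ ≤ 1 := by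
  rw [jac]
  rcases jacobiSym.trichotomy (x.val : ℤ) q with h | h | h <;> rw [h] <;> simp

theorem dft_jac_unit_mul (u : (ZMod q)ˣ) (k : ZMod q) :
    jac q u * 𝓕 (jac q) k = 𝓕 (jac q) (↑u⁻¹ * k) := by
  have h : (jac q u • jac q) = fun j => jac q (u.val * j) := by
    funext j
    rw [jac_mul]
    rfl
  rw [← dft_comp_unitMul, ← smul_eq_mul, ← Pi.smul_apply, ← _root_.map_smul, h]

/-- This is the primitivity of the Jacobi character. If a prime `p` divides both `k` and `q`, take a
unit that is a nonresidue modulo `p` and `1` modulo `q/p`; multiplying by it changes `k` by a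
multiple of `q`. -/
theorem exists_unit_fixing (hodd : Odd q) (hsf : Squarefree q) {k : ZMod q} (hk : ¬ IsUnit k) :
    ∃ u : (ZMod q)ˣ, jac q u = -1 ∧ (u : ZMod q) * k = k := by
  rw [← ZMod.natCast_zmod_val k, ZMod.isUnit_iff_coprime, Nat.Prime.not_coprime_iff_dvd] at hk
  obtain ⟨p, hp, hpk, q', rfl⟩ := hk
  have : Fact p.Prime := ⟨hp⟩
  have hp2 : p ≠ 2 := by
    rintro rfl
    exact (Nat.not_odd_iff_even.2 (even_two.mul_right q')) hodd
  have hq' : NeZero q' := ⟨by rintro rfl; exact NeZero.ne (p * 0) (mul_zero p)⟩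
  have hcop : Nat.Coprime p q' := Nat.coprime_of_squarefree_mul hsf
  obtain ⟨a, ha⟩ := exists_nonresidue p hp2
  have hcopZ : IsCoprime (p : ℤ) (q' : ℤ) := Nat.isCoprime_iff_coprime.2 hcop
  obtain ⟨s, t, hst⟩ := hcopZ
  -- Since `t q' ≡ 1` modulo `p`, this is `a` modulo `p` and `1` modulo `q'`.
  set y : ℤ := 1 + t * q' * (a - 1)
  have hyp : y % p = a % p := by
    apply Int.emod_emod_of_dvd _ (dvd_refl _) |>.symm.trans
    apply (Int.emod_emod_of_dvd _ (dvd_refl _)).trans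
    apply Int.ModEq.symm
    rw [Int.modEq_iff_dvd]
    exact ⟨-s * (a - 1), by simp only [y]; linear_combination (a - 1) * hst⟩
  have hyq : y % q' = 1 % q' := by
    apply Int.ModEq.symm
    rw [Int.modEq_iff_dvd]
    exact ⟨t * (a - 1), by simp only [y]; ring⟩
  have hJ : jacobiSym y (p * q') = -1 := by
    rw [jacobiSym.mul_right, jacobiSym.mod_left' hyp, jacobiSym.mod_left' hyq, ha,
      jacobiSym.one_left, mul_one]
  have hju : jac (p * q') (y : ZMod (p * q')) = -1 := by rw [jac_intCast, hJ]; simp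
  have hu : IsUnit (y : ZMod (p * q')) := by
    by_contra h
    rw [jac_eq_zero_of_not_isUnit h] at hju
    norm_num at hju
  obtain ⟨u, hu⟩ := hu
  refine ⟨u, by rw [hu, hju], ?_⟩
  rw [hu, ← ZMod.natCast_zmod_val k]
  obtain ⟨r, hr⟩ := hpk
  rw [hr, ← sub_eq_zero]
  have h1 : ((y : ℤ) : ZMod (p * q')) * ((p * r : ℕ) : ZMod (p * q')) - ((p * r : ℕ) : ZMod (p * q'))
      = (((p * q' : ℕ) : ℤ) * (t * (a - 1) * r) : ℤ) := by
    simp only [y]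
    push_cast
    ring
  rw [h1, Int.cast_mul, Int.cast_natCast, ZMod.natCast_self, zero_mul]

/-- For a unit `k`, substitute in the sum that defines the transform. For a nonunit, a unit fixing
`k` with symbol `-1` shows that the transform equals its own negative. -/
theorem dft_jac (hodd : Odd q) (hsf : Squarefree q) (k : ZMod q) :
    𝓕 (jac q) k = jac q k * 𝓕 (jac q) 1 := by
  by_cases hk : IsUnit k
  · obtain ⟨u, rfl⟩ := hk
    have h := dft_jac_unit_mul u (u : ZMod q)
    rw [Units.inv_mul] at h
    rw [← h, ← mul_assoc, jac_sq_of_isUnit u.isUnit, one_mul]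
  · obtain ⟨u, hu, huk⟩ := exists_unit_fixing hodd hsf hk
    have h := dft_jac_unit_mul u k
    have h2 : (↑u⁻¹ : ZMod q) * k = k := by
      conv_lhs => rw [← huk, ← mul_assoc, Units.inv_mul, one_mul]
    rw [h2, hu] at h
    have h3 : 𝓕 (jac q) k = 0 := by linear_combination (-1 / 2 : ℂ) * h
    rw [h3, jac_eq_zero_of_not_isUnit hk, zero_mul]

/-- By `dft_jac` the double transform at `1` is the square of the Gauss sum; by Fourier inversion it
is `q · jac q (-1)`, of absolute value `q`. -/
theorem norm_dft_jac_one (hodd : Odd q) (hsf : Squarefree q) :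
    ‖𝓕 (jac q) 1‖ = Real.sqrt q := by
  have h := congrFun (dft_dft (jac q)) 1
  have h1 : 𝓕 (jac q) = fun k => jac q k * 𝓕 (jac q) 1 := funext (dft_jac hodd hsf)
  have h2 : 𝓕 (𝓕 (jac q)) 1 = 𝓕 (jac q) 1 * 𝓕 (jac q) 1 := by
    conv_lhs => rw [h1]
    rw [dft_mul_const]
  rw [h2] at h
  have h3 : ‖jac q (-1)‖ = 1 := by
    have h4 := jac_sq_of_isUnit (q := q) (x := -1) isUnit_one.neg
    have h5 := congrArg norm h4
    rw [norm_mul, norm_one] at h5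
    nlinarith [norm_nonneg (jac q (-1))]
  have h6 := congrArg norm h
  rw [norm_mul, norm_smul, h3, mul_one] at h6
  simp only [Complex.norm_natCast] at h6
  rw [← h6, Real.sqrt_mul_self (norm_nonneg _)]

theorem norm_dft_jac_le (hodd : Odd q) (hsf : Squarefree q) (k : ZMod q) :
    ‖𝓕 (jac q) k‖ ≤ Real.sqrt q := by
  rw [dft_jac hodd hsf, norm_mul, norm_dft_jac_one hodd hsf]
  exact mul_le_of_le_one_left (Real.sqrt_nonneg _) (norm_jac_le k)

/-- Jordan's inequality at `k` or, by the symmetry of the sine, at `q - k`. -/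
theorem min_le_sin {k q : ℝ} (hk : 0 < k) (hkq : k < q) :
    2 * (min k (q - k) / q) ≤ Real.sin (Real.pi * k / q) := by
  have hq : 0 < q := hk.trans hkq
  have hpi := Real.pi_pos
  have key : ∀ t : ℝ, 0 ≤ t → t ≤ q / 2 → 2 * (t / q) ≤ Real.sin (Real.pi * t / q) := by
    intro t ht htq
    have h := Real.mul_le_sin (x := Real.pi * t / q) (by positivity) (by
      rw [div_le_div_iff₀ hq two_pos]
      nlinarith)
    refine le_trans (le_of_eq ?_) h
    field_simp
  by_cases h : k ≤ q / 2
  · rw [min_eq_left (by linarith)]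
    exact key k hk.le h
  · push Not at h
    rw [min_eq_right (by linarith), ← Real.sin_pi_sub,
      show Real.pi - Real.pi * k / q = Real.pi * (q - k) / q by field_simp]
    exact key _ (by linarith) (by linarith)

/-- The ratio lies at distance `2 sin(πk/q)` from `1`. Replacing the reciprocal of the minimum by a
sum of two reciprocals makes the later sum over `k` harmonic. -/
theorem norm_geom_sum_le {k : ℕ} (hk : 0 < k) (hkq : k < q) (N : ℕ) :
    ‖∑ l ∈ Finset.range N, (stdAddChar (k : ZMod q)) ^ l‖ ≤
      (q : ℝ) / 2 * (1 / k + 1 / ((q : ℝ) - k)) := by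
  have hkR : (0 : ℝ) < k := by exact_mod_cast hk
  have hkqR : (k : ℝ) < q := by exact_mod_cast hkq
  have hq : (0 : ℝ) < q := hkR.trans hkqR
  set z : ℂ := stdAddChar (k : ZMod q) with hz
  have hz1 : ‖z‖ = 1 := by rw [hz, stdAddChar_apply]; exact Circle.norm_coe _
  have hzexp : z = Complex.exp (Complex.I * ((2 * Real.pi * k / q : ℝ) : ℂ)) := by
    have := stdAddChar_coe (N := q) (k : ℤ)
    rw [hz]
    push_cast at this ⊢
    rw [this]
    congr 1
    ring
  have hlow : 4 * (min (k : ℝ) (q - k) / q) ≤ ‖z - 1‖ := by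
    rw [hzexp, Complex.norm_exp_I_mul_ofReal_sub_one]
    have h := min_le_sin hkR hkqR
    rw [show 2 * Real.pi * k / q / 2 = Real.pi * k / q by ring, norm_mul]
    have h2 : Real.sin (Real.pi * k / q) ≤ ‖Real.sin (Real.pi * k / q)‖ := le_abs_self _
    rw [show ‖(2 : ℝ)‖ = 2 by simp]
    linarith
  have hmin : 0 < min (k : ℝ) (q - k) := lt_min hkR (by linarith)
  have hpos : 0 < ‖z - 1‖ := lt_of_lt_of_le (by positivity) hlow
  have hz0 : z ≠ 1 := by
    rintro h
    rw [h, sub_self, norm_zero] at hpos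
    exact lt_irrefl _ hpos
  rw [geom_sum_eq hz0, norm_div]
  have hnum : ‖z ^ N - 1‖ ≤ 2 := by
    refine (norm_sub_le _ _).trans ?_
    rw [norm_pow, hz1, one_pow, norm_one]
    norm_num
  calc ‖z ^ N - 1‖ / ‖z - 1‖ ≤ 2 / (4 * (min (k : ℝ) (q - k) / q)) := by gcongr
    _ = (q : ℝ) / 2 * (1 / min (k : ℝ) (q - k)) := by field_simp; norm_num
    _ ≤ _ := by
      gcongr
      rcases min_choice (k : ℝ) (q - k) with h | h <;> rw [h]
      · have : 0 < 1 / ((q : ℝ) - k) := by rw [h] at hmin; apply one_div_pos.2; linarith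
        linarith
      · have : 0 < 1 / (k : ℝ) := by positivity
        linarith

theorem jac_eq_sum (x : ZMod q) :
    jac q x = (q : ℂ)⁻¹ * ∑ k : ZMod q, stdAddChar (k * x) * 𝓕 (jac q) k := by
  have h := invDFT_apply (𝓕 (jac q)) x
  rw [LinearEquiv.symm_apply_apply] at h
  simpa using h

/-- By Fourier inversion each nonzero frequency contributes at most `√q` times a geometric sum, and
frequency `0` contributes nothing. The harmonic sum over the frequencies gives the logarithm. -/
theorem norm_sum_jac_le (hq1 : 1 < q) (hodd : Odd q) (hsf : Squarefree q) (a : ZMod q) (N : ℕ) :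
    ‖∑ l ∈ Finset.range N, jac q (a + l)‖ ≤ Real.sqrt q * (1 + Real.log q) := by
  have hqR : (0 : ℝ) < q := by exact_mod_cast (zero_lt_one.trans hq1)
  have h1 : ∑ l ∈ Finset.range N, jac q (a + l) = (q : ℂ)⁻¹ * ∑ k : ZMod q,
      (stdAddChar (k * a) * 𝓕 (jac q) k) * ∑ l ∈ Finset.range N, (stdAddChar k) ^ l := by
    simp_rw [jac_eq_sum, ← Finset.mul_sum]
    rw [Finset.sum_comm]
    congr 1
    refine Finset.sum_congr rfl fun k _ => ?_
    rw [Finset.mul_sum]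
    refine Finset.sum_congr rfl fun l _ => ?_
    rw [mul_add, AddChar.map_add_eq_mul, mul_comm k (l : ZMod q), ← nsmul_eq_mul,
      AddChar.map_nsmul_eq_pow]
    ring
  have hdft0 : 𝓕 (jac q) 0 = 0 := by
    rw [dft_jac hodd hsf, jac_eq_zero_of_not_isUnit, zero_mul]
    have : Fact (1 < q) := ⟨hq1⟩
    exact not_isUnit_zero
  have hbound : ∀ k ∈ Finset.range q, k ≠ 0 → ‖(stdAddChar ((k : ZMod q) * a) * 𝓕 (jac q) k) *
      ∑ l ∈ Finset.range N, (stdAddChar (k : ZMod q)) ^ l‖ ≤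
      Real.sqrt q * ((q : ℝ) / 2 * (1 / k + 1 / ((q : ℝ) - k))) := by
    intro k hk hk0
    rw [norm_mul, norm_mul, show ‖(stdAddChar ((k : ZMod q) * a) : ℂ)‖ = 1 by
      rw [stdAddChar_apply]; exact Circle.norm_coe _, one_mul]
    exact mul_le_mul (norm_dft_jac_le hodd hsf _)
      (norm_geom_sum_le (Nat.pos_of_ne_zero hk0) (Finset.mem_range.1 hk) N) (norm_nonneg _)
      (Real.sqrt_nonneg _)
  have hreindex : ∀ g : ZMod q → ℂ, ∑ k : ZMod q, g k = ∑ k ∈ Finset.range q, g (k : ZMod q) := by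
    intro g
    refine Finset.sum_nbij' (fun x => x.val) (fun k => (k : ZMod q)) ?_ ?_ ?_ ?_ ?_
    · intro x _
      exact Finset.mem_range.2 (ZMod.val_lt x)
    · intro k _
      exact Finset.mem_univ _
    · intro x _
      exact ZMod.natCast_zmod_val x
    · intro k hk
      exact ZMod.val_natCast_of_lt (Finset.mem_range.1 hk)
    · intro x _
      rw [ZMod.natCast_zmod_val]
  obtain ⟨r, rfl⟩ : ∃ r, q = r + 1 := ⟨q - 1, by omega⟩
  have hH : ∑ k ∈ Finset.range r, (1 / ((k + 1 : ℕ) : ℝ) + 1 / (((r + 1 : ℕ) : ℝ) - (k + 1 : ℕ))) ≤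
      2 * (1 + Real.log (r + 1 : ℕ)) := by
    have hh : ∑ k ∈ Finset.range r, 1 / ((k + 1 : ℕ) : ℝ) = harmonic r := by
      rw [harmonic]
      push_cast
      simp
    have hh' : ∑ k ∈ Finset.range r, 1 / (((r + 1 : ℕ) : ℝ) - (k + 1 : ℕ)) = harmonic r := by
      rw [← hh, ← Finset.sum_range_reflect]
      refine Finset.sum_congr rfl fun k hk => ?_
      have := Finset.mem_range.1 hk
      congr 1
      rw [← Nat.cast_sub (by omega)]
      congr 1
      omega
    rw [Finset.sum_add_distrib, hh, hh']
    have h5 := harmonic_le_one_add_log r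
    have h6 : Real.log r ≤ Real.log (r + 1 : ℕ) := by
      rcases Nat.eq_zero_or_pos r with rfl | hr
      · simp
      · exact Real.log_le_log (by exact_mod_cast hr) (by push_cast; linarith)
    linarith
  rw [h1, norm_mul, hreindex, Finset.sum_range_succ']
  simp only [Nat.cast_zero, hdft0, mul_zero, zero_mul, add_zero]
  calc ‖((r + 1 : ℕ) : ℂ)⁻¹‖ * ‖∑ k ∈ Finset.range r, _‖
      ≤ ((r + 1 : ℕ) : ℝ)⁻¹ * ∑ k ∈ Finset.range r, Real.sqrt (r + 1 : ℕ) *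
        (((r + 1 : ℕ) : ℝ) / 2 * (1 / ((k + 1 : ℕ) : ℝ) + 1 / (((r + 1 : ℕ) : ℝ) - (k + 1 : ℕ)))) := by
        rw [norm_inv, Complex.norm_natCast]
        refine mul_le_mul_of_nonneg_left ?_ (by positivity)
        refine (norm_sum_le _ _).trans (Finset.sum_le_sum fun k hk => ?_)
        exact hbound (k + 1) (Finset.mem_range.2 (by have := Finset.mem_range.1 hk; omega))
          (Nat.succ_ne_zero k)
    _ = Real.sqrt (r + 1 : ℕ) / 2 *
        ∑ k ∈ Finset.range r, (1 / ((k + 1 : ℕ) : ℝ) + 1 / (((r + 1 : ℕ) : ℝ) - (k + 1 : ℕ))) := by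
        rw [← Finset.mul_sum, ← Finset.mul_sum]
        field_simp
    _ ≤ Real.sqrt (r + 1 : ℕ) / 2 * (2 * (1 + Real.log (r + 1 : ℕ))) := by gcongr
    _ = _ := by ring

/-- The Pólya–Vinogradov inequality for Jacobi symbols of odd squarefree modulus. -/
theorem abs_sum_jacobiSym_le (hq1 : 1 < q) (hodd : Odd q) (hsf : Squarefree q) (a : ℤ) (N : ℕ) :
    |∑ l ∈ Finset.range N, (jacobiSym (a + l) q : ℝ)| ≤ Real.sqrt q * (1 + Real.log q) := by
  have h := norm_sum_jac_le hq1 hodd hsf (a : ZMod q) N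
  have h1 : ∑ l ∈ Finset.range N, jac q ((a : ZMod q) + l) =
      ((∑ l ∈ Finset.range N, (jacobiSym (a + l) q : ℝ) : ℝ) : ℂ) := by
    push_cast
    refine Finset.sum_congr rfl fun l _ => ?_
    rw [← jac_intCast]
    push_cast
    rfl
  rwa [h1, Complex.norm_real, Real.norm_eq_abs] at h

end PolyaVinogradov

/-- The bound for incomplete sums of Jacobi symbols of modulus `q`. -/
def pvBound (η : ℝ) (q : ℕ) : ℝ := (1 + 1 / η) * (q : ℝ) ^ (1 / 2 + η)

theorem one_le_pvBound {η : ℝ} (hη : 0 < η) {q : ℕ} (hq : 0 < q) : 1 ≤ pvBound η q := by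
  have h1 : (1 : ℝ) ≤ (q : ℝ) ^ (1 / 2 + η) :=
    Real.one_le_rpow (by exact_mod_cast hq) (by positivity)
  have h2 : 0 < 1 / η := by positivity
  unfold pvBound
  nlinarith

/-- The inequality `log q ≤ q^η / η` is the source of the constant `1 + 1/η`. -/
theorem sqrt_mul_log_le_pvBound {η : ℝ} (hη : 0 < η) {q : ℕ} (hq : 0 < q) :
    Real.sqrt q * (1 + Real.log q) ≤ pvBound η q := by
  have hqR : (0 : ℝ) < q := by exact_mod_cast hq
  have h1 : (1 : ℝ) ≤ (q : ℝ) ^ η := Real.one_le_rpow (by exact_mod_cast hq) hη.le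
  have h2 := Real.log_le_rpow_div hqR.le hη
  rw [pvBound, Real.rpow_add hqR, ← Real.sqrt_eq_rpow]
  have h3 : 1 + Real.log q ≤ (1 + 1 / η) * (q : ℝ) ^ η := by
    rw [add_mul, one_mul, one_div_mul_eq_div]
    linarith
  calc Real.sqrt q * (1 + Real.log q) ≤ Real.sqrt q * ((1 + 1 / η) * (q : ℝ) ^ η) := by gcongr
    _ = _ := by ring

/-- The sum of the Jacobi symbols `(k | q)` over `0 ≤ k < Z` with `k ≡ c` modulo `8`. -/
def progSum (q c : ℕ) (Z : ℝ) : ℝ :=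
  ∑ k ∈ (Finset.range ⌈Z⌉₊).filter (fun k => k % 8 = c), (jacobiSym k q : ℝ)

theorem progSum_eq (q c : ℕ) (hc : c < 8) (Z : ℝ) :
    progSum q c Z = ∑ l ∈ Finset.range ((⌈Z⌉₊ + 7 - c) / 8), (jacobiSym (8 * l + c : ℕ) q : ℝ) := by
  unfold progSum
  symm
  refine Finset.sum_nbij' (fun l => 8 * l + c) (fun k => k / 8) ?_ ?_ ?_ ?_ ?_
  · intro l hl
    simp only [Finset.mem_range, Finset.mem_filter] at hl ⊢
    omega
  · intro k hk
    simp only [Finset.mem_range, Finset.mem_filter] at hk ⊢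
    omega
  · intro l _
    omega
  · intro k hk
    simp only [Finset.mem_range, Finset.mem_filter] at hk
    omega
  · intro l _
    rfl

/-- The natural number is the count of `k < Z` in the class `c`. Excluding the class `0` excludes `k
= 0`, so the count is at most `Z` even for `Z < 1`. -/
theorem card_prog_bounds {c : ℕ} (hc : c < 8) (hc1 : 1 ≤ c) {Z : ℝ} (hZ : 0 ≤ Z) :
    |(((⌈Z⌉₊ + 7 - c) / 8 : ℕ) : ℝ) - Z / 8| ≤ min Z 1 ∧ (((⌈Z⌉₊ + 7 - c) / 8 : ℕ) : ℝ) ≤ Z := by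
  set W := ⌈Z⌉₊ with hW
  set N := (W + 7 - c) / 8 with hN
  have h1 : (W : ℝ) < Z + 1 := Nat.ceil_lt_add_one hZ
  have h2 : Z ≤ W := Nat.le_ceil Z
  have h3 : 8 * N ≤ W + 7 - c := Nat.mul_div_le _ _
  have h4 : W ≤ 8 * N + c := by omega
  have h3' : 8 * N + c ≤ W + 7 ∨ N = 0 := by omega
  have h5 : N = 0 ∨ N + 1 ≤ W := by omega
  have h4R : (W : ℝ) ≤ 8 * N + c := by exact_mod_cast h4
  have hcR : (c : ℝ) ≤ 7 := by exact_mod_cast (by omega : c ≤ 7)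
  have hc1R : (1 : ℝ) ≤ c := by exact_mod_cast hc1
  have hNZ : (N : ℝ) ≤ Z := by
    rcases h5 with h | h
    · rw [h]; simpa using hZ
    · have : (N : ℝ) + 1 ≤ W := by exact_mod_cast h
      linarith
  refine ⟨?_, hNZ⟩
  rw [le_min_iff, abs_le, abs_le]
  have hN0 : (0 : ℝ) ≤ N := Nat.cast_nonneg _
  have hup : (N : ℝ) - Z / 8 ≤ 1 := by
    rcases h3' with h | h
    · have : (8 : ℝ) * N + c ≤ W + 7 := by exact_mod_cast h
      linarith
    · rw [h]; push_cast; linarith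
  exact ⟨⟨by linarith, by linarith⟩, ⟨by linarith, hup⟩⟩

/-- With `s` an inverse of `8` modulo `q`, `8l + c ≡ 8(l + s c)`, so the progression becomes an
interval. The trivial bound `Z` is kept because the sieve uses it when `Z` is small. -/
theorem abs_progSum_sub_le {η : ℝ} (hη : 0 < η) {q : ℕ} (hodd : Odd q) (hsf : Squarefree q)
    {c : ℕ} (hc : c < 8) (hc1 : 1 ≤ c) {Z : ℝ} (hZ : 0 ≤ Z) :
    |progSum q c Z - if q = 1 then Z / 8 else 0| ≤ min Z (pvBound η q) := by
  have hq0 : 0 < q := hodd.pos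
  obtain ⟨h1, h2⟩ := card_prog_bounds hc hc1 hZ
  rw [progSum_eq q c hc]
  by_cases hq : q = 1
  · subst hq
    simp only [jacobiSym.one_right, if_true]
    simp only [Int.cast_one, Finset.sum_const, Finset.card_range, nsmul_eq_mul, mul_one]
    exact h1.trans (min_le_min_left _ (one_le_pvBound hη one_pos))
  · rw [if_neg hq, sub_zero, le_min_iff]
    have : NeZero q := ⟨hq0.ne'⟩
    constructor
    · refine (Finset.abs_sum_le_sum_abs _ _).trans (le_trans ?_ h2)
      refine (Finset.sum_le_card_nsmul _ _ 1 fun l _ => ?_).trans (by simp)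
      rcases jacobiSym.trichotomy ((8 * l + c : ℕ) : ℤ) q with h | h | h <;> rw [h] <;> simp
    · refine le_trans ?_ (sqrt_mul_log_le_pvBound hη hq0)
      have h8 : IsCoprime (8 : ℤ) (q : ℤ) := by
        rw [← Nat.cast_ofNat, Nat.isCoprime_iff_coprime]
        exact (Nat.coprime_pow_left_iff (n := 3) (by norm_num) 2 q).2
          (Nat.coprime_two_left.2 hodd)
      obtain ⟨s, t, hst⟩ := h8
      have hterm : ∀ l : ℕ, (jacobiSym ((8 * l + c : ℕ) : ℤ) q : ℝ) =
          (jacobiSym 8 q : ℝ) * (jacobiSym (s * c + l) q : ℝ) := by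
        intro l
        rw [← Int.cast_mul, ← jacobiSym.mul_left]
        congr 1
        apply jacobiSym.mod_left'
        apply Int.ModEq.symm
        rw [Int.modEq_iff_dvd]
        exact ⟨t * c, by push_cast; linear_combination (-c : ℤ) * hst⟩
      simp_rw [hterm]
      rw [← Finset.mul_sum, abs_mul]
      have h9 : |(jacobiSym 8 q : ℝ)| ≤ 1 := by
        rcases jacobiSym.trichotomy 8 q with h | h | h <;> rw [h] <;> simp
      exact (mul_le_of_le_one_left (abs_nonneg _) h9).trans
        (abs_sum_jacobiSym_le (by omega) hodd hsf (s * c) _)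

end QuadCount

end

/-! ### Character sums over squarefree integers. -/

noncomputable section

namespace QuadCount

open ArithmeticFunction ArithmeticFunction.Moebius

theorem sum_moebius_divisors (n : ℕ) : ∑ d ∈ n.divisors, μ d = if n = 1 then 1 else 0 := by
  have h := congrArg (fun f => f n) moebius_mul_coe_zeta
  simp only [coe_mul_zeta_apply, one_apply] at h
  exact h

theorem dvd_of_sq_dvd_sq_mul {a b d : ℕ} (ha : Squarefree a) (hd : d ≠ 0) (h : d ^ 2 ∣ b ^ 2 * a) :
    d ∣ b := by
  obtain ⟨N, hN⟩ := h
  have hd' : (d : ℚ) ≠ 0 := Nat.cast_ne_zero.2 hd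
  have hNQ : ((b : ℚ)) ^ 2 * a = d ^ 2 * N := by exact_mod_cast hN
  obtain ⟨Y, hY⟩ := exists_algebraMap_eq_of_squarefree (R := ℤ) (K := ℚ) (n := (a : ℤ)) (N := (N : ℤ))
    (y := (b : ℚ) / d) (by
      rw [← Int.squarefree_natAbs]; simpa using ha) (by
      simp only [eq_intCast, Int.cast_natCast]
      field_simp
      linear_combination -hNQ)
  have h1 : (d : ℤ) ∣ (b : ℤ) := by
    refine ⟨Y, ?_⟩
    have h2 : (b : ℚ) = d * Y := by
      rw [eq_intCast] at hY
      rw [hY]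
      field_simp
    exact_mod_cast h2
  exact_mod_cast h1

/-- Write `m = b² a` with `a` squarefree: the `d` with `d² ∣ m` are exactly the divisors of `b`. -/
theorem sum_moebius_sq_dvd {m D : ℕ} (hm : m ≠ 0) (hD : m < D) :
    ∑ d ∈ (Finset.Ico 1 D).filter (fun d => d ^ 2 ∣ m), μ d = if Squarefree m then 1 else 0 := by
  obtain ⟨a, b, hab, ha⟩ := Nat.sq_mul_squarefree m
  have hb : b ≠ 0 := by
    rintro rfl
    simp at hab
    exact hm hab.symm
  have ha0 : a ≠ 0 := ha.ne_zero
  have hset : (Finset.Ico 1 D).filter (fun d => d ^ 2 ∣ m) = b.divisors := by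
    ext d
    simp only [Finset.mem_filter, Finset.mem_Ico, Nat.mem_divisors]
    constructor
    · rintro ⟨⟨h1, -⟩, h2⟩
      rw [← hab] at h2
      exact ⟨dvd_of_sq_dvd_sq_mul ha (by omega) h2, hb⟩
    · rintro ⟨h, -⟩
      have h3 : d ≤ b := Nat.le_of_dvd (Nat.pos_of_ne_zero hb) h
      have h4 : b ≤ m := by
        rw [← hab]
        nlinarith [Nat.pos_of_ne_zero hb, Nat.pos_of_ne_zero ha0,
          Nat.mul_le_mul (Nat.mul_le_mul (le_refl b) (Nat.pos_of_ne_zero hb)) (Nat.pos_of_ne_zero ha0)]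
      refine ⟨⟨Nat.pos_of_dvd_of_pos h (Nat.pos_of_ne_zero hb), by omega⟩, ?_⟩
      rw [← hab]
      exact (pow_dvd_pow_of_dvd h 2).mul_right a
  rw [hset, sum_moebius_divisors]
  congr 1
  apply propext
  constructor
  · rintro rfl
    rw [← hab]
    simpa using ha
  · intro h
    have := h b ⟨a, by rw [← hab]; ring⟩
    exact Nat.isUnit_iff.1 this

/-- An odd number is its own inverse modulo `8`. -/
theorem mod_eight_iff {u k c : ℕ} (hu : Odd u) (hc : c < 8) :
    (u * k) % 8 = c ↔ k % 8 = (c * u) % 8 := by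
  rw [Nat.odd_iff] at hu
  have h8 : u % 8 = 1 ∨ u % 8 = 3 ∨ u % 8 = 5 ∨ u % 8 = 7 := by omega
  rw [Nat.mul_mod u k, Nat.mul_mod c u]
  have hk : k % 8 < 8 := Nat.mod_lt _ (by norm_num)
  rcases h8 with h | h | h | h <;> rw [h] <;> omega

/-- The sum of `(m | q)` over `m < Z` coprime to `M` with `m ≡ c` modulo `8`. -/
def coprSum (q M c : ℕ) (Z : ℝ) : ℝ :=
  ∑ m ∈ (Finset.range ⌈Z⌉₊).filter (fun m => m % 8 = c ∧ m.Coprime M), (jacobiSym m q : ℝ)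

/-- The sum of `(m | q)` over squarefree `m < Y` coprime to `M` with `m ≡ c` modulo `8`. -/
def sqfSum (q M c : ℕ) (Y : ℝ) : ℝ :=
  ∑ m ∈ (Finset.range ⌈Y⌉₊).filter (fun m => m % 8 = c ∧ m.Coprime M ∧ Squarefree m),
    (jacobiSym m q : ℝ)

/-- Möbius inversion over the common divisors `e` of `m` and `M`, followed by the substitution `m =
e k`. -/
theorem coprSum_eq {q M c : ℕ} (hM : Odd M) (hc : c < 8) (Z : ℝ) :
    coprSum q M c Z = ∑ e ∈ M.divisors,
      (μ e : ℝ) * (jacobiSym e q : ℝ) * progSum q ((c * e) % 8) (Z / e) := by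
  have hM0 : M ≠ 0 := hM.pos.ne'
  have h1 : coprSum q M c Z = ∑ m ∈ (Finset.range ⌈Z⌉₊).filter (fun m => m % 8 = c),
      ∑ e ∈ M.divisors, if e ∣ m then (μ e : ℝ) * (jacobiSym m q : ℝ) else 0 := by
    rw [coprSum, ← Finset.filter_filter, Finset.sum_filter]
    refine Finset.sum_congr rfl fun m _ => ?_
    rw [← Finset.sum_filter, ← Finset.sum_mul]
    have h2 : M.divisors.filter (fun e => e ∣ m) = (Nat.gcd m M).divisors := by
      ext e
      simp only [Finset.mem_filter, Nat.mem_divisors, Nat.dvd_gcd_iff]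
      have : Nat.gcd m M ≠ 0 := Nat.gcd_ne_zero_right hM0
      tauto
    rw [h2, ← Int.cast_sum, sum_moebius_divisors]
    by_cases h : m.Coprime M
    · rw [if_pos h, if_pos h]; simp
    · rw [if_neg h, if_neg h]; simp
  rw [h1, Finset.sum_comm]
  refine Finset.sum_congr rfl fun e he => ?_
  have heM := Nat.dvd_of_mem_divisors he
  have heodd : Odd e := Odd.of_dvd_nat hM heM
  have he0 : (0 : ℝ) < e := by exact_mod_cast heodd.pos
  rw [← Finset.sum_filter, Finset.filter_filter, progSum, Finset.mul_sum]
  symm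
  refine Finset.sum_nbij' (fun k => e * k) (fun m => m / e) ?_ ?_ ?_ ?_ ?_
  · intro k hk
    simp only [Finset.mem_filter, Finset.mem_range, Nat.lt_ceil] at hk ⊢
    refine ⟨?_, (mod_eight_iff heodd hc).2 hk.2, Nat.dvd_mul_right _ _⟩
    rw [lt_div_iff₀ he0] at hk
    push_cast
    linarith [hk.1]
  · intro m hm
    simp only [Finset.mem_filter, Finset.mem_range, Nat.lt_ceil] at hm ⊢
    obtain ⟨h1, h2, k, rfl⟩ := hm
    rw [Nat.mul_div_cancel_left _ heodd.pos]
    refine ⟨?_, (mod_eight_iff heodd hc).1 h2⟩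
    rw [lt_div_iff₀ he0]
    push_cast at h1
    linarith
  · intro k _
    exact Nat.mul_div_cancel_left _ heodd.pos
  · intro m hm
    simp only [Finset.mem_filter] at hm
    exact Nat.mul_div_cancel' hm.2.2
  · intro k _
    rw [Nat.cast_mul, jacobiSym.mul_left]
    push_cast
    ring

/-- Möbius inversion over `d² ∣ m`, where `d` is coprime to `2M` because `m` is. As `d² ≡ 1` modulo
`8` and `(d² | q) = 1`, dividing by `d²` changes neither the class nor the character. The cutoff `D`
stays free so that it can tend to infinity. -/
theorem sqfSum_eq {q M c : ℕ} (hM : Odd M) (hqM : q ∣ M) (hc : c < 8) (hc2 : c % 2 = 1) (Y : ℝ)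
    {D : ℕ} (hD : ⌈Y⌉₊ ≤ D) :
    sqfSum q M c Y = ∑ d ∈ (Finset.Ico 1 D).filter (fun d => d.Coprime (2 * M)),
      (μ d : ℝ) * coprSum q M c (Y / (d : ℝ) ^ 2) := by
  have hM0 : M ≠ 0 := hM.pos.ne'
  have h1 : sqfSum q M c Y = ∑ m ∈ (Finset.range ⌈Y⌉₊).filter (fun m => m % 8 = c ∧ m.Coprime M),
      ∑ d ∈ Finset.Ico 1 D, if d ^ 2 ∣ m then (μ d : ℝ) * (jacobiSym m q : ℝ) else 0 := by
    have hfil : (Finset.range ⌈Y⌉₊).filter (fun m => m % 8 = c ∧ m.Coprime M ∧ Squarefree m) =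
        ((Finset.range ⌈Y⌉₊).filter (fun m => m % 8 = c ∧ m.Coprime M)).filter Squarefree := by
      rw [Finset.filter_filter]
      simp only [and_assoc]
    rw [sqfSum, hfil, Finset.sum_filter]
    refine Finset.sum_congr rfl fun m hm => ?_
    simp only [Finset.mem_filter, Finset.mem_range] at hm
    rw [← Finset.sum_filter, ← Finset.sum_mul, ← Int.cast_sum,
      sum_moebius_sq_dvd (by rintro rfl; omega) (by omega)]
    split_ifs <;> simp
  rw [h1, Finset.sum_comm, Finset.sum_filter]
  refine Finset.sum_congr rfl fun d hd => ?_
  have hd1 : 0 < d := (Finset.mem_Ico.1 hd).1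
  rw [← Finset.sum_filter, Finset.filter_filter]
  by_cases hcop : d.Coprime (2 * M)
  · rw [if_pos hcop, coprSum, Finset.mul_sum]
    have hd2 : Odd d := (Nat.coprime_mul_iff_right.1 hcop).1.odd_of_right
    have hdM : d.Coprime M := (Nat.coprime_mul_iff_right.1 hcop).2
    have hd8 : Odd (d ^ 2) := hd2.pow
    have hdd : (0 : ℝ) < (d : ℝ) ^ 2 := by positivity
    have hdpos : 0 < d ^ 2 := by positivity
    have hsq : ∀ k : ℕ, (c * d ^ 2) % 8 = c := by
      intro _
      rw [Nat.mul_mod, Nat.pow_mod]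
      have := Nat.odd_iff.1 hd2
      have h8 : d % 8 = 1 ∨ d % 8 = 3 ∨ d % 8 = 5 ∨ d % 8 = 7 := by omega
      rcases h8 with h | h | h | h <;> rw [h] <;> omega
    have hJ : jacobiSym ((d : ℤ) ^ 2) q = 1 := by
      apply jacobiSym.sq_one'
      rw [Int.gcd_natCast_natCast]
      exact hdM.coprime_dvd_right hqM
    symm
    refine Finset.sum_nbij' (fun k => d ^ 2 * k) (fun m => m / d ^ 2) ?_ ?_ ?_ ?_ ?_
    · intro k hk
      simp only [Finset.mem_filter, Finset.mem_range, Nat.lt_ceil] at hk ⊢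
      refine ⟨?_, ⟨(mod_eight_iff hd8 hc).2 ?_, ?_⟩, Nat.dvd_mul_right _ _⟩
      · rw [lt_div_iff₀ hdd] at hk
        push_cast
        linarith [hk.1]
      · rw [hsq k, hk.2.1]
      · exact Nat.Coprime.mul_left (hdM.pow_left 2) hk.2.2
    · intro m hm
      simp only [Finset.mem_filter, Finset.mem_range, Nat.lt_ceil] at hm ⊢
      obtain ⟨h1, ⟨h2, h3⟩, k, rfl⟩ := hm
      rw [Nat.mul_div_cancel_left _ hdpos]
      refine ⟨?_, ?_, h3.coprime_mul_left⟩
      · rw [lt_div_iff₀ hdd]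
        push_cast at h1
        linarith
      · rw [(mod_eight_iff hd8 hc).1 h2, hsq k]
    · intro k _
      exact Nat.mul_div_cancel_left _ hdpos
    · intro m hm
      simp only [Finset.mem_filter] at hm
      exact Nat.mul_div_cancel' hm.2.2
    · intro k _
      rw [Nat.cast_mul, jacobiSym.mul_left, Nat.cast_pow, hJ, one_mul]
  · rw [if_neg hcop]
    apply Finset.sum_eq_zero
    intro m hm
    simp only [Finset.mem_filter] at hm
    exfalso
    apply hcop
    obtain ⟨-, ⟨h2, h3⟩, h4⟩ := hm
    have h5 : d ∣ m := (dvd_pow_self d two_ne_zero).trans h4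
    apply Nat.Coprime.mul_right
    · apply Nat.Coprime.coprime_dvd_left h5
      rw [Nat.coprime_two_right, Nat.odd_iff]
      omega
    · exact h3.coprime_dvd_left h5

/-- The two bounds cross at `d = t = √(Y/P)`. The minimum is dominated by `4 P t² (1/(t + d - 1) -
1/(t + d))`, which telescopes to at most `4 P t = 4 √(Y P)`. -/
theorem sum_min_le {Y P : ℝ} (hY : 0 < Y) (hP : 0 < P) (D : ℕ) :
    ∑ d ∈ Finset.Ico 1 D, min (Y / (d : ℝ) ^ 2) P ≤ 4 * Real.sqrt (Y * P) := by
  set t := Real.sqrt (Y / P)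
  have ht : 0 < t := Real.sqrt_pos.2 (div_pos hY hP)
  have ht2 : t ^ 2 = Y / P := Real.sq_sqrt (div_pos hY hP).le
  have hYt : Y = P * t ^ 2 := by rw [ht2]; field_simp
  have key : ∀ d : ℕ, min (Y / ((1 + d : ℕ) : ℝ) ^ 2) P ≤
      4 * P * t ^ 2 * (1 / (t + d) - 1 / (t + (d + 1 : ℕ))) := by
    intro d
    have hx : (1 : ℝ) ≤ ((1 + d : ℕ) : ℝ) := by exact_mod_cast Nat.le_add_right 1 d
    have hxd : (d : ℝ) = ((1 + d : ℕ) : ℝ) - 1 := by push_cast; ring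
    rw [hxd, show ((d + 1 : ℕ) : ℝ) = ((1 + d : ℕ) : ℝ) by rw [add_comm]]
    set x : ℝ := ((1 + d : ℕ) : ℝ)
    have h1 : 0 < t + (x - 1) := by linarith
    have h2 : 0 < t + x := by linarith
    have h3 : 4 * P * t ^ 2 * (1 / (t + (x - 1)) - 1 / (t + x)) =
        4 * P * t ^ 2 / ((t + (x - 1)) * (t + x)) := by
      field_simp
      ring
    rw [h3]
    rcases le_total t x with h | h
    · refine (min_le_left _ _).trans ?_
      rw [hYt, div_le_div_iff₀ (by positivity) (by positivity)]
      have h5 : (t + (x - 1)) * (t + x) ≤ 4 * x ^ 2 := by nlinarith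
      have h6 : 0 < P * t ^ 2 := by positivity
      nlinarith
    · refine (min_le_right _ _).trans ?_
      rw [le_div_iff₀ (by positivity)]
      have h5 : (t + (x - 1)) * (t + x) ≤ 4 * t ^ 2 := by nlinarith
      nlinarith
  rw [Finset.sum_Ico_eq_sum_range]
  calc ∑ d ∈ Finset.range (D - 1), min (Y / ((1 + d : ℕ) : ℝ) ^ 2) P
      ≤ ∑ d ∈ Finset.range (D - 1), 4 * P * t ^ 2 * (1 / (t + d) - 1 / (t + (d + 1 : ℕ))) :=
        Finset.sum_le_sum fun d _ => key d
    _ = 4 * P * t ^ 2 * (1 / (t + (0 : ℕ)) - 1 / (t + (D - 1 : ℕ))) := by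
        rw [← Finset.mul_sum, Finset.sum_range_sub' (fun d : ℕ => 1 / (t + (d : ℝ)))]
    _ ≤ 4 * P * t ^ 2 * (1 / t) := by
        gcongr
        have : 0 ≤ 1 / (t + ((D - 1 : ℕ) : ℝ)) := by positivity
        push_cast at this ⊢
        rw [add_zero]
        linarith
    _ = 4 * (P * t) := by field_simp
    _ = 4 * Real.sqrt (Y * P) := by
        congr 1
        rw [hYt, show P * t ^ 2 * P = (P * t) ^ 2 by ring, Real.sqrt_sq (by positivity)]

theorem abs_moebius_real_le_one (n : ℕ) : |(μ n : ℝ)| ≤ 1 := by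
  exact_mod_cast abs_moebius_le_one (n := n)

theorem abs_jacobiSym_real_le_one (a : ℤ) (q : ℕ) : |(jacobiSym a q : ℝ)| ≤ 1 := by
  rcases jacobiSym.trichotomy a q with h | h | h <;> rw [h] <;> simp

theorem abs_coprSum_sub_le {η : ℝ} (hη : 0 < η) {q M c : ℕ} (hM : Odd M) (hMsf : Squarefree M)
    (hqM : q ∣ M) (hc : c < 8) (hc2 : c % 2 = 1) {Z : ℝ} (hZ : 0 ≤ Z) :
    |coprSum q M c Z - if q = 1 then Z / 8 * ∑ e ∈ M.divisors, (μ e : ℝ) / e else 0| ≤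
      M.divisors.card * min Z (pvBound η q) := by
  have hqodd : Odd q := Odd.of_dvd_nat hM hqM
  have hqsf : Squarefree q := hMsf.squarefree_of_dvd hqM
  have h1 : coprSum q M c Z - (if q = 1 then Z / 8 * ∑ e ∈ M.divisors, (μ e : ℝ) / e else 0) =
      ∑ e ∈ M.divisors, (μ e : ℝ) * (jacobiSym e q : ℝ) *
        (progSum q ((c * e) % 8) (Z / e) - if q = 1 then Z / e / 8 else 0) := by
    simp only [mul_sub]
    rw [coprSum_eq hM hc, Finset.sum_sub_distrib]
    congr 1
    split_ifs with h
    · subst h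
      simp only [jacobiSym.one_right, Int.cast_one, mul_one]
      rw [Finset.mul_sum]
      exact Finset.sum_congr rfl fun e _ => by ring
    · simp
  rw [h1]
  refine (Finset.abs_sum_le_sum_abs _ _).trans ?_
  rw [← nsmul_eq_mul]
  apply Finset.sum_le_card_nsmul
  intro e he
  have heM := Nat.dvd_of_mem_divisors he
  have heodd : Odd e := Odd.of_dvd_nat hM heM
  have he1 : (1 : ℝ) ≤ e := by exact_mod_cast heodd.pos
  rw [abs_mul, abs_mul]
  have h2 : |(μ e : ℝ)| * |(jacobiSym e q : ℝ)| ≤ 1 :=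
    mul_le_one₀ (abs_moebius_real_le_one e) (abs_nonneg _) (abs_jacobiSym_real_le_one _ _)
  refine (mul_le_of_le_one_left (abs_nonneg _) h2).trans ?_
  have hce : (c * e) % 8 % 2 = 1 := by
    rw [Nat.mod_mod_of_dvd _ (by norm_num : 2 ∣ 8), Nat.mul_mod, hc2, Nat.odd_iff.1 heodd]
  refine (abs_progSum_sub_le hη hqodd hqsf (Nat.mod_lt _ (by norm_num)) (by omega)
    (by positivity)).trans ?_
  exact min_le_min_right _ (div_le_self hZ he1)

/-- The truncated Möbius series stays in the main term. Terms with `d² > Y`, where no `m` is left,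
obey the same bound by a minimum, so the estimate is uniform in `D`. -/
theorem abs_sqfSum_sub_partial_le {η : ℝ} (hη : 0 < η) {q M c : ℕ} (hM : Odd M)
    (hMsf : Squarefree M) (hqM : q ∣ M) (hc : c < 8) (hc2 : c % 2 = 1) {Y : ℝ} (hY : 0 < Y)
    {D : ℕ} (hD : ⌈Y⌉₊ ≤ D) :
    |sqfSum q M c Y - if q = 1 then Y / 8 * (∑ e ∈ M.divisors, (μ e : ℝ) / e) *
      ∑ d ∈ Finset.range D, (if d.Coprime (2 * M) then (μ d : ℝ) / (d : ℝ) ^ 2 else 0) else 0| ≤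
      4 * M.divisors.card * Real.sqrt (Y * pvBound η q) := by
  have hqodd : Odd q := Odd.of_dvd_nat hM hqM
  have hP : 0 < pvBound η q := one_pos.trans_le (one_le_pvBound hη hqodd.pos)
  set E := ∑ e ∈ M.divisors, (μ e : ℝ) / e
  have hsum : ∑ d ∈ Finset.range D, (if d.Coprime (2 * M) then (μ d : ℝ) / (d : ℝ) ^ 2 else 0) =
      ∑ d ∈ (Finset.Ico 1 D).filter (fun d => d.Coprime (2 * M)), (μ d : ℝ) / (d : ℝ) ^ 2 := by
    rw [Finset.sum_filter]
    rcases Nat.eq_zero_or_pos D with rfl | hD0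
    · simp
    · rw [Finset.range_eq_Ico, Finset.sum_eq_sum_Ico_succ_bot hD0]
      simp
  have h1 : sqfSum q M c Y - (if q = 1 then Y / 8 * E *
      ∑ d ∈ Finset.range D, (if d.Coprime (2 * M) then (μ d : ℝ) / (d : ℝ) ^ 2 else 0) else 0) =
      ∑ d ∈ (Finset.Ico 1 D).filter (fun d => d.Coprime (2 * M)), (μ d : ℝ) *
        (coprSum q M c (Y / (d : ℝ) ^ 2) - if q = 1 then Y / (d : ℝ) ^ 2 / 8 * E else 0) := by
    simp only [mul_sub]
    rw [sqfSum_eq hM hqM hc hc2 Y hD, Finset.sum_sub_distrib, hsum]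
    congr 1
    split_ifs with h
    · rw [Finset.mul_sum]
      exact Finset.sum_congr rfl fun e _ => by ring
    · simp
  rw [h1]
  refine (Finset.abs_sum_le_sum_abs _ _).trans ?_
  calc ∑ d ∈ (Finset.Ico 1 D).filter (fun d => d.Coprime (2 * M)), |(μ d : ℝ) *
        (coprSum q M c (Y / (d : ℝ) ^ 2) - if q = 1 then Y / (d : ℝ) ^ 2 / 8 * E else 0)|
      ≤ ∑ d ∈ (Finset.Ico 1 D).filter (fun d => d.Coprime (2 * M)),
          M.divisors.card * min (Y / (d : ℝ) ^ 2) (pvBound η q) := by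
        refine Finset.sum_le_sum fun d _ => ?_
        rw [abs_mul]
        refine (mul_le_of_le_one_left (abs_nonneg _) (abs_moebius_real_le_one d)).trans ?_
        exact abs_coprSum_sub_le hη hM hMsf hqM hc hc2 (by positivity)
    _ ≤ ∑ d ∈ Finset.Ico 1 D, M.divisors.card * min (Y / (d : ℝ) ^ 2) (pvBound η q) := by
        refine Finset.sum_le_sum_of_subset_of_nonneg (Finset.filter_subset _ _) fun d _ _ => ?_
        have : 0 ≤ min (Y / (d : ℝ) ^ 2) (pvBound η q) := le_min (by positivity) hP.le
        positivity
    _ ≤ M.divisors.card * (4 * Real.sqrt (Y * pvBound η q)) := by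
        rw [← Finset.mul_sum]
        gcongr
        exact sum_min_le hY hP D
    _ = _ := by ring

section LSeries

open LSeries.notation

/-- The series is the inverse at `2` of the `L`-function of the trivial character modulo `2M`, that
is of `ζ(2)` without the Euler factors at `2` and at the primes of `M`; note `(π²/6)(3/4) = π²/8`.
-/
theorem hasSum_moebius_coprime {M : ℕ} (hM : Odd M) :
    HasSum (fun d : ℕ => if d.Coprime (2 * M) then (μ d : ℝ) / (d : ℝ) ^ 2 else 0)
      (8 / Real.pi ^ 2 * ∏ p ∈ M.primeFactors, (1 - 1 / (p : ℝ) ^ 2)⁻¹) := by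
  have hM0 : M ≠ 0 := hM.pos.ne'
  have hN : NeZero (2 * M) := ⟨by omega⟩
  have hre : 1 < (2 : ℂ).re := by norm_num
  let χ : DirichletCharacter ℂ (2 * M) := 1
  have hL : L ↗χ 2 = (∏ p ∈ M.primeFactors, (1 - 1 / (p : ℂ) ^ 2)) * ((Real.pi : ℂ) ^ 2 / 8) := by
    rw [← DirichletCharacter.LFunction_eq_LSeries χ hre]
    have h1 := DirichletCharacter.LFunctionTrivChar_eq_mul_riemannZeta (N := 2 * M) (s := 2)
      (by norm_num)
    refine h1.trans ?_
    have hpf : (2 * M).primeFactors = insert 2 M.primeFactors := by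
      rw [Nat.primeFactors_mul two_ne_zero hM0, Nat.Prime.primeFactors Nat.prime_two]
      rfl
    have h2 : 2 ∉ M.primeFactors := by
      intro h
      exact (Nat.not_odd_iff_even.2 (even_iff_two_dvd.2 (Nat.dvd_of_mem_primeFactors h))) hM
    rw [hpf, Finset.prod_insert h2, riemannZeta_two]
    have h3 : ∀ p : ℕ, (p : ℂ) ^ (-2 : ℂ) = 1 / (p : ℂ) ^ 2 := by
      intro p
      rw [Complex.cpow_neg, one_div]
      norm_cast
    simp only [h3]
    push_cast
    ring
  have hprod : ∏ p ∈ M.primeFactors, (1 - 1 / (p : ℂ) ^ 2) ≠ 0 := by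
    rw [Finset.prod_ne_zero_iff]
    intro p hp
    have hp2 : 2 ≤ p := (Nat.prime_of_mem_primeFactors hp).two_le
    rw [sub_ne_zero]
    intro h
    have hp0 : (p : ℂ) ≠ 0 := Nat.cast_ne_zero.2 (by omega)
    rw [eq_div_iff (pow_ne_zero 2 hp0), one_mul] at h
    have h5 : p ^ 2 = 1 := by exact_mod_cast h
    nlinarith
  have hpi : (Real.pi : ℂ) ≠ 0 := Complex.ofReal_ne_zero.2 Real.pi_ne_zero
  have hval : L (↗χ * fun n => ((μ n : ℤ) : ℂ)) 2 =
      ((8 / Real.pi ^ 2 * ∏ p ∈ M.primeFactors, (1 - 1 / (p : ℝ) ^ 2)⁻¹ : ℝ) : ℂ) := by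
    have h := DirichletCharacter.LSeries.mul_mu_eq_one χ hre
    rw [hL] at h
    have h6 := eq_inv_of_mul_eq_one_right h
    refine h6.trans ?_
    push_cast
    rw [mul_inv, inv_div, Finset.prod_inv_distrib]
    ring
  have hsummable : LSeriesSummable (↗χ * fun n => ((μ n : ℤ) : ℂ)) 2 :=
    DirichletCharacter.LSeriesSummable_mul χ
      (ArithmeticFunction.LSeriesSummable_moebius_iff.mpr hre)
  have hs := hsummable.LSeriesHasSum
  rw [hval] at hs
  rw [← Complex.hasSum_ofReal]
  have hs' : HasSum (LSeries.term (↗χ * fun n => ((μ n : ℤ) : ℂ)) 2) _ := hs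
  convert! hs' using 1
  funext n
  symm
  rw [LSeries.term_def]
  rcases Nat.eq_zero_or_pos n with rfl | hn
  · rw [if_pos rfl, if_neg]
    · simp
    · rw [Nat.coprime_zero_left]
      omega
  · rw [if_neg hn.ne']
    by_cases hcop : n.Coprime (2 * M)
    · rw [if_pos hcop, Pi.mul_apply, MulChar.one_apply ((ZMod.isUnit_iff_coprime _ _).2 hcop),
        one_mul]
      push_cast
      norm_cast
    · rw [if_neg hcop, Pi.mul_apply, MulChar.map_nonunit _
        (fun h => hcop ((ZMod.isUnit_iff_coprime _ _).1 h))]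
      simp

end LSeries

theorem sum_moebius_div_eq_prod {M : ℕ} (hMsf : Squarefree M) :
    ∑ e ∈ M.divisors, (μ e : ℝ) / e = ∏ p ∈ M.primeFactors, (1 - 1 / (p : ℝ)) := by
  let f : ArithmeticFunction ℝ := ⟨fun n => 1 / (n : ℝ), by simp⟩
  have hf : f.IsMultiplicative := by
    refine ⟨by simp [f], fun {m n} _ => ?_⟩
    simp [f, mul_comm]
  have h := IsMultiplicative.prodPrimeFactors_one_sub_of_squarefree f hf hMsf
  simp only [f, coe_mk] at h
  rw [h]
  exact Finset.sum_congr rfl fun e _ => by ring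

/-- Uniformity in `D` permits the limit `D → ∞`, so no tail of the series is estimated. The constant
simplifies by `(1 - 1/p)(1 - 1/p²)⁻¹ = (1 + 1/p)⁻¹`. -/
theorem abs_sqfSum_sub_le {η : ℝ} (hη : 0 < η) {q M c : ℕ} (hM : Odd M)
    (hMsf : Squarefree M) (hqM : q ∣ M) (hc : c < 8) (hc2 : c % 2 = 1) {Y : ℝ} (hY : 0 < Y) :
    |sqfSum q M c Y - if q = 1 then
      Y / Real.pi ^ 2 * ∏ p ∈ M.primeFactors, (1 + 1 / (p : ℝ))⁻¹ else 0| ≤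
      4 * M.divisors.card * Real.sqrt (Y * pvBound η q) := by
  have hlim := (hasSum_moebius_coprime hM).tendsto_sum_nat
  have hval : Y / 8 * (∑ e ∈ M.divisors, (μ e : ℝ) / e) *
      (8 / Real.pi ^ 2 * ∏ p ∈ M.primeFactors, (1 - 1 / (p : ℝ) ^ 2)⁻¹) =
      Y / Real.pi ^ 2 * ∏ p ∈ M.primeFactors, (1 + 1 / (p : ℝ))⁻¹ := by
    rw [sum_moebius_div_eq_prod hMsf]
    have h1 : ∏ p ∈ M.primeFactors, (1 + 1 / (p : ℝ))⁻¹ =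
        (∏ p ∈ M.primeFactors, (1 - 1 / (p : ℝ))) *
          ∏ p ∈ M.primeFactors, (1 - 1 / (p : ℝ) ^ 2)⁻¹ := by
      rw [← Finset.prod_mul_distrib]
      refine Finset.prod_congr rfl fun p hp => ?_
      have hp2 : (2 : ℝ) ≤ p := by exact_mod_cast (Nat.prime_of_mem_primeFactors hp).two_le
      have h3 : (1 : ℝ) - 1 / (p : ℝ) ^ 2 = (1 - 1 / p) * (1 + 1 / p) := by
        field_simp
        ring
      have h4 : 1 - 1 / (p : ℝ) ≠ 0 := by
        have : 1 / (p : ℝ) ≤ 1 / 2 := one_div_le_one_div_of_le two_pos hp2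
        linarith
      rw [h3, mul_inv, ← mul_assoc, mul_inv_cancel₀ h4, one_mul]
    rw [h1]
    ring
  rw [← hval]
  have hlim2 : Filter.Tendsto (fun D => |sqfSum q M c Y - if q = 1 then
      Y / 8 * (∑ e ∈ M.divisors, (μ e : ℝ) / e) *
      ∑ d ∈ Finset.range D, (if d.Coprime (2 * M) then (μ d : ℝ) / (d : ℝ) ^ 2 else 0) else 0|)
      Filter.atTop (nhds |sqfSum q M c Y - if q = 1 then
      Y / 8 * (∑ e ∈ M.divisors, (μ e : ℝ) / e) *
      (8 / Real.pi ^ 2 * ∏ p ∈ M.primeFactors, (1 - 1 / (p : ℝ) ^ 2)⁻¹) else 0|) := by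
    apply Filter.Tendsto.abs
    apply Filter.Tendsto.const_sub
    split_ifs
    · exact hlim.const_mul _
    · exact tendsto_const_nhds
  refine le_of_tendsto hlim2 ?_
  filter_upwards [Filter.eventually_ge_atTop ⌈Y⌉₊] with D hD
  exact abs_sqfSum_sub_partial_le hη hM hMsf hqM hc hc2 hY hD

end QuadCount

end

/-! ### Products of local indicators summed over squarefree integers. -/

noncomputable section

namespace QuadCount

/-- The product of a finite set of primes. -/
def primeProd (G : Finset Nat.Primes) : ℕ := ∏ p ∈ G, (p : ℕ)

theorem primeProd_pos (G : Finset Nat.Primes) : 0 < primeProd G :=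
  Finset.prod_pos fun p _ => p.2.pos

theorem coprime_primeProd_iff {m : ℕ} {G : Finset Nat.Primes} :
    m.Coprime (primeProd G) ↔ ∀ p ∈ G, ¬ (p : ℕ) ∣ m := by
  rw [primeProd, Nat.coprime_prod_right_iff]
  refine forall₂_congr fun p _ => ?_
  rw [Nat.coprime_comm, p.2.coprime_iff_not_dvd]

theorem dvd_primeProd_iff {G : Finset Nat.Primes} {p : Nat.Primes} :
    (p : ℕ) ∣ primeProd G ↔ p ∈ G := by
  rw [primeProd, Prime.dvd_finsetProd_iff p.2.prime]
  constructor
  · rintro ⟨q, hq, h⟩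
    have := (Nat.prime_dvd_prime_iff_eq p.2 q.2).1 h
    rwa [show p = q from Subtype.ext this]
  · intro h
    exact ⟨p, h, dvd_refl _⟩

theorem squarefree_primeProd (G : Finset Nat.Primes) : Squarefree (primeProd G) := by
  induction G using Finset.induction_on with
  | empty => simp [primeProd]
  | insert p G hp ih =>
    rw [primeProd, Finset.prod_insert hp, Nat.squarefree_mul_iff]
    refine ⟨?_, p.2.prime.squarefree, ih⟩
    rw [p.2.coprime_iff_not_dvd]
    exact fun h => hp (dvd_primeProd_iff.1 h)

theorem odd_primeProd {G : Finset Nat.Primes} (hG : ∀ p ∈ G, (p : ℕ) ≠ 2) : Odd (primeProd G) := by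
  rw [← Nat.coprime_two_left, coprime_primeProd_iff]
  intro p hp h
  exact hG p hp ((Nat.prime_dvd_prime_iff_eq p.2 Nat.prime_two).1 h)

theorem primeProd_dvd_of_subset {G B : Finset Nat.Primes} (h : G ⊆ B) :
    primeProd G ∣ primeProd B := Finset.prod_dvd_prod_of_subset _ _ _ h

theorem prod_primeFactors_primeProd (B : Finset Nat.Primes) (f : ℕ → ℝ) :
    ∏ p ∈ (primeProd B).primeFactors, f p = ∏ p ∈ B, f p := by
  symm
  refine Finset.prod_bij (fun p _ => (p : ℕ)) ?_ ?_ ?_ ?_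
  · intro p hp
    rw [Nat.mem_primeFactors]
    exact ⟨p.2, dvd_primeProd_iff.2 hp, (primeProd_pos B).ne'⟩
  · intro p _ q _ h
    exact Subtype.ext h
  · intro p hp
    rw [Nat.mem_primeFactors] at hp
    exact ⟨⟨p, hp.1⟩, dvd_primeProd_iff.1 hp.2.1, rfl⟩
  · intro p _
    rfl

theorem card_divisors_primeProd (B : Finset Nat.Primes) :
    (primeProd B).divisors.card = 2 ^ B.card := by
  induction B using Finset.induction_on with
  | empty => simp [primeProd]
  | insert p G hp ih =>
    rw [primeProd, Finset.prod_insert hp, Finset.card_insert_of_notMem hp, Nat.Coprime.card_divisors_mul,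
      p.2.divisors, Finset.card_pair p.2.one_lt.ne, pow_succ, mul_comm]
    · change (primeProd G).divisors.card * 2 = _
      rw [ih]
    · rw [p.2.coprime_iff_not_dvd]
      exact fun h => hp (dvd_primeProd_iff.1 h)

theorem jacobiSym_primeProd (a : ℤ) (T : Finset Nat.Primes) :
    jacobiSym a (primeProd T) = ∏ p ∈ T, jacobiSym a p := by
  induction T using Finset.induction_on with
  | empty => simp [primeProd, jacobiSym.one_right]
  | insert p G hp ih =>
    rw [Finset.prod_insert hp, ← ih, primeProd, Finset.prod_insert hp]
    exact jacobiSym.mul_right' a p.2.ne_zero (primeProd_pos G).ne'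

theorem primeProd_eq_one_iff {T : Finset Nat.Primes} : primeProd T = 1 ↔ T = ∅ := by
  constructor
  · intro h
    by_contra hT
    obtain ⟨p, hp⟩ := Finset.nonempty_iff_ne_empty.2 hT
    have := dvd_primeProd_iff.2 hp
    rw [h] at this
    exact p.2.one_lt.ne' (Nat.dvd_one.1 this)
  · rintro rfl
    simp [primeProd]

theorem sqrt_pvBound_primeProd {η : ℝ} (hη : 0 < η) (T : Finset Nat.Primes) :
    Real.sqrt (pvBound η (primeProd T)) =
      Real.sqrt (1 + 1 / η) * ∏ p ∈ T, ((p : ℕ) : ℝ) ^ (1 / 4 + η / 2) := by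
  have h : 0 ≤ 1 + 1 / η := by positivity
  rw [pvBound, Real.sqrt_mul h, Real.sqrt_eq_rpow (_ ^ _), ← Real.rpow_mul (by positivity), primeProd]
  push_cast
  rw [← Real.finsetProd_rpow _ _ (fun _ _ => by positivity)]
  congr 2
  funext p
  congr 1
  ring

/-- The squarefree `m < Y` that are coprime to `∏ B` and congruent to `c` modulo `8`. -/
def sqfSet (B : Finset Nat.Primes) (c : ℕ) (Y : ℝ) : Finset ℕ :=
  (Finset.range ⌈Y⌉₊).filter (fun m => m % 8 = c ∧ m.Coprime (primeProd B) ∧ Squarefree m)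

/-- Expanding over subsets `T` gives sums of `(m | ∏ T)`, and only `T = ∅` has a main term. The
error is again a product over `p`; the factor `2` per prime counts the divisors of `primeProd B`. -/
theorem abs_sum_prod_sub_le {η : ℝ} (hη : 0 < η) {B : Finset Nat.Primes}
    (hB : ∀ p ∈ B, (p : ℕ) ≠ 2) (α β : Nat.Primes → ℝ) {c : ℕ} (hc : c < 8) (hc2 : c % 2 = 1)
    {Y : ℝ} (hY : 0 < Y) :
    |∑ m ∈ sqfSet B c Y, ∏ p ∈ B, (α p + β p * (jacobiSym m p : ℝ)) -
      Y / Real.pi ^ 2 * ∏ p ∈ B, (α p * (1 + 1 / ((p : ℕ) : ℝ))⁻¹)| ≤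
      4 * Real.sqrt (1 + 1 / η) * Real.sqrt Y *
        ∏ p ∈ B, (2 * (|α p| + |β p| * ((p : ℕ) : ℝ) ^ (1 / 4 + η / 2))) := by
  have hM : Odd (primeProd B) := odd_primeProd hB
  have hsum : ∑ m ∈ sqfSet B c Y, ∏ p ∈ B, (α p + β p * (jacobiSym m p : ℝ)) =
      ∑ T ∈ B.powerset, ((∏ p ∈ T, β p) * ∏ p ∈ B \ T, α p) *
        sqfSum (primeProd T) (primeProd B) c Y := by
    have h1 : ∀ m : ℕ, ∏ p ∈ B, (α p + β p * (jacobiSym m p : ℝ)) =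
        ∑ T ∈ B.powerset, ((∏ p ∈ T, β p) * ∏ p ∈ B \ T, α p) *
          (jacobiSym m (primeProd T) : ℝ) := by
      intro m
      simp_rw [add_comm (α _)]
      rw [Finset.prod_add]
      refine Finset.sum_congr rfl fun T _ => ?_
      rw [Finset.prod_mul_distrib, jacobiSym_primeProd]
      push_cast
      ring
    simp_rw [h1]
    rw [Finset.sum_comm]
    refine Finset.sum_congr rfl fun T _ => ?_
    rw [← Finset.mul_sum]
    rfl
  have hmain : Y / Real.pi ^ 2 * ∏ p ∈ B, (α p * (1 + 1 / ((p : ℕ) : ℝ))⁻¹) =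
      ∑ T ∈ B.powerset, ((∏ p ∈ T, β p) * ∏ p ∈ B \ T, α p) *
        (if primeProd T = 1 then
          Y / Real.pi ^ 2 * ∏ p ∈ (primeProd B).primeFactors, (1 + 1 / (p : ℝ))⁻¹ else 0) := by
    rw [Finset.sum_eq_single ∅]
    · rw [if_pos (primeProd_eq_one_iff.2 rfl),
        prod_primeFactors_primeProd B (fun p => (1 + 1 / (p : ℝ))⁻¹), Finset.prod_mul_distrib]
      simp only [Finset.prod_empty, Finset.sdiff_empty]
      ring
    · intro T _ hT
      rw [if_neg (fun h => hT (primeProd_eq_one_iff.1 h)), mul_zero]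
    · intro h
      exact absurd (Finset.empty_mem_powerset B) h
  rw [hsum, hmain, ← Finset.sum_sub_distrib]
  refine (Finset.abs_sum_le_sum_abs _ _).trans ?_
  calc ∑ T ∈ B.powerset, |((∏ p ∈ T, β p) * ∏ p ∈ B \ T, α p) *
        sqfSum (primeProd T) (primeProd B) c Y - ((∏ p ∈ T, β p) * ∏ p ∈ B \ T, α p) *
        (if primeProd T = 1 then
          Y / Real.pi ^ 2 * ∏ p ∈ (primeProd B).primeFactors, (1 + 1 / (p : ℝ))⁻¹ else 0)|
      ≤ ∑ T ∈ B.powerset, ((∏ p ∈ T, |β p|) * ∏ p ∈ B \ T, |α p|) *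
        (4 * 2 ^ B.card * (Real.sqrt Y * (Real.sqrt (1 + 1 / η) *
          ∏ p ∈ T, ((p : ℕ) : ℝ) ^ (1 / 4 + η / 2)))) := by
        refine Finset.sum_le_sum fun T hT => ?_
        rw [← mul_sub, abs_mul, abs_mul, Finset.abs_prod, Finset.abs_prod,
          ← sqrt_pvBound_primeProd hη, ← Real.sqrt_mul hY.le]
        refine mul_le_mul_of_nonneg_left ?_ (by positivity)
        have h := abs_sqfSum_sub_le hη hM (squarefree_primeProd B)
          (primeProd_dvd_of_subset (Finset.mem_powerset.1 hT)) hc hc2 hY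
        rw [card_divisors_primeProd] at h
        push_cast at h
        exact h
    _ = _ := by
        have h2 : ∏ p ∈ B, (2 * (|α p| + |β p| * ((p : ℕ) : ℝ) ^ (1 / 4 + η / 2))) =
            2 ^ B.card * ∑ T ∈ B.powerset, ((∏ p ∈ T, |β p|) * ∏ p ∈ B \ T, |α p|) *
              ∏ p ∈ T, ((p : ℕ) : ℝ) ^ (1 / 4 + η / 2) := by
          rw [Finset.prod_mul_distrib, Finset.prod_const]
          congr 1
          simp_rw [add_comm (|α _|)]
          rw [Finset.prod_add]
          refine Finset.sum_congr rfl fun T _ => ?_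
          rw [Finset.prod_mul_distrib]
          ring
        rw [h2, Finset.mul_sum, Finset.mul_sum]
        refine Finset.sum_congr rfl fun T _ => ?_
        ring

end QuadCount

end

/-! ### Factoring radicands and turning the local conditions into residue symbols. -/

noncomputable section

namespace QuadCount

/-- The prime `2`. -/
abbrev primeTwo : Nat.Primes := ⟨2, Nat.prime_two⟩

/-- The odd primes at which `S` is not ordinary. -/
def oddBad (S : CubicSpec) : Finset Nat.Primes := by
  classical exact S.finite_not_ordinary.toFinset.erase primeTwo

theorem mem_oddBad {S : CubicSpec} {p : Nat.Primes} :
    p ∈ oddBad S ↔ (p : ℕ) ≠ 2 ∧ p ∈ S.badPrimes := by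
  classical
  rw [oddBad, Finset.mem_erase, Set.Finite.mem_toFinset]
  refine and_congr (not_congr ⟨fun h => by rw [h], fun h => Subtype.ext h⟩) Iff.rfl

open Classical in
/-- The indicator of a class of quadratic algebras at an odd prime. -/
def oddInd (S : CubicSpec) (p : Nat.Primes) (x : Bool × Bool) : ℝ :=
  if (oddClass (p : ℕ) x).prodBase ∈ S.loc p then 1 else 0

open Classical in
/-- The indicator of a class of quadratic algebras at the prime `2`. -/
def twoInd (S : CubicSpec) (x : Bool × Fin 4) : ℝ :=
  if (twoClass x).prodBase ∈ (S.loc primeTwo : Set (EtaleClass ℚ_[2] 3)) then 1 else 0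

/-- The even part of `oddInd` in the residue symbol. -/
def oddMean (S : CubicSpec) (p : Nat.Primes) (j : Bool) : ℝ :=
  (oddInd S p (j, false) + oddInd S p (j, true)) / 2

/-- The odd part of `oddInd` in the residue symbol. -/
def oddDiff (S : CubicSpec) (p : Nat.Primes) (j : Bool) : ℝ :=
  (oddInd S p (j, false) - oddInd S p (j, true)) / 2

/-- A function of a sign is its mean plus its odd part times the sign. -/
theorem oddInd_eq {S : CubicSpec} {p : Nat.Primes} (j : Bool) {n : ℤ} (hn : ¬ ((p : ℕ) : ℤ) ∣ n) :
    oddInd S p (j, decide (jacobiSym n p = -1)) =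
      oddMean S p j + oddDiff S p j * (jacobiSym n p : ℝ) := by
  rw [oddMean, oddDiff]
  rcases jacobiSym_eq_one_or_neg_one hn with h | h
  · rw [h, decide_eq_false (by norm_num)]
    push_cast
    ring
  · rw [h, decide_eq_true rfl]
    push_cast
    ring

/-- Whether `p` belongs to `G`. -/
def memBool (p : Nat.Primes) (G : Finset Nat.Primes) : Bool := by
  classical exact decide (p ∈ G)

theorem memBool_eq_true {p : Nat.Primes} {G : Finset Nat.Primes} :
    memBool p G = true ↔ p ∈ G := by
  simp [memBool]

theorem memBool_of_mem {p : Nat.Primes} {G : Finset Nat.Primes} (h : p ∈ G) :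
    memBool p G = true := memBool_eq_true.2 h

theorem memBool_of_notMem {p : Nat.Primes} {G : Finset Nat.Primes} (h : p ∉ G) :
    memBool p G = false := by
  rw [← Bool.not_eq_true, memBool_eq_true]
  exact h

/-- The product of the primes of `G` other than `p`. -/
def primeProdErase (G : Finset Nat.Primes) (p : Nat.Primes) : ℕ := by
  classical exact primeProd (G.erase p)

theorem primeProd_eq_pow_mul (G : Finset Nat.Primes) (p : Nat.Primes) :
    primeProd G = (p : ℕ) ^ (memBool p G).toNat * primeProdErase G p := by
  classical
  by_cases h : p ∈ G
  · rw [memBool_of_mem h, Bool.toNat_true, pow_one]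
    exact (Finset.mul_prod_erase G (fun q => (q : ℕ)) h).symm
  · rw [memBool_of_notMem h, Bool.toNat_false, pow_zero, one_mul, primeProdErase,
      Finset.erase_eq_of_notMem h]

theorem not_dvd_primeProdErase (G : Finset Nat.Primes) (p : Nat.Primes) :
    ¬ (p : ℕ) ∣ primeProdErase G p := by
  classical
  rw [primeProdErase, dvd_primeProd_iff]
  exact Finset.notMem_erase p G

/-- The squarefree integer with the given sign, exponent of `2`, bad prime factors and remaining
factor. -/
def radicandOf (σ : ℤˣ) (i : Bool) (G : Finset Nat.Primes) (m : ℕ) : ℤ :=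
  (σ : ℤ) * (2 ^ i.toNat * (primeProd G * m) : ℕ)

/-- The class of the remaining factor modulo `8`. -/
def residueClass (σ : ℤˣ) (k : Fin 4) (G : Finset Nat.Primes) : ℕ :=
  (((σ : ℤ) * primeProd G * (2 * (k : ℕ) + 1)) % 8).toNat

theorem residueClass_lt (σ : ℤˣ) (k : Fin 4) (G : Finset Nat.Primes) :
    residueClass σ k G < 8 := by
  unfold residueClass
  omega

theorem odd_units_mul (σ : ℤˣ) {n : ℕ} (hn : Odd n) : Odd ((σ : ℤ) * n) := by
  have h : Odd (n : ℤ) := by exact_mod_cast hn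
  rcases Int.units_eq_one_or σ with rfl | rfl
  · simpa using h
  · simpa using h

theorem int_mod_eight_iff {u m c : ℤ} (hu : Odd u) (hc : 0 ≤ c) (hc' : c < 8) :
    m % 8 = (u * c) % 8 ↔ (u * m) % 8 = c := by
  rw [Int.odd_iff] at hu
  have h8 : u % 8 = 1 ∨ u % 8 = 3 ∨ u % 8 = 5 ∨ u % 8 = 7 := by omega
  rw [Int.mul_emod u m, Int.mul_emod u c]
  rcases h8 with h | h | h | h <;> rw [h] <;> omega

theorem mod_eight_residueClass (σ : ℤˣ) (k : Fin 4) {G : Finset Nat.Primes}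
    (hG : Odd (primeProd G)) (m : ℕ) :
    m % 8 = residueClass σ k G ↔ ((σ : ℤ) * (primeProd G * m : ℕ)) % 8 = 2 * (k : ℕ) + 1 := by
  have hk := k.2
  have h := int_mod_eight_iff (m := (m : ℤ)) (c := 2 * (k : ℕ) + 1) (odd_units_mul σ hG)
    (by omega) (by omega)
  push_cast
  rw [← mul_assoc, ← h, residueClass]
  omega

theorem residueClass_odd (σ : ℤˣ) (k : Fin 4) {G : Finset Nat.Primes} (hG : Odd (primeProd G)) :
    residueClass σ k G % 2 = 1 := by
  have h := odd_units_mul σ hG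
  have h2 : Odd ((σ : ℤ) * primeProd G * (2 * (k : ℕ) + 1)) :=
    h.mul ⟨((k : ℕ) : ℤ), rfl⟩
  rw [Int.odd_iff] at h2
  unfold residueClass
  omega

/-- The class at `2` fixes the power of `2` in the discriminant, so the bound on the discriminant
becomes a bound on `m`. -/
theorem fundDisc_radicandOf (σ : ℤˣ) (x : Bool × Fin 4) {G : Finset Nat.Primes} {m : ℕ}
    (h : ((σ : ℤ) * (primeProd G * m : ℕ)) % 8 = 2 * (x.2 : ℕ) + 1) :
    (σ : ℤ) * fundDisc (radicandOf σ x.1 G m) = (twoDisc x * (primeProd G * m) : ℕ) := by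
  obtain ⟨i, k⟩ := x
  rw [radicandOf]
  generalize primeProd G * m = u at *
  have hσ : (σ : ℤ) * σ = 1 := by
    rcases Int.units_eq_one_or σ with rfl | rfl <;> rfl
  simp only at h ⊢
  cases i
  · simp only [Bool.toNat_false, pow_zero, one_mul, fundDisc, twoDisc, Bool.false_eq_true, if_false]
    by_cases hk : (k : ℕ) % 2 = 0
    · rw [if_pos (by omega), if_pos hk, ← mul_assoc, hσ]
      push_cast
      ring
    · rw [if_neg (by omega), if_neg hk]
      push_cast
      linear_combination 4 * (u : ℤ) * hσ
  · simp only [Bool.toNat_true, pow_one, fundDisc, twoDisc, if_true]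
    rw [if_neg (by
      push_cast
      rw [mul_left_comm]
      omega)]
    push_cast
    linear_combination 8 * (u : ℤ) * hσ

theorem squarefree_units_mul (σ : ℤˣ) {n : ℕ} : Squarefree ((σ : ℤ) * (n : ℤ)) ↔ Squarefree n := by
  rw [← Int.squarefree_natAbs, Int.natAbs_mul, Int.units_natAbs, one_mul, Int.natAbs_natCast]

theorem squarefree_radicandOf {σ : ℤˣ} {i : Bool} {B G : Finset Nat.Primes} {m : ℕ}
    (hB : ∀ p ∈ B, (p : ℕ) ≠ 2) (hG : G ⊆ B) (hm : Odd m) (hmB : m.Coprime (primeProd B))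
    (hsf : Squarefree m) : Squarefree (radicandOf σ i G m) := by
  rw [radicandOf, squarefree_units_mul]
  have hcop : (primeProd G).Coprime m :=
    (Nat.Coprime.coprime_dvd_right (primeProd_dvd_of_subset hG) hmB).symm
  have hG' : Odd (primeProd G) := odd_primeProd fun p hp => hB p (hG hp)
  rw [Nat.squarefree_mul_iff, Nat.squarefree_mul_iff]
  refine ⟨?_, ?_, hcop, squarefree_primeProd G, hsf⟩
  · exact Nat.Coprime.pow_left _ (Nat.coprime_two_left.2 (hG'.mul hm))
  · cases i
    · simp
    · simpa using Nat.prime_two.prime.squarefree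

/-- The factors of a squarefree integer in `radicandOf` are unique. -/
theorem radicandOf_inj {σ : ℤˣ} {i i' : Bool} {B G G' : Finset Nat.Primes} {m m' : ℕ}
    (hB : ∀ p ∈ B, (p : ℕ) ≠ 2) (hG : G ⊆ B) (hG' : G' ⊆ B) (hm : Odd m) (hm' : Odd m')
    (hmB : m.Coprime (primeProd B)) (hmB' : m'.Coprime (primeProd B))
    (h : radicandOf σ i G m = radicandOf σ i' G' m') : i = i' ∧ G = G' ∧ m = m' := by
  have h1 : 2 ^ i.toNat * (primeProd G * m) = 2 ^ i'.toNat * (primeProd G' * m') := by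
    have h2 := mul_left_cancel₀ σ.ne_zero h
    exact_mod_cast h2
  have hodd : ∀ {G : Finset Nat.Primes} {m : ℕ}, G ⊆ B → Odd m → Odd (primeProd G * m) :=
    fun hG hm => (odd_primeProd fun p hp => hB p (hG hp)).mul hm
  have hi : i = i' := by
    have h3 := Nat.odd_iff.1 (hodd hG hm)
    have h4 := Nat.odd_iff.1 (hodd hG' hm')
    cases i <;> cases i' <;> simp at h1 ⊢ <;> omega
  subst hi
  have h5 := Nat.eq_of_mul_eq_mul_left (by positivity) h1
  have key : ∀ {G G' : Finset Nat.Primes} {m m' : ℕ}, G ⊆ B → m'.Coprime (primeProd B) →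
      primeProd G * m = primeProd G' * m' → G ⊆ G' := by
    intro G G' m m' hG hm h p hp
    have h6 : (p : ℕ) ∣ primeProd G' * m' := h ▸ (dvd_primeProd_iff.2 hp).mul_right m
    rcases p.2.dvd_mul.1 h6 with h7 | h7
    · exact dvd_primeProd_iff.1 h7
    · exact absurd h7 (coprime_primeProd_iff.1 hm p (hG hp))
  have hGG := (key hG hmB' h5).antisymm (key hG' hmB h5.symm)
  subst hGG
  exact ⟨rfl, rfl, Nat.eq_of_mul_eq_mul_left (primeProd_pos G) h5⟩

theorem exists_radicandOf {σ : ℤˣ} {n : ℤ} (B : Finset Nat.Primes)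
    (hn : Squarefree n) (hσ : 0 < (σ : ℤ) * n) : ∃ (i : Bool) (G : Finset Nat.Primes) (m : ℕ),
      G ⊆ B ∧ Odd m ∧ m.Coprime (primeProd B) ∧ Squarefree m ∧ n = radicandOf σ i G m := by
  classical
  obtain ⟨N, hN⟩ := Int.eq_ofNat_of_zero_le hσ.le
  have hσ2 : (σ : ℤ) * σ = 1 := by
    rcases Int.units_eq_one_or σ with rfl | rfl <;> rfl
  have hnN : n = (σ : ℤ) * N := by rw [← hN, ← mul_assoc, hσ2, one_mul]
  rw [hnN, squarefree_units_mul] at hn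
  let G := B.filter fun p : Nat.Primes => (p : ℕ) ∣ N
  have hGN : primeProd G ∣ N := by
    apply Finset.prod_dvd_of_isRelPrime
    · intro p _ q _ hpq
      exact Nat.coprime_iff_isRelPrime.1
        ((Nat.coprime_primes p.2 q.2).2 (fun h => hpq (Subtype.ext h)))
    · intro p hp
      exact (Finset.mem_filter.1 hp).2
  obtain ⟨N', hN'⟩ := hGN
  have hG : G ⊆ B := Finset.filter_subset _ _
  have hsf' : Squarefree N' := hn.squarefree_of_dvd ⟨primeProd G, by rw [hN', mul_comm]⟩
  have hcop : N'.Coprime (primeProd B) := by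
    rw [coprime_primeProd_iff]
    intro p hp hpN
    have hpG : p ∈ G := Finset.mem_filter.2 ⟨hp, hN' ▸ hpN.mul_left _⟩
    have h2 : (p : ℕ) * p ∣ N := hN' ▸ mul_dvd_mul (dvd_primeProd_iff.2 hpG) hpN
    exact p.2.one_lt.ne' (Nat.isUnit_iff.1 (hn _ h2))
  obtain ⟨i, m, hm, hm2⟩ : ∃ (i : Bool) (m : ℕ), Odd m ∧ N' = 2 ^ i.toNat * m := by
    rcases Nat.even_or_odd N' with he | ho
    · obtain ⟨m, hm⟩ := he.two_dvd
      refine ⟨true, m, ?_, by simpa using hm⟩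
      rw [← Nat.not_even_iff_odd]
      intro h
      obtain ⟨t, ht⟩ := h.two_dvd
      have := Nat.isUnit_iff.1 (hsf' 2 ⟨t, by rw [hm, ht]; ring⟩)
      omega
    · exact ⟨false, N', ho, by simp⟩
  have hmN : m ∣ N' := ⟨2 ^ i.toNat, by rw [hm2, mul_comm]⟩
  refine ⟨i, G, m, hG, hm, Nat.Coprime.coprime_dvd_left hmN hcop, hsf'.squarefree_of_dvd hmN, ?_⟩
  rw [hnN, radicandOf, hN', hm2]
  congr 2
  ring

theorem quadClass_intUnit_congr {K : Type} [Field K] [CharZero K] {n n' : ℤ} (h : n ≠ 0)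
    (h' : n' ≠ 0) (e : n = n') : quadClass (intUnit K n h) = quadClass (intUnit K n' h') := by
  subst e
  rfl

/-- The value at `p` of the residue symbol of the factors of `radicandOf` other than the last. -/
def twist (σ : ℤˣ) (i : Bool) (G : Finset Nat.Primes) (p : Nat.Primes) : ℤ :=
  jacobiSym ((σ : ℤ) * (2 ^ i.toNat * primeProdErase G p : ℕ)) p

theorem int_not_dvd_units_mul (σ : ℤˣ) {p n : ℕ} : (p : ℤ) ∣ (σ : ℤ) * (n : ℤ) ↔ p ∣ n := by
  rw [← Int.natAbs_dvd_natAbs, Int.natAbs_mul, Int.units_natAbs, one_mul, Int.natAbs_natCast,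
    Int.natAbs_natCast]

theorem not_dvd_two_pow_mul {p : Nat.Primes} (hp : (p : ℕ) ≠ 2) (i : Bool)
    (G : Finset Nat.Primes) : ¬ (p : ℕ) ∣ 2 ^ i.toNat * primeProdErase G p := by
  rw [p.2.dvd_mul]
  rintro (h | h)
  · exact hp ((Nat.prime_dvd_prime_iff_eq p.2 Nat.prime_two).1 (p.2.dvd_of_dvd_pow h))
  · exact not_dvd_primeProdErase G p h

theorem abs_twist {σ : ℤˣ} {i : Bool} {G : Finset Nat.Primes} {p : Nat.Primes}
    (hp : (p : ℕ) ≠ 2) : |(twist σ i G p : ℝ)| = 1 := by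
  have h : ¬ ((p : ℕ) : ℤ) ∣ (σ : ℤ) * (2 ^ i.toNat * primeProdErase G p : ℕ) := by
    rw [int_not_dvd_units_mul]
    exact not_dvd_two_pow_mul hp i G
  rcases jacobiSym_eq_one_or_neg_one h with h | h
  · rw [twist, h]
    simp
  · rw [twist, h]
    simp

-- At an odd bad `p` the unit part of the radicand is a fixed integer times `m`, so the local
-- indicator is affine in `(m | p)`, and `twist` is the symbol of the fixed integer. Apart from
-- these primes only `2` matters, and there the class is fixed by `x`.
open Classical in
theorem indicator_eq_prod (S : CubicSpec) (σ : ℤˣ) (x : Bool × Fin 4) {G : Finset Nat.Primes}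
    {m : ℕ} (hm : m.Coprime (primeProd (oddBad S))) (hm0 : m ≠ 0)
    (hk : ((σ : ℤ) * (primeProd G * m : ℕ)) % 8 = 2 * (x.2 : ℕ) + 1) :
    (if IntSatisfies S (radicandOf σ x.1 G m) then (1 : ℝ) else 0) =
      twoInd S x * ∏ p ∈ oddBad S, (oddMean S p (memBool p G) +
        oddDiff S p (memBool p G) * twist σ x.1 G p * (jacobiSym m p : ℝ)) := by
  have hn0 : radicandOf σ x.1 G m ≠ 0 := by
    have := primeProd_pos G
    rw [radicandOf]
    exact mul_ne_zero σ.ne_zero (by positivity)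
  have htwo : quadClass (intUnit ℚ_[2] (radicandOf σ x.1 G m) hn0) = twoClass x := by
    have h0 : (2 : ℤ) ^ x.1.toNat * ((σ : ℤ) * (primeProd G * m : ℕ)) ≠ 0 := by
      have := primeProd_pos G
      exact mul_ne_zero (by positivity) (mul_ne_zero σ.ne_zero (by positivity))
    rw [← quadClass_eq_twoClass x.1 x.2 hk h0]
    apply quadClass_intUnit_congr
    rw [radicandOf]
    push_cast
    ring
  have hodd : ∀ p ∈ oddBad S, (if (quadClass (intUnit ℚ_[p] (radicandOf σ x.1 G m) hn0)).prodBase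
        ∈ S.loc p then (1 : ℝ) else 0) = oddMean S p (memBool p G) +
        oddDiff S p (memBool p G) * twist σ x.1 G p * (jacobiSym m p : ℝ) := by
    intro p hp
    have hp2 := (mem_oddBad.1 hp).1
    have hpn : ¬ ((p : ℕ) : ℤ) ∣ (σ : ℤ) * (2 ^ x.1.toNat * primeProdErase G p : ℕ) * m := by
      rw [mul_assoc, ← Nat.cast_mul, int_not_dvd_units_mul, p.2.dvd_mul]
      rintro (h | h)
      · exact not_dvd_two_pow_mul hp2 x.1 G h
      · exact coprime_primeProd_iff.1 hm p hp h
    have hcls : quadClass (intUnit ℚ_[p] (radicandOf σ x.1 G m) hn0) = oddClass (p : ℕ) (memBool p G,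
        decide (jacobiSym ((σ : ℤ) * (2 ^ x.1.toNat * primeProdErase G p : ℕ) * m) p = -1)) := by
      rw [← quadClass_eq_oddClass hp2 hpn]
      apply quadClass_intUnit_congr
      rw [radicandOf, primeProd_eq_pow_mul G p]
      push_cast
      ring
    rw [hcls, mul_assoc (oddDiff S p _), twist, ← Int.cast_mul, ← jacobiSym.mul_left,
      ← oddInd_eq _ hpn]
    rfl
  have hiff : IntSatisfies S (radicandOf σ x.1 G m) ↔
      (twoClass x).prodBase ∈ (S.loc primeTwo : Set (EtaleClass ℚ_[2] 3)) ∧ ∀ p ∈ oddBad S,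
        (quadClass (intUnit ℚ_[p] (radicandOf σ x.1 G m) hn0)).prodBase ∈ S.loc p := by
    constructor
    · rintro ⟨_, h⟩
      exact ⟨htwo ▸ h primeTwo, fun p _ => h p⟩
    · rintro ⟨h2, h⟩
      refine ⟨hn0, fun p => ?_⟩
      by_cases hp : p ∈ oddBad S
      · exact h p hp
      · by_cases hp2 : p = primeTwo
        · subst hp2
          rw [← htwo] at h2
          exact h2
        · apply prodBase_mem_of_isOrdinary
          by_contra hord
          exact hp (mem_oddBad.2 ⟨fun h => hp2 (Subtype.ext h), hord⟩)
  rw [← Finset.prod_congr rfl hodd, Finset.prod_boole, twoInd, boole_mul, ← ite_and]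
  exact if_congr hiff rfl rfl

/-- The sum over the remaining factors that corresponds to fixed behaviour at `2` and at the bad
primes. -/
def innerSum (S : CubicSpec) (σ : ℤˣ) (X : ℝ) (x : Bool × Fin 4) (G : Finset Nat.Primes) : ℝ :=
  ∑ m ∈ sqfSet (oddBad S) (residueClass σ x.2 G) (X / (twoDisc x * primeProd G)),
    ∏ p ∈ oddBad S, (oddMean S p (memBool p G) +
      oddDiff S p (memBool p G) * twist σ x.1 G p * (jacobiSym m p : ℝ))

/-- As `radicands`, with `1` allowed. -/
def fullRadicands (σ : ℤˣ) (X : ℝ) (S : CubicSpec) : Set ℤ :=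
  {n | Squarefree n ∧ 0 < (σ : ℤ) * fundDisc n ∧
    (((σ : ℤ) * fundDisc n : ℤ) : ℝ) < X ∧ IntSatisfies S n}

theorem units_mul_pos_iff (σ : ℤˣ) (n : ℤ) : 0 < (σ : ℤ) * fundDisc n ↔ 0 < (σ : ℤ) * n := by
  unfold fundDisc
  split_ifs
  · rfl
  · rw [mul_left_comm]
    omega

theorem fullRadicands_finite (σ : ℤˣ) (X : ℝ) (S : CubicSpec) : (fullRadicands σ X S).Finite := by
  apply ((radicands_finite σ X S).union (Set.finite_singleton 1)).subset
  rintro n ⟨h1, h2, h3, h4⟩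
  by_cases h : n = 1
  · exact Or.inr h
  · exact Or.inl ⟨h1, h, h2, h3, h4⟩

theorem twoDisc_pos (x : Bool × Fin 4) : 0 < twoDisc x := by
  unfold twoDisc
  split_ifs <;> norm_num

theorem fullRadicands_ncard (σ : ℤˣ) (X : ℝ) (S : CubicSpec) :
    ((fullRadicands σ X S).ncard : ℝ) =
      ∑ x : Bool × Fin 4, twoInd S x * ∑ G ∈ (oddBad S).powerset, innerSum S σ X x G := by
  classical
  -- The specification without conditions; it only serves to show that all radicands in the range
  -- form a finite set.
  let T : CubicSpec := ⟨fun _ => Set.univ, by simp [IsOrdinary]⟩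
  have hR : {n : ℤ | Squarefree n ∧ 0 < (σ : ℤ) * fundDisc n ∧
      (((σ : ℤ) * fundDisc n : ℤ) : ℝ) < X}.Finite := by
    apply (fullRadicands_finite σ X T).subset
    rintro n ⟨h1, h2, h3⟩
    exact ⟨h1, h2, h3, h1.ne_zero, fun _ => Set.mem_univ _⟩
  have hcard : ((fullRadicands σ X S).ncard : ℝ) =
      ∑ n ∈ hR.toFinset, if IntSatisfies S n then (1 : ℝ) else 0 := by
    rw [Finset.sum_boole, Set.ncard_eq_toFinset_card _ (fullRadicands_finite σ X S)]
    congr 2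
    ext n
    simp only [Set.Finite.mem_toFinset, Finset.mem_filter]
    exact ⟨fun ⟨h1, h2, h3, h4⟩ => ⟨⟨h1, h2, h3⟩, h4⟩, fun ⟨⟨h1, h2, h3⟩, h4⟩ => ⟨h1, h2, h3, h4⟩⟩
  rw [hcard]
  simp_rw [innerSum, Finset.mul_sum]
  rw [← Finset.sum_product', Finset.sum_sigma']
  have hB : ∀ p ∈ oddBad S, (p : ℕ) ≠ 2 := fun p hp => (mem_oddBad.1 hp).1
  have hmem : ∀ y : (_ : (Bool × Fin 4) × Finset Nat.Primes) × ℕ,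
      y ∈ ((Finset.univ ×ˢ (oddBad S).powerset).sigma fun y => sqfSet (oddBad S)
        (residueClass σ y.1.2 y.2) (X / (twoDisc y.1 * primeProd y.2))) ↔
      y.1.2 ⊆ oddBad S ∧ Odd y.2 ∧ y.2.Coprime (primeProd (oddBad S)) ∧ Squarefree y.2 ∧
        ((σ : ℤ) * (primeProd y.1.2 * y.2 : ℕ)) % 8 = 2 * (y.1.1.2 : ℕ) + 1 ∧
        ((twoDisc y.1.1 * (primeProd y.1.2 * y.2) : ℕ) : ℝ) < X := by
    rintro ⟨⟨x, G⟩, m⟩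
    simp only [Finset.mem_sigma, Finset.mem_product, Finset.mem_univ, true_and,
      Finset.mem_powerset, sqfSet, Finset.mem_filter, Finset.mem_range, Nat.lt_ceil]
    refine and_congr_right fun hG => ?_
    have hG' : Odd (primeProd G) := odd_primeProd fun p hp => hB p (hG hp)
    have h0 : 0 < (twoDisc x : ℝ) * primeProd G := by
      have := twoDisc_pos x
      have := primeProd_pos G
      positivity
    have hX : (m : ℝ) < X / (twoDisc x * primeProd G) ↔
        ((twoDisc x * (primeProd G * m) : ℕ) : ℝ) < X := by
      rw [lt_div_iff₀ h0]
      push_cast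
      rw [mul_comm, mul_assoc]
    rw [hX, mod_eight_residueClass σ x.2 hG' m]
    have hodd : ((σ : ℤ) * (primeProd G * m : ℕ)) % 8 = 2 * (x.2 : ℕ) + 1 → Odd m := by
      intro h
      rw [← mod_eight_residueClass σ x.2 hG' m] at h
      have := residueClass_odd σ x.2 hG'
      rw [Nat.odd_iff]
      omega
    tauto
  symm
  refine Finset.sum_bij (fun y _ => radicandOf σ y.1.1.1 y.1.2 y.2) ?_ ?_ ?_ ?_
  · intro y hy
    obtain ⟨h1, h2, h3, h4, h5, h6⟩ := (hmem y).1 hy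
    rw [Set.Finite.mem_toFinset]
    refine ⟨squarefree_radicandOf hB h1 h2 h3 h4, ?_, ?_⟩
    · rw [fundDisc_radicandOf σ y.1.1 h5]
      have := twoDisc_pos y.1.1
      have := primeProd_pos y.1.2
      have := h2.pos
      positivity
    · rw [fundDisc_radicandOf σ y.1.1 h5]
      exact_mod_cast h6
  · rintro ⟨⟨⟨i, k⟩, G⟩, m⟩ hy ⟨⟨⟨i', k'⟩, G'⟩, m'⟩ hy' h
    obtain ⟨h1, h2, h3, -, h5, -⟩ := (hmem _).1 hy
    obtain ⟨h1', h2', h3', -, h5', -⟩ := (hmem _).1 hy'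
    obtain ⟨rfl, rfl, rfl⟩ := radicandOf_inj hB h1 h1' h2 h2' h3 h3' h
    have : k = k' := by
      apply Fin.ext
      simp only at h5 h5'
      omega
    rw [this]
  · intro n hn
    rw [Set.Finite.mem_toFinset] at hn
    obtain ⟨hsf, h0, hX⟩ := hn
    obtain ⟨i, G, m, h1, h2, h3, h4, rfl⟩ :=
      exists_radicandOf (oddBad S) hsf ((units_mul_pos_iff σ n).1 h0)
    have hodd : Odd ((σ : ℤ) * (primeProd G * m : ℕ)) :=
      odd_units_mul σ ((odd_primeProd fun p hp => hB p (h1 hp)).mul h2)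
    rw [Int.odd_iff] at hodd
    obtain ⟨k, hk⟩ : ∃ k : Fin 4,
        ((σ : ℤ) * (primeProd G * m : ℕ)) % 8 = 2 * (k : ℕ) + 1 := by
      refine ⟨⟨((((σ : ℤ) * (primeProd G * m : ℕ)) % 8).toNat) / 2, by omega⟩, ?_⟩
      simp only
      omega
    refine ⟨⟨((i, k), G), m⟩, (hmem _).2 ⟨h1, h2, h3, h4, hk, ?_⟩, rfl⟩
    rw [fundDisc_radicandOf σ (i, k) hk] at hX
    exact_mod_cast hX
  · intro y hy
    obtain ⟨-, h2, h3, -, h5, -⟩ := (hmem y).1 hy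
    exact (indicator_eq_prod S σ y.1.1 h3 h2.pos.ne' h5).symm

end QuadCount

end

/-! ### The main term as a product of densities, and the error as a product of local factors. -/

noncomputable section

namespace QuadCount

/-- Choosing `G` means choosing the parity of the valuation independently at each prime of `B`. -/
theorem sum_powerset_prod_memBool (B : Finset Nat.Primes) (h : Nat.Primes → Bool → ℝ) :
    ∑ G ∈ B.powerset, ∏ p ∈ B, h p (memBool p G) = ∏ p ∈ B, (h p false + h p true) := by
  classical
  simp_rw [add_comm (h _ false)]
  rw [Finset.prod_add]
  refine Finset.sum_congr rfl fun G hG => ?_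
  rw [← Finset.prod_sdiff (Finset.mem_powerset.1 hG), mul_comm]
  congr 1
  · exact Finset.prod_congr rfl fun p hp => by rw [memBool_of_mem hp]
  · exact Finset.prod_congr rfl fun p hp => by rw [memBool_of_notMem (Finset.mem_sdiff.1 hp).2]

theorem prod_pow_memBool {B G : Finset Nat.Primes} (hG : G ⊆ B) (f : Nat.Primes → ℝ) :
    ∏ p ∈ B, f p ^ (memBool p G).toNat = ∏ p ∈ G, f p := by
  classical
  rw [← Finset.prod_sdiff hG, Finset.prod_eq_one, one_mul]
  · exact Finset.prod_congr rfl fun p hp => by rw [memBool_of_mem hp, Bool.toNat_true, pow_one]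
  · intro p hp
    rw [memBool_of_notMem (Finset.mem_sdiff.1 hp).2, Bool.toNat_false, pow_zero]

/-- The factor at `p` of the error term. -/
def errorFactor (η : ℝ) (S : CubicSpec) (p : Nat.Primes) (j : Bool) : ℝ :=
  2 * (|oddMean S p j| + |oddDiff S p j| * ((p : ℕ) : ℝ) ^ (1 / 4 + η / 2)) *
    (Real.sqrt (p : ℕ) ^ j.toNat)⁻¹

/-- The range is `Y = X / (twoDisc x · ∏ G)`, so each `p ∈ G` contributes `1/p` to the main term and
`p^(-1/2)` to the error. The twists have absolute value `1` and disappear. -/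
theorem abs_innerSum_sub_le {η : ℝ} (hη : 0 < η) (S : CubicSpec) (σ : ℤˣ) {X : ℝ} (hX : 0 < X)
    (x : Bool × Fin 4) {G : Finset Nat.Primes} (hG : G ⊆ oddBad S) :
    |innerSum S σ X x G - X / Real.pi ^ 2 * (1 / (twoDisc x : ℝ)) *
        ∏ p ∈ oddBad S, (oddMean S p (memBool p G) * (1 + 1 / ((p : ℕ) : ℝ))⁻¹ *
          (((p : ℕ) : ℝ) ^ (memBool p G).toNat)⁻¹)| ≤
      4 * Real.sqrt (1 + 1 / η) * Real.sqrt X *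
        ∏ p ∈ oddBad S, errorFactor η S p (memBool p G) := by
  have hB : ∀ p ∈ oddBad S, (p : ℕ) ≠ 2 := fun p hp => (mem_oddBad.1 hp).1
  have hδ := twoDisc_pos x
  have hg := primeProd_pos G
  have hδ1 : (1 : ℝ) ≤ twoDisc x := by exact_mod_cast hδ
  have h := abs_sum_prod_sub_le hη hB (fun p => oddMean S p (memBool p G))
    (fun p => oddDiff S p (memBool p G) * twist σ x.1 G p) (residueClass_lt σ x.2 G)
    (residueClass_odd σ x.2 (odd_primeProd fun p hp => hB p (hG hp)))
    (Y := X / (twoDisc x * primeProd G)) (by positivity)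
  have hgp : (primeProd G : ℝ) = ∏ p ∈ oddBad S, ((p : ℕ) : ℝ) ^ (memBool p G).toNat := by
    rw [prod_pow_memBool hG, primeProd, Nat.cast_prod]
  have hgs : Real.sqrt (primeProd G) =
      ∏ p ∈ oddBad S, Real.sqrt (p : ℕ) ^ (memBool p G).toNat := by
    rw [prod_pow_memBool hG, primeProd, Nat.cast_prod, Real.sqrt_prod]
    intros
    positivity
  have hmain : X / Real.pi ^ 2 * (1 / (twoDisc x : ℝ)) *
        ∏ p ∈ oddBad S, (oddMean S p (memBool p G) * (1 + 1 / ((p : ℕ) : ℝ))⁻¹ *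
          (((p : ℕ) : ℝ) ^ (memBool p G).toNat)⁻¹) =
      X / (twoDisc x * primeProd G) / Real.pi ^ 2 *
        ∏ p ∈ oddBad S, (oddMean S p (memBool p G) * (1 + 1 / ((p : ℕ) : ℝ))⁻¹) := by
    rw [Finset.prod_mul_distrib, Finset.prod_inv_distrib, ← hgp]
    field_simp
  rw [hmain]
  refine h.trans ?_
  have hprod : ∏ p ∈ oddBad S, (2 * (|oddMean S p (memBool p G)| +
      |oddDiff S p (memBool p G) * twist σ x.1 G p| * ((p : ℕ) : ℝ) ^ (1 / 4 + η / 2))) =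
      Real.sqrt (primeProd G) * ∏ p ∈ oddBad S, errorFactor η S p (memBool p G) := by
    rw [hgs, ← Finset.prod_mul_distrib]
    refine Finset.prod_congr rfl fun p hp => ?_
    have h0 : 0 < Real.sqrt (p : ℕ) := Real.sqrt_pos.2 (by exact_mod_cast p.2.pos)
    rw [abs_mul, abs_twist (hB p hp), mul_one, errorFactor]
    field_simp
  rw [hprod, ← mul_assoc]
  have hE : 0 ≤ ∏ p ∈ oddBad S, errorFactor η S p (memBool p G) :=
    Finset.prod_nonneg fun p _ => by unfold errorFactor; positivity
  refine mul_le_mul_of_nonneg_right ?_ hE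
  rw [mul_assoc]
  refine mul_le_mul_of_nonneg_left ?_ (by positivity)
  rw [← Real.sqrt_mul (by positivity)]
  apply Real.sqrt_le_sqrt
  rw [div_mul_eq_mul_div, div_le_iff₀ (by positivity)]
  have : X * (primeProd G : ℝ) ≤ X * (primeProd G : ℝ) * twoDisc x :=
    le_mul_of_one_le_right (by positivity) hδ1
  linarith

theorem localDensity_eq_of_ne_two (S : CubicSpec) {p : Nat.Primes} (hp : (p : ℕ) ≠ 2) :
    localDensity (S.loc p) = (oddMean S p false + oddMean S p true / ((p : ℕ) : ℝ)) *
      (1 + 1 / ((p : ℕ) : ℝ))⁻¹ := by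
  classical
  have h0 : (0 : ℝ) < (p : ℕ) := by exact_mod_cast p.2.pos
  rw [localDensity_odd hp, div_eq_mul_inv]
  congr 1
  rw [Fintype.sum_prod_type]
  simp only [Fintype.sum_bool, oddMean, oddInd, Bool.toNat_true, Bool.toNat_false, pow_one, pow_zero]
  split_ifs <;> field_simp <;> ring

theorem localDensity_eq_one (S : CubicSpec) {p : Nat.Primes} (hp : (p : ℕ) ≠ 2)
    (h : IsOrdinary (S.loc p)) : localDensity (S.loc p) = 1 := by
  have h0 : (0 : ℝ) < (p : ℕ) := by exact_mod_cast p.2.pos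
  have h1 : ∀ x, oddInd S p x = 1 := fun x => if_pos (prodBase_mem_of_isOrdinary h _)
  rw [localDensity_eq_of_ne_two S hp, oddMean, oddMean, h1, h1, h1, h1]
  field_simp
  ring

theorem finprod_localDensity (S : CubicSpec) : ∏ᶠ p : Nat.Primes, localDensity (S.loc p) =
    (∑ x, twoInd S x * (1 / (twoDisc x : ℝ))) / 3 *
      ∏ p ∈ oddBad S, ((oddMean S p false + oddMean S p true / ((p : ℕ) : ℝ)) *
        (1 + 1 / ((p : ℕ) : ℝ))⁻¹) := by
  classical
  have h2 : primeTwo ∉ oddBad S := fun h => (mem_oddBad.1 h).1 rfl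
  rw [finprod_eq_prod_of_mulSupport_subset (s := insert primeTwo (oddBad S)), Finset.prod_insert h2]
  · congr 1
    · refine (localDensity_two (S.loc primeTwo)).trans ?_
      congr 1
      refine Finset.sum_congr rfl fun x _ => ?_
      rw [twoInd, boole_mul]
    · exact Finset.prod_congr rfl fun p hp => localDensity_eq_of_ne_two S (mem_oddBad.1 hp).1
  · intro p hp
    rw [Function.mem_mulSupport] at hp
    rw [Finset.coe_insert, Set.mem_insert_iff, Finset.mem_coe]
    by_contra! hn
    apply hp
    have hp2 : (p : ℕ) ≠ 2 := fun h => hn.1 (Subtype.ext h)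
    apply localDensity_eq_one S hp2
    by_contra hord
    exact hn.2 (mem_oddBad.2 ⟨hp2, hord⟩)

/-- Summed over the classes at `2` and over `G`, the main terms factor into local densities; the `3`
in `3/π²` cancels the denominator of the density at `2`. The constant is `32 = 8 · 4`, with one
summand for each class at `2`. -/
theorem abs_fullRadicands_sub_le {η : ℝ} (hη : 0 < η) (S : CubicSpec) (σ : ℤˣ) {X : ℝ}
    (hX : 0 < X) : |((fullRadicands σ X S).ncard : ℝ) -
        (∏ᶠ p : Nat.Primes, localDensity (S.loc p)) * (3 / Real.pi ^ 2) * X| ≤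
      32 * Real.sqrt (1 + 1 / η) * Real.sqrt X *
        ∏ p ∈ oddBad S, (errorFactor η S p false + errorFactor η S p true) := by
  set B := oddBad S
  have hmain : (∏ᶠ p : Nat.Primes, localDensity (S.loc p)) * (3 / Real.pi ^ 2) * X =
      ∑ x : Bool × Fin 4, twoInd S x * ∑ G ∈ B.powerset,
        X / Real.pi ^ 2 * (1 / (twoDisc x : ℝ)) *
        ∏ p ∈ B, (oddMean S p (memBool p G) * (1 + 1 / ((p : ℕ) : ℝ))⁻¹ *
          (((p : ℕ) : ℝ) ^ (memBool p G).toNat)⁻¹) := by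
    simp_rw [← Finset.mul_sum]
    rw [sum_powerset_prod_memBool B (fun p j => oddMean S p j * (1 + 1 / ((p : ℕ) : ℝ))⁻¹ *
          (((p : ℕ) : ℝ) ^ j.toNat)⁻¹)]
    have hP : ∏ p ∈ B, ((oddMean S p false + oddMean S p true / ((p : ℕ) : ℝ)) *
        (1 + 1 / ((p : ℕ) : ℝ))⁻¹) = ∏ p ∈ B, (oddMean S p false * (1 + 1 / ((p : ℕ) : ℝ))⁻¹ *
          (((p : ℕ) : ℝ) ^ false.toNat)⁻¹ + oddMean S p true * (1 + 1 / ((p : ℕ) : ℝ))⁻¹ *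
          (((p : ℕ) : ℝ) ^ true.toNat)⁻¹) := by
      refine Finset.prod_congr rfl fun p _ => ?_
      simp only [Bool.toNat_true, Bool.toNat_false, pow_one, pow_zero]
      ring
    rw [finprod_localDensity, hP, Finset.sum_div, Finset.sum_mul, Finset.sum_mul, Finset.sum_mul]
    refine Finset.sum_congr rfl fun x _ => ?_
    ring
  rw [fullRadicands_ncard, hmain, ← Finset.sum_sub_distrib]
  refine (Finset.abs_sum_le_sum_abs _ _).trans ?_
  have hE : 0 ≤ ∏ p ∈ B, (errorFactor η S p false + errorFactor η S p true) :=
    Finset.prod_nonneg fun p _ => by unfold errorFactor; positivity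
  calc _ ≤ ∑ _x : Bool × Fin 4, 4 * Real.sqrt (1 + 1 / η) * Real.sqrt X *
        ∏ p ∈ B, (errorFactor η S p false + errorFactor η S p true) := by
        refine Finset.sum_le_sum fun x _ => ?_
        rw [← mul_sub, abs_mul, ← Finset.sum_sub_distrib]
        have h1 : |twoInd S x| ≤ 1 := by
          unfold twoInd
          split_ifs <;> simp
        refine (mul_le_of_le_one_left (abs_nonneg _) h1).trans ?_
        refine (Finset.abs_sum_le_sum_abs _ _).trans ?_
        rw [← sum_powerset_prod_memBool, Finset.mul_sum]
        exact Finset.sum_le_sum fun G hG =>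
          abs_innerSum_sub_le hη S σ hX x (Finset.mem_powerset.1 hG)
    _ = _ := by
        rw [Finset.sum_const, Finset.card_univ, Fintype.card_prod, Fintype.card_bool,
          Fintype.card_fin, nsmul_eq_mul]
        push_cast
        ring

end QuadCount

end

/-! ### Comparison of the local error factors with `U`, `s` and `r`. -/

noncomputable section

namespace QuadCount

theorem exists_toClass_eq {K : Type} [Field K] {n : ℕ} (c : EtaleClass K n) :
    ∃ F : EtaleAlgebra K n, F.toClass = c := Quotient.exists_rep c

theorem hasUnramified_of_oddClass_mem {p : ℕ} [Fact p.Prime] (hp : p ≠ 2)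
    {T : Set (EtaleClass ℚ_[p] 3)} {s : Bool} (h : (oddClass p (false, s)).prodBase ∈ T) :
    HasUnramified T := by
  obtain ⟨F, hF⟩ := exists_toClass_eq (oddClass p (false, s))
  refine ⟨F.prodBase, (isUnramified_of_oddClass hp hF).2, ?_⟩
  rw [← hF] at h
  exact h

theorem toClass_eq_of_prodBase {p : ℕ} [Fact p.Prime] {F : EtaleAlgebra ℚ_[p] 2}
    {c : EtaleClass ℚ_[p] 2} (h : F.prodBase.toClass = c.prodBase) : F.toClass = c := by
  have h' : F.toClass.prodBase = c.prodBase := h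
  exact prodBase_injective h'

theorem not_isSingleRamified_of_oddClass_mem {p : ℕ} [Fact p.Prime] (hp : p ≠ 2)
    {T : Set (EtaleClass ℚ_[p] 3)} {s : Bool} (h : (oddClass p (false, s)).prodBase ∈ T) :
    ¬ IsSingleRamified T := by
  rintro ⟨F, hF, rfl⟩
  exact hF (isUnramified_of_oddClass hp (toClass_eq_of_prodBase (Set.mem_singleton_iff.1 h).symm)).1

theorem not_isAllRamified_of_oddClass_mem {p : ℕ} [Fact p.Prime] (hp : p ≠ 2)
    {T : Set (EtaleClass ℚ_[p] 3)} {s : Bool} (h : (oddClass p (false, s)).prodBase ∈ T) :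
    ¬ IsAllRamified T := by
  rintro rfl
  obtain ⟨F, hF, hF'⟩ := h
  exact hF (isUnramified_of_oddClass hp (toClass_eq_of_prodBase hF')).1

theorem oddClass_mem_of_isAllRamified {p : ℕ} [Fact p.Prime] (hp : p ≠ 2)
    {T : Set (EtaleClass ℚ_[p] 3)} (hT : IsAllRamified T) (s : Bool) :
    (oddClass p (true, s)).prodBase ∈ T := by
  obtain ⟨F, hF⟩ := exists_toClass_eq (oddClass p (true, s))
  rw [hT, ← hF]
  exact ⟨F, not_isUnramified_of_oddClass hp hF, rfl⟩

/-- An odd prime has two distinct ramified quadratic classes. -/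
theorem not_isAllRamified_of_isSingleRamified {p : ℕ} [Fact p.Prime] (hp : p ≠ 2)
    {T : Set (EtaleClass ℚ_[p] 3)} (hT : IsSingleRamified T) : ¬ IsAllRamified T := by
  intro h
  have h1 := oddClass_mem_of_isAllRamified hp h true
  have h2 := oddClass_mem_of_isAllRamified hp h false
  obtain ⟨F, -, rfl⟩ := hT
  have h3 := (oddClass_bijective hp).1
    (prodBase_injective ((Set.mem_singleton_iff.1 h1).trans (Set.mem_singleton_iff.1 h2).symm))
  simp at h3

theorem abs_oddMean_add_abs_oddDiff_le (S : CubicSpec) (p : Nat.Primes) (j : Bool) :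
    |oddMean S p j| + |oddDiff S p j| ≤ 1 := by
  unfold oddMean oddDiff oddInd
  split_ifs <;> norm_num

theorem errorFactor_le {η : ℝ} (hη : 0 < η) (S : CubicSpec) (p : Nat.Primes) (j : Bool) :
    errorFactor η S p j ≤
      2 * ((p : ℕ) : ℝ) ^ (1 / 4 + η / 2) * (Real.sqrt (p : ℕ) ^ j.toNat)⁻¹ := by
  unfold errorFactor
  have h1 : (1 : ℝ) ≤ (p : ℕ) := by exact_mod_cast p.2.one_lt.le
  have h2 : 1 ≤ ((p : ℕ) : ℝ) ^ (1 / 4 + η / 2) := Real.one_le_rpow h1 (by positivity)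
  refine mul_le_mul_of_nonneg_right ?_ (by positivity)
  have h3 := abs_oddMean_add_abs_oddDiff_le S p j
  nlinarith [abs_nonneg (oddMean S p j), abs_nonneg (oddDiff S p j)]

open Classical in
/-- The power `p ^ t` if `Q` holds, and `1` otherwise. -/
def condPow (Q : Prop) (p : Nat.Primes) (t : ℝ) : ℝ := if Q then ((p : ℕ) : ℝ) ^ t else 1

theorem condPow_of {Q : Prop} (h : Q) (p : Nat.Primes) (t : ℝ) :
    condPow Q p t = ((p : ℕ) : ℝ) ^ t := if_pos h

theorem condPow_of_not {Q : Prop} (h : ¬ Q) (p : Nat.Primes) (t : ℝ) : condPow Q p t = 1 := if_neg h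

theorem one_le_prime (p : Nat.Primes) : (1 : ℝ) ≤ (p : ℕ) := by exact_mod_cast p.2.one_lt.le

theorem one_le_condPow (Q : Prop) (p : Nat.Primes) {t : ℝ} (ht : 0 ≤ t) : 1 ≤ condPow Q p t := by
  unfold condPow
  split_ifs
  · exact Real.one_le_rpow (one_le_prime p) ht
  · exact le_rfl

theorem condPow_le (Q : Prop) (p : Nat.Primes) {t : ℝ} (ht : 0 ≤ t) :
    condPow Q p t ≤ ((p : ℕ) : ℝ) ^ t := by
  unfold condPow
  split_ifs
  · exact le_rfl
  · exact Real.one_le_rpow (one_le_prime p) ht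

/-- The factor at `p` of the error term in the theorem. -/
def targetFactor (ε : ℝ) (S : CubicSpec) (p : Nat.Primes) : ℝ :=
  condPow (HasUnramified (S.loc p)) p (1 / 4) / (condPow (IsSingleRamified (S.loc p)) p (1 / 4) *
    condPow (IsAllRamified (S.loc p)) p (1 / 2)) *
    (condPow (HasUnramified (S.loc p)) p ε * condPow (IsSingleRamified (S.loc p)) p ε *
      condPow (IsAllRamified (S.loc p)) p ε)

theorem condPow_pos (Q : Prop) (p : Nat.Primes) (t : ℝ) : 0 < condPow Q p t := by
  have := one_le_prime p
  unfold condPow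
  split_ifs <;> positivity

theorem targetFactor_pos (ε : ℝ) (S : CubicSpec) (p : Nat.Primes) : 0 < targetFactor ε S p := by
  unfold targetFactor
  have := condPow_pos
  exact mul_pos (div_pos (this _ _ _) (mul_pos (this _ _ _) (this _ _ _)))
    (mul_pos (mul_pos (this _ _ _) (this _ _ _)) (this _ _ _))

theorem le_targetFactor {ε : ℝ} (S : CubicSpec) (p : Nat.Primes) {a b c d : ℝ}
    (hd : 0 ≤ d)
    (hu : a ≤ condPow (HasUnramified (S.loc p)) p (1 / 4))
    (hs : condPow (IsSingleRamified (S.loc p)) p (1 / 4) ≤ b)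
    (hr : condPow (IsAllRamified (S.loc p)) p (1 / 2) ≤ c)
    (he : d ≤ condPow (HasUnramified (S.loc p)) p ε * condPow (IsSingleRamified (S.loc p)) p ε *
      condPow (IsAllRamified (S.loc p)) p ε) :
    a / (b * c) * d ≤ targetFactor ε S p := by
  unfold targetFactor
  have h0 := condPow_pos
  refine mul_le_mul ?_ he hd (div_pos (h0 _ _ _) (mul_pos (h0 _ _ _) (h0 _ _ _))).le
  refine div_le_div₀ (h0 _ _ _).le hu (mul_pos (h0 _ _ _) (h0 _ _ _)) ?_
  exact mul_le_mul hs hr (h0 _ _ _).le ((h0 _ _ _).le.trans hs)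

theorem errorFactor_add_le {ε η : ℝ} (hη : 0 < η) (hηε : η ≤ ε / 2) (hη8 : η ≤ 1 / 8)
    (S : CubicSpec) {p : Nat.Primes} (hp : (p : ℕ) ≠ 2) :
    errorFactor η S p false + errorFactor η S p true ≤
      4 * ((p : ℕ) : ℝ) ^ (-η) * targetFactor ε S p := by
  have hε : 0 < ε := by linarith
  have h1 := one_le_prime p
  have h0 : (0 : ℝ) < (p : ℕ) := by linarith
  have hsq : (Real.sqrt (p : ℕ))⁻¹ = ((p : ℕ) : ℝ) ^ (-(1 / 2) : ℝ) := by
    rw [Real.sqrt_eq_rpow, Real.rpow_neg h0.le]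
  have hE1 : errorFactor η S p true ≤ 2 * ((p : ℕ) : ℝ) ^ (-(1 / 4) + η / 2) := by
    refine (errorFactor_le hη S p true).trans_eq ?_
    rw [Bool.toNat_true, pow_one, hsq, mul_assoc, ← Real.rpow_add h0]
    congr 2
    ring
  have hE0 : errorFactor η S p false ≤ 2 * ((p : ℕ) : ℝ) ^ (1 / 4 + η / 2) := by
    refine (errorFactor_le hη S p false).trans_eq ?_
    rw [Bool.toNat_false, pow_zero, inv_one, mul_one]
  have hzero : (∀ s, (oddClass (p : ℕ) (false, s)).prodBase ∉ S.loc p) →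
      errorFactor η S p false = 0 := by
    intro h
    have h2 : ∀ s, oddInd S p (false, s) = 0 := fun s => if_neg (h s)
    simp [errorFactor, oddMean, oddDiff, h2]
  -- Every case bounds the error by `c p^t` and the target below by `p^v`; the gap `t ≤ v - η` pays
  -- for the factor `p^(-η)`.
  have hmono : ∀ {c t v : ℝ}, 0 ≤ c → c ≤ 4 → t ≤ v - η →
      ((p : ℕ) : ℝ) ^ v ≤ targetFactor ε S p →
      c * ((p : ℕ) : ℝ) ^ t ≤ 4 * ((p : ℕ) : ℝ) ^ (-η) * targetFactor ε S p := by
    intro c t v hc hc4 ht hv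
    calc c * ((p : ℕ) : ℝ) ^ t ≤ 4 * ((p : ℕ) : ℝ) ^ (-η + v) :=
          mul_le_mul hc4 (Real.rpow_le_rpow_of_exponent_le h1 (by linarith)) (by positivity)
            (by norm_num)
      _ = 4 * ((p : ℕ) : ℝ) ^ (-η) * ((p : ℕ) : ℝ) ^ v := by rw [Real.rpow_add h0, mul_assoc]
      _ ≤ _ := mul_le_mul_of_nonneg_left hv (by positivity)
  have hUε := one_le_condPow (HasUnramified (S.loc p)) p hε.le
  have hSε := one_le_condPow (IsSingleRamified (S.loc p)) p hε.le
  have hRε := one_le_condPow (IsAllRamified (S.loc p)) p hε.le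
  have hU := one_le_condPow (HasUnramified (S.loc p)) p (t := 1 / 4) (by norm_num)
  have hpε : 0 ≤ ((p : ℕ) : ℝ) ^ ε := by positivity
  -- If all ramified classes are allowed, `oddDiff` vanishes: no character appears and only
  -- `p^(-1/2)` is left.
  by_cases hr : IsAllRamified (S.loc p)
  · have hs : ¬ IsSingleRamified (S.loc p) := fun hs =>
      not_isAllRamified_of_isSingleRamified hp hs hr
    rw [hzero fun s h => not_isAllRamified_of_oddClass_mem hp h hr, zero_add]
    have h2 : ∀ s, oddInd S p (true, s) = 1 := fun s => if_pos (oddClass_mem_of_isAllRamified hp hr s)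
    have h3 : errorFactor η S p true = 2 * ((p : ℕ) : ℝ) ^ (-(1 / 2) : ℝ) := by
      rw [← hsq]
      simp [errorFactor, oddMean, oddDiff, h2]
    rw [h3]
    refine hmono (v := -(1 / 2) + ε) (by norm_num) (by norm_num) (by linarith) ?_
    refine le_trans (le_of_eq ?_) (le_targetFactor S p hpε hU
      (condPow_of_not hs p _).le (condPow_of hr p _).le ?_)
    · rw [Real.rpow_add h0, Real.rpow_neg h0.le, one_mul, ← one_div]
    · rw [condPow_of_not hs, condPow_of hr]
      nlinarith
  -- A single ramified class keeps the character, with exponent `1/4 - 1/2 = -1/4`.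
  by_cases hs : IsSingleRamified (S.loc p)
  · rw [hzero fun s h => not_isSingleRamified_of_oddClass_mem hp h hs, zero_add]
    refine hE1.trans (hmono (v := -(1 / 4) + ε) (by norm_num) (by norm_num) (by linarith) ?_)
    refine le_trans (le_of_eq ?_) (le_targetFactor S p hpε hU
      (condPow_of hs p _).le (condPow_of_not hr p _).le ?_)
    · rw [Real.rpow_add h0, Real.rpow_neg h0.le, mul_one, ← one_div]
    · rw [condPow_of_not hr, condPow_of hs]
      nlinarith
  -- Otherwise the unramified classes dominate with `p^(1/4)`, or are absent, and then `-1/4 + η/2 ≤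
  -- -η` because `η ≤ 1/8`.
  by_cases hu : HasUnramified (S.loc p)
  · have h3 : ((p : ℕ) : ℝ) ^ (-(1 / 4) + η / 2) ≤ ((p : ℕ) : ℝ) ^ (1 / 4 + η / 2) :=
      Real.rpow_le_rpow_of_exponent_le h1 (by linarith)
    refine le_trans (b := 4 * ((p : ℕ) : ℝ) ^ (1 / 4 + η / 2)) (by linarith)
      (hmono (v := 1 / 4 + ε) (by norm_num) (by norm_num) (by linarith) ?_)
    refine le_trans (le_of_eq ?_) (le_targetFactor S p hpε
      (condPow_of hu p _).ge (condPow_of_not hs p _).le (condPow_of_not hr p _).le ?_)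
    · rw [Real.rpow_add h0]
      ring
    · rw [condPow_of_not hr, condPow_of_not hs, condPow_of hu]
      linarith
  · rw [hzero fun s h => hu (hasUnramified_of_oddClass_mem hp h), zero_add]
    refine hE1.trans (hmono (v := 0) (by norm_num) (by norm_num) (by linarith) ?_)
    refine le_trans (le_of_eq ?_) (le_targetFactor S p zero_le_one hU
      (condPow_of_not hs p _).le (condPow_of_not hr p _).le ?_)
    · rw [Real.rpow_zero]
      norm_num
    · rw [condPow_of_not hr, condPow_of_not hs, condPow_of_not hu]
      norm_num

/-- Only primes below `4^(1/η)` have `4 p^(-η) > 1`, so the bound does not depend on `B`. -/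
theorem prod_four_mul_rpow_le {η : ℝ} (hη : 0 < η) (B : Finset Nat.Primes) :
    ∏ p ∈ B, (4 * ((p : ℕ) : ℝ) ^ (-η)) ≤ 4 ^ ⌈(4 : ℝ) ^ (1 / η)⌉₊ := by
  set L := ⌈(4 : ℝ) ^ (1 / η)⌉₊
  calc ∏ p ∈ B, (4 * ((p : ℕ) : ℝ) ^ (-η)) ≤ ∏ p ∈ B, (if (p : ℕ) < L then (4 : ℝ) else 1) := by
        refine Finset.prod_le_prod (fun p _ => by positivity) fun p _ => ?_
        have h1 := one_le_prime p
        split_ifs with h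
        · have := Real.rpow_le_one_of_one_le_of_nonpos h1 (by linarith : -η ≤ 0)
          linarith
        · rw [not_lt] at h
          have h2 : (4 : ℝ) ^ (1 / η) ≤ (p : ℕ) := (Nat.le_ceil _).trans (by exact_mod_cast h)
          have h3 : (4 : ℝ) ≤ ((p : ℕ) : ℝ) ^ η := by
            calc (4 : ℝ) = ((4 : ℝ) ^ (1 / η)) ^ η := by
                  rw [← Real.rpow_mul (by norm_num), one_div_mul_cancel hη.ne', Real.rpow_one]
              _ ≤ _ := Real.rpow_le_rpow (by positivity) h2 hη.le
          rw [Real.rpow_neg (by linarith), ← div_eq_mul_inv, div_le_one (by linarith)]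
          exact h3
    _ = 4 ^ (B.filter fun p : Nat.Primes => (p : ℕ) < L).card := by
        rw [← Finset.prod_filter, Finset.prod_const]
    _ ≤ 4 ^ L := by
        apply pow_le_pow_right₀ (by norm_num)
        rw [← Finset.card_range L]
        refine Finset.card_le_card_of_injOn (fun p => (p : ℕ)) ?_ ?_
        · intro p hp
          have := (Finset.mem_filter.1 hp).2
          simpa using this
        · intro p _ q _ h
          exact Subtype.ext h

theorem rpow_finprod_bad (S : CubicSpec) (Q : Nat.Primes → Prop) (t : ℝ) :
    (((∏ᶠ (p : Nat.Primes) (_ : p ∈ S.badPrimes ∧ Q p), (p : ℕ) : ℕ) : ℝ)) ^ t =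
      ∏ p ∈ S.finite_not_ordinary.toFinset, condPow (Q p) p t := by
  classical
  have h : ∏ᶠ (p : Nat.Primes) (_ : p ∈ S.badPrimes ∧ Q p), (p : ℕ) =
      ∏ p ∈ S.finite_not_ordinary.toFinset.filter Q, (p : ℕ) := by
    apply finprod_cond_eq_prod_of_cond_iff
    intro p _
    rw [Finset.mem_filter, Set.Finite.mem_toFinset]
    rfl
  rw [h, Nat.cast_prod, ← Real.finsetProd_rpow _ _ (fun _ _ => by positivity), Finset.prod_filter]
  refine Finset.prod_congr rfl fun p _ => ?_
  unfold condPow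
  congr

theorem target_eq_prod (ε : ℝ) (S : CubicSpec) :
    ((S.U : ℝ) ^ (1 / 4 : ℝ) / ((S.s : ℝ) ^ (1 / 4 : ℝ) * (S.r : ℝ) ^ (1 / 2 : ℝ))) *
          ((S.U : ℝ) * S.s * S.r) ^ ε =
      ∏ p ∈ S.finite_not_ordinary.toFinset, targetFactor ε S p := by
  rw [Real.mul_rpow (by positivity) (by positivity), Real.mul_rpow (by positivity) (by positivity)]
  unfold CubicSpec.U CubicSpec.s CubicSpec.r targetFactor
  simp only [rpow_finprod_bad S]
  simp only [Finset.prod_mul_distrib, Finset.prod_div_distrib]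

/-- No case analysis is needed at `2`: even if both ramified conditions held, the factor would be at
least `2^(-3/4)`. -/
theorem half_le_targetFactor_two {ε : ℝ} (hε : 0 < ε) (S : CubicSpec) :
    1 / 2 ≤ targetFactor ε S primeTwo := by
  have h2 : ((primeTwo : ℕ) : ℝ) = 2 := by norm_num
  have h := le_targetFactor S primeTwo zero_le_one
    (one_le_condPow _ primeTwo (by norm_num)) (condPow_le _ primeTwo (by norm_num))
    (condPow_le _ primeTwo (by norm_num))
    (one_le_mul_of_one_le_of_one_le (one_le_mul_of_one_le_of_one_le
      (one_le_condPow _ primeTwo hε.le) (one_le_condPow _ primeTwo hε.le))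
      (one_le_condPow _ primeTwo hε.le))
  refine le_trans ?_ h
  rw [mul_one, h2, ← Real.rpow_add (by norm_num)]
  apply one_div_le_one_div_of_le (by positivity)
  calc (2 : ℝ) ^ (1 / 4 + 1 / 2 : ℝ) ≤ 2 ^ (1 : ℝ) :=
        Real.rpow_le_rpow_of_exponent_le (by norm_num) (by norm_num)
    _ = 2 := Real.rpow_one 2

theorem prod_oddBad_targetFactor_le {ε : ℝ} (hε : 0 < ε) (S : CubicSpec) :
    ∏ p ∈ oddBad S, targetFactor ε S p ≤
      2 * ∏ p ∈ S.finite_not_ordinary.toFinset, targetFactor ε S p := by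
  classical
  have h0 : 0 < ∏ p ∈ oddBad S, targetFactor ε S p :=
    Finset.prod_pos fun p _ => targetFactor_pos ε S p
  have hB : oddBad S = S.finite_not_ordinary.toFinset.erase primeTwo := by
    unfold oddBad
    congr
  by_cases h : primeTwo ∈ S.finite_not_ordinary.toFinset
  · rw [← Finset.mul_prod_erase _ _ h, ← hB]
    have := half_le_targetFactor_two hε S
    nlinarith
  · rw [Finset.erase_eq_of_notMem h] at hB
    rw [← hB]
    linarith

/-- The radicand `1` stands for `ℚ × ℚ`, which is unramified at `p`; then `Σ_p` is of neither
ramified type. -/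
theorem one_le_targetFactor_of_intSatisfies_one {ε : ℝ} (hε : 0 < ε) {S : CubicSpec}
    (hS : IntSatisfies S 1) {p : Nat.Primes} (hp : (p : ℕ) ≠ 2) : 1 ≤ targetFactor ε S p := by
  obtain ⟨h0, h⟩ := hS
  have h1 : ¬ ((p : ℕ) : ℤ) ∣ 1 := by
    intro h
    exact p.2.one_lt.ne' (by exact_mod_cast Int.eq_one_of_dvd_one (by positivity) h)
  have h2 := h p
  rw [quadClass_intUnit_congr h0 (pow_mul_ne_zero (p : ℕ) h1 false) (by simp),
    quadClass_eq_oddClass hp h1 false] at h2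
  refine le_trans (le_of_eq ?_) (le_targetFactor S p zero_le_one
    (one_le_condPow _ p (by norm_num))
    (condPow_of_not (not_isSingleRamified_of_oddClass_mem hp h2) p _).le
    (condPow_of_not (not_isAllRamified_of_oddClass_mem hp h2) p _).le
    (one_le_mul_of_one_le_of_one_le (one_le_mul_of_one_le_of_one_le
      (one_le_condPow _ p hε.le) (one_le_condPow _ p hε.le)) (one_le_condPow _ p hε.le)))
  norm_num

/-- The counts differ by at most `1`, and only if the radicand `1` qualifies. In that case `X ≥ 1`
and the product of target factors is at least `1/2`. -/
theorem abs_radicands_sub_fullRadicands_le {ε : ℝ} (hε : 0 < ε) (S : CubicSpec) (σ : ℤˣ) (X : ℝ) :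
    |((radicands σ X S).ncard : ℝ) - (fullRadicands σ X S).ncard| ≤
      2 * (Real.sqrt X * ∏ p ∈ S.finite_not_ordinary.toFinset, targetFactor ε S p) := by
  have hsub : radicands σ X S = fullRadicands σ X S \ {1} := by
    ext n
    simp only [radicands, fullRadicands, Set.mem_ofPred_eq, Set.mem_sdiff, Set.mem_singleton_iff]
    tauto
  have hT : 0 ≤ ∏ p ∈ S.finite_not_ordinary.toFinset, targetFactor ε S p :=
    Finset.prod_nonneg fun p _ => (targetFactor_pos ε S p).le
  by_cases h1 : (1 : ℤ) ∈ fullRadicands σ X S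
  · have hc := Set.ncard_sdiff_singleton_add_one h1 (fullRadicands_finite σ X S)
    rw [← hsub] at hc
    have hc' : ((radicands σ X S).ncard : ℝ) - (fullRadicands σ X S).ncard = -1 := by
      rw [← hc]
      push_cast
      ring
    obtain ⟨-, h2, h3, h4⟩ := h1
    have hX : 1 ≤ X := by
      have h5 : (1 : ℝ) ≤ (((σ : ℤ) * fundDisc 1 : ℤ) : ℝ) := by exact_mod_cast h2
      linarith
    have hsqrt : 1 ≤ Real.sqrt X := Real.one_le_sqrt.2 hX
    have h6 : 1 ≤ ∏ p ∈ oddBad S, targetFactor ε S p :=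
      Finset.one_le_prod fun p hp =>
        one_le_targetFactor_of_intSatisfies_one hε h4 (mem_oddBad.1 hp).1
    have h7 := h6.trans (prod_oddBad_targetFactor_le hε S)
    rw [hc', abs_neg, abs_one]
    nlinarith
  · rw [Set.sdiff_singleton_eq_self h1] at hsub
    rw [hsub, sub_self, abs_zero]
    positivity

end QuadCount

end

theorem proposition4p2 (ε : ℝ) (hε : 0 < ε) :
    ∃ C : ℝ, ∀ (S : QuadCount.CubicSpec) (σ : ℤˣ) (X : ℝ), 0 < X →
      (QuadCount.quadraticFields σ X S).Finite ∧
      |(QuadCount.N₂ σ X S : ℝ) -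
          (∏ᶠ p : Nat.Primes, QuadCount.localDensity (S.loc p)) * (3 / Real.pi ^ 2) * X| ≤
        C * (X ^ (1 / 2 : ℝ) *
          ((S.U : ℝ) ^ (1 / 4 : ℝ) / ((S.s : ℝ) ^ (1 / 4 : ℝ) * (S.r : ℝ) ^ (1 / 2 : ℝ))) *
          ((S.U : ℝ) * S.s * S.r) ^ ε) := by
  obtain ⟨η, hη, hηε, hη8⟩ : ∃ η : ℝ, 0 < η ∧ η ≤ ε / 2 ∧ η ≤ 1 / 8 :=
    ⟨min (ε / 2) (1 / 8), by positivity, min_le_left _ _, min_le_right _ _⟩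
  -- `64 = 2 · 32`, where the `2` restores the prime `2` in the target; the power of `4` comes from
  -- the small primes, and the final `2` from the radicand `1`.
  refine ⟨64 * Real.sqrt (1 + 1 / η) * 4 ^ ⌈(4 : ℝ) ^ (1 / η)⌉₊ + 2, fun S σ X hX => ?_⟩
  obtain ⟨hfin, hN⟩ := QuadCount.quadraticFields_ncard σ X S
  refine ⟨hfin, ?_⟩
  rw [hN, mul_assoc (X ^ (1 / 2 : ℝ)), QuadCount.target_eq_prod, ← Real.sqrt_eq_rpow]
  have h1 := QuadCount.abs_fullRadicands_sub_le hη S σ hX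
  have h2 := QuadCount.abs_radicands_sub_fullRadicands_le hε S σ X
  have h3 := QuadCount.prod_oddBad_targetFactor_le hε S
  have h4 : ∏ p ∈ QuadCount.oddBad S,
      (QuadCount.errorFactor η S p false + QuadCount.errorFactor η S p true) ≤
      4 ^ ⌈(4 : ℝ) ^ (1 / η)⌉₊ * ∏ p ∈ QuadCount.oddBad S, QuadCount.targetFactor ε S p := by
    calc _ ≤ ∏ p ∈ QuadCount.oddBad S,
          (4 * ((p : ℕ) : ℝ) ^ (-η) * QuadCount.targetFactor ε S p) := by
          refine Finset.prod_le_prod (fun p _ => by unfold QuadCount.errorFactor; positivity)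
            fun p hp => ?_
          exact QuadCount.errorFactor_add_le hη hηε hη8 S (QuadCount.mem_oddBad.1 hp).1
      _ ≤ _ := by
          rw [Finset.prod_mul_distrib]
          exact mul_le_mul_of_nonneg_right (QuadCount.prod_four_mul_rpow_le hη _)
            (Finset.prod_nonneg fun p _ => (QuadCount.targetFactor_pos ε S p).le)
  have h5 := h4.trans (mul_le_mul_of_nonneg_left h3 (by positivity))
  have h6 := mul_le_mul_of_nonneg_left h5
    (by positivity : 0 ≤ 32 * Real.sqrt (1 + 1 / η) * Real.sqrt X)
  refine (abs_sub_le _ _ _).trans ((add_le_add h2 (h1.trans h6)).trans (le_of_eq ?_))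
  ring
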